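/- Let $d\ge 3$ and let $\mathcal H$ be a homogeneous foliation of degree $d$ on $\mathbb P^2_{\mathbb C}$, given in affine coordinates $(x,y)$ by $\omega=A(x,y)\,\mathrm dx+B(x,y)\,\mathrm dy$ with $A,B\in\mathbb C[x,y]$ homogeneous of degree $d$ and $\gcd(A,B)=1$. Let $(p,q)$ be the affine chart of the dual plane $\check{\mathbb P}^2_{\mathbb C}$ corresponding to the lines $\{y=px-q\}$. Let $\mathcal G_{\mathcal H}:\mathbb P^2\dashrightarrow\check{\mathbb P}^2$ be the Gauss map, which sends a regular point $m$ of $\mathcal H$ to the tangent line of $\mathcal H$ at $m$, and let $\underline{\mathcal G}_{\mathcal H}:\mathbb P^1\to\mathbb P^1$ be the ramified covering of degree $d$ given by $[y:x]\mapsto[-A(x,y):B(x,y)]$. The Legendre transform $\mathrm{Leg}\,\mathcal H$ is the $d$-web on $\check{\mathbb P}^2$ given by $$A(x,px-q)+p\,B(x,px-q)=0,\qquad x=\frac{\mathrm dq}{\mathrm dp}.$$ For a web which is locally the superposition of pairwise transverse foliations defined by $1$-forms $\omega_1,\dots,\omega_d$, write $\omega_i\wedge\omega_j=\delta_{ij}\,\mathrm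 dp\wedge\mathrm dq$, and for $r<s<t$ let $\eta_{rst}$ be the unique $1$-form with $\mathrm d(\delta_{st}\omega_r)=\eta_{rst}\wedge\delta_{st}\omega_r$, $\mathrm d(\delta_{tr}\omega_s)=\eta_{rst}\wedge\delta_{tr}\omega_s$ and $\mathrm d(\delta_{rs}\omega_t)=\eta_{rst}\wedge\delta_{rs}\omega_t$. The curvature of the web is $\mathrm d\sum_{r<s<t}\eta_{rst}$ (it does not depend on the choice of the $\omega_i$), and the web is flat if its curvature vanishes identically. Assume that $\mathcal H$ is Galois, i.e. that there is a subgroup $G$ of order $d$ of the group $\mathrm{Bir}(\mathbb P^2)$ of birational transformations with $\mathcal G_{\mathcal H}\circ\gamma=\mathcal G_{\mathcal H}$ for all $\gamma\in G$ (equivalently, $\mathcal G_{\mathcal H}$ induces a Galois covering from some non-empty Zariski open set onto its image). Let $\mathrm{Gal}(\underline{\mathcal G}_{\mathcal H})$ be the Galois group of the covering $\underline{\mathcal G}_{\mathcal H}$, i.e. of the associated extension of function fields. Then: - if $\mathrm{Gal}(\underline{\mathcal G}_{\mathcal H})$ is cyclic, then $\mathrm{Leg}\,\mathcal H$ is flat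 if and only if $\mathcal H$ is linearly conjugate (by an element of $\mathrm{GL}_2(\mathbb C)$ acting on $(x,y)$) to one of the two foliations defined by $y^d\,\mathrm dx-x^d\,\mathrm dy$ and $x^d\,\mathrm dx-y^d\,\mathrm dy$; - if $\mathrm{Gal}(\underline{\mathcal G}_{\mathcal H})$ is not cyclic, then $\mathrm{Leg}\,\mathcal H$ is flat. -/

import Mathlib

namespace HomFol

open MvPolynomial

noncomputable section

/-! ### Differential forms on `ℂ²` in coordinates, three-webs, curvature of a web -/

/-- A `1`-form `a du + b dv` on (an open subset of) `ℂ²`, as the map `z ↦ (a z, b z)`. -/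
abbrev OneForm : Type := ℂ × ℂ → ℂ × ℂ

/-- The coefficient of `du ∧ dv` in `α ∧ β`. -/
def wedge (α β : OneForm) (z : ℂ × ℂ) : ℂ :=
  (α z).1 * (β z).2 - (α z).2 * (β z).1

/-- The coefficient `∂b/∂u - ∂a/∂v` of `du ∧ dv` in the exterior derivative of `a du + b dv`. -/
def extD (α : OneForm) (z : ℂ × ℂ) : ℂ :=
  fderiv ℂ (fun w => (α w).2) z (1, 0) - fderiv ℂ (fun w => (α w).1) z (0, 1)

/-- The product of a function and a `1`-form. -/
def mulForm (f : ℂ × ℂ → ℂ) (α : OneForm) : OneForm := fun z => f z • α z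

/-- `η` is, on `V`, the fundamental form of the `3`-web defined by `ω₁, ω₂, ω₃`: with
`ωᵢ ∧ ωⱼ = δᵢⱼ du ∧ dv`, one has `d(δ₂₃ ω₁) = η ∧ δ₂₃ ω₁`, `d(δ₃₁ ω₂) = η ∧ δ₃₁ ω₂` and
`d(δ₁₂ ω₃) = η ∧ δ₁₂ ω₃`. Where the `ωᵢ` are pairwise independent this determines `η`. -/
def IsFundamentalForm₃ (V : Set (ℂ × ℂ)) (ω₁ ω₂ ω₃ η : OneForm) : Prop :=
  ∀ z ∈ V,
    extD (mulForm (wedge ω₂ ω₃) ω₁) z = wedge η (mulForm (wedge ω₂ ω₃) ω₁) z ∧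
    extD (mulForm (wedge ω₃ ω₁) ω₂) z = wedge η (mulForm (wedge ω₃ ω₁) ω₂) z ∧
    extD (mulForm (wedge ω₁ ω₂) ω₃) z = wedge η (mulForm (wedge ω₁ ω₂) ω₃) z

/-- `η` is, on `V`, the fundamental form of the completely decomposable `d`-web defined by
`ω₁, …, ω_d`: the sum over `r < s < t` of the fundamental forms of the `3`-subwebs. -/
def IsFundamentalForm {d : ℕ} (V : Set (ℂ × ℂ)) (ω : Fin d → OneForm) (η : OneForm) : Prop :=
  ∃ e : Fin d → Fin d → Fin d → OneForm,
    (∀ r s t, r < s → s < t → IsFundamentalForm₃ V (ω r) (ω s) (ω t) (e r s t)) ∧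
    ∀ z ∈ V, η z = ∑ r, ∑ s, ∑ t, if r < s ∧ s < t then e r s t z else 0

/-- Flatness of the `d`-web on `ℂ²` (coordinates `(u, v)`) given by an implicit differential
equation `F(u, v, dv/du) = 0`, where `F` is polynomial of degree `d` in `dv/du` with reduced generic
fibre. Wherever the equation has `d` pairwise distinct holomorphic solutions `dv/du = λᵢ(u, v)`,
the web is the superposition of the foliations `dv - λᵢ du = 0`, and its curvature `dη` is required
to vanish there. The points having such a neighbourhood form a dense open set. -/
def IsFlatImplicitWeb (d : ℕ) (F : ℂ × ℂ → ℂ → ℂ) : Prop :=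
  ∀ (V : Set (ℂ × ℂ)) (slope : Fin d → ℂ × ℂ → ℂ), IsOpen V →
    (∀ i, DifferentiableOn ℂ (slope i) V) →
    (∀ z ∈ V, Function.Injective fun i => slope i z) →
    (∀ z ∈ V, ∀ i, F z (slope i z) = 0) →
    ∃ η : OneForm, IsFundamentalForm V (fun i z => (-slope i z, 1)) η ∧
      ∀ z ∈ V, extD η z = 0

/-! ### Homogeneous foliations -/

/-- A homogeneous foliation of degree `d` on `ℙ²`, given in affine coordinates `(x, y)` by the
`1`-form `A dx + B dy` with `A, B ∈ ℂ[x, y]` homogeneous of degree `d` and `gcd(A, B) = 1`.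
The variable `X 0` is `x` and `X 1` is `y`. -/
structure HomogeneousFoliation (d : ℕ) where
  A : MvPolynomial (Fin 2) ℂ
  B : MvPolynomial (Fin 2) ℂ
  homogeneous_A : A.IsHomogeneous d
  homogeneous_B : B.IsHomogeneous d
  gcd_eq_one : IsRelPrime A B

lemma isRelPrime_X_pow (d : ℕ) {i j : Fin 2} (hij : i ≠ j) :
    IsRelPrime ((X i : MvPolynomial (Fin 2) ℂ) ^ d) (-(X j) ^ d) := by
  have h : IsRelPrime (X i : MvPolynomial (Fin 2) ℂ) (X j) := by
    refine ((X_prime (R := ℂ) (i := i)).irreducible.isRelPrime_iff_not_dvd).2 fun h => ?_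
    exact hij (by simpa using (X_dvd_X (R := ℂ) (i := i) (j := j)).1 h)
  exact IsRelPrime.neg_right h.pow

/-- The foliation defined by `y^d dx - x^d dy`. -/
def H₁ (d : ℕ) : HomogeneousFoliation d where
  A := X 1 ^ d
  B := -(X 0) ^ d
  homogeneous_A := isHomogeneous_X_pow 1 d
  homogeneous_B := (isHomogeneous_X_pow 0 d).neg
  gcd_eq_one := isRelPrime_X_pow d (by decide)

/-- The foliation defined by `x^d dx - y^d dy`. -/
def H₂ (d : ℕ) : HomogeneousFoliation d where
  A := X 0 ^ d
  B := -(X 1) ^ d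
  homogeneous_A := isHomogeneous_X_pow 0 d
  homogeneous_B := (isHomogeneous_X_pow 1 d).neg
  gcd_eq_one := isRelPrime_X_pow d (by decide)

/-- The function field `ℂ(x, y)` of `ℙ²`. -/
abbrev FunField : Type := FractionRing (MvPolynomial (Fin 2) ℂ)

/-- The group `Bir(ℙ²)` of birational transformations of `ℙ²`, seen (contravariantly) as the group
of `ℂ`-automorphisms of the function field. -/
abbrev Bir : Type := FunField ≃ₐ[ℂ] FunField

namespace HomogeneousFoliation

variable {d : ℕ}

/-- `H` and `H'` are linearly conjugate: for some `M ∈ GL₂(ℂ)`, acting by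
`φ(x, y) = (M₀₀ x + M₀₁ y, M₁₀ x + M₁₁ y)`, the pull-back by `φ` of the `1`-form of `H` is
a nonzero constant multiple of the `1`-form of `H'`. -/
def LinearlyConjugate (H H' : HomogeneousFoliation d) : Prop :=
  ∃ (M : GL (Fin 2) ℂ) (c : ℂ), c ≠ 0 ∧
    let φ : MvPolynomial (Fin 2) ℂ →ₐ[ℂ] MvPolynomial (Fin 2) ℂ :=
      aeval fun i : Fin 2 =>
        (C (M i 0) * X 0 + C (M i 1) * X 1 : MvPolynomial (Fin 2) ℂ)
    C (M 0 0) * φ H.A + C (M 1 0) * φ H.B = C c * H'.A ∧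
    C (M 0 1) * φ H.A + C (M 1 1) * φ H.B = C c * H'.B

/-- First coordinate of the Gauss map of `H` in the affine chart `(p, q)` of the dual plane which
corresponds to the lines `y = p x - q`: the slope `p = -A/B` of the tangent line at `(x, y)`. -/
def gaussP (H : HomogeneousFoliation d) : FunField :=
  -(algebraMap (MvPolynomial (Fin 2) ℂ) FunField H.A / algebraMap (MvPolynomial (Fin 2) ℂ) FunField H.B)

/-- Second coordinate `q = p x - y` of the Gauss map of `H`. -/
def gaussQ (H : HomogeneousFoliation d) : FunField :=
  H.gaussP * algebraMap (MvPolynomial (Fin 2) ℂ) FunField (X 0) -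
    algebraMap (MvPolynomial (Fin 2) ℂ) FunField (X 1)

/-- `H` is Galois: there is a subgroup of order `d` of `Bir(ℙ²)` all of whose elements `γ` satisfy
`G_H ∘ γ = G_H`, where `G_H` is the Gauss map. -/
def IsGaloisFoliation (H : HomogeneousFoliation d) : Prop :=
  ∃ G : Subgroup Bir, Nat.card G = d ∧ ∀ γ ∈ G, γ H.gaussP = H.gaussP ∧ γ H.gaussQ = H.gaussQ

/-- The rational map `[y : x] ↦ [-A(x, y) : B(x, y)]` from `ℙ¹` to `ℙ¹`, as the rational function
`-A(1, t) / B(1, t)` of the coordinate `t = y / x`. -/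
def gaussLine (H : HomogeneousFoliation d) : RatFunc ℂ :=
  -(algebraMap (Polynomial ℂ) (RatFunc ℂ) (aeval ![1, Polynomial.X] H.A) /
    algebraMap (Polynomial ℂ) (RatFunc ℂ) (aeval ![1, Polynomial.X] H.B))

/-- The Galois group of the ramified covering `f = gaussLine : ℙ¹ → ℙ¹`, that is of the
extension of function fields `ℂ(t) / ℂ(f(t))`. -/
abbrev galoisGroup (H : HomogeneousFoliation d) : Type :=
  RatFunc ℂ ≃ₐ[IntermediateField.adjoin ℂ {H.gaussLine}] RatFunc ℂ

/-- The left-hand side of the implicit equation `A(x, p x - q) + p B(x, p x - q) = 0`,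
`x = dq/dp`, of the Legendre transform of `H`, in the affine chart `(p, q)` of the dual plane which
corresponds to the lines `y = p x - q`. -/
def legEquation (H : HomogeneousFoliation d) (z : ℂ × ℂ) (x : ℂ) : ℂ :=
  eval ![x, z.1 * x - z.2] H.A + z.1 * eval ![x, z.1 * x - z.2] H.B

/-- The `d`-web `Leg H` on the dual plane is flat: its curvature vanishes identically. (The
curvature is meromorphic, so this can be read on the dense chart `(p, q)`.) -/
def LegIsFlat (H : HomogeneousFoliation d) : Prop :=
  IsFlatImplicitWeb d H.legEquation

end HomogeneousFoliation

end

end HomFol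

/-!
Write `e = (1, p)`, `L_p = A + p B`, `[v, w]` for the determinant of two vectors, and let `mᵢ(p)` be
the solutions of `L_p(m, p m - 1) = 0`.

**The web.** The equation of the Legendre transform is homogeneous in `(x, q)`, so its slopes are
`q mᵢ(p)` (`exists_isBranchAt`). For such a web the fundamental form of the three-web `(r, s, t)` is
`a dp + (2 + b) dq / q`, where `a` and `b` only depend on `p`, and the curvature is the derivative of
`∑ b_rst`, up to the factor `1 / q`. Flatness therefore means that `totalB = ∑ b_rst` is locally
constant. Put `wᵢ = (mᵢ, p mᵢ - 1)`. One has `b_rst = 1 - Q_rst(e)`, where `Q_rst` is the quadratic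
form taking the values `mᵢ' + mᵢ² = [wᵢ, wᵢ']` at `wᵢ` for `i = r, s, t` (`tripleB_eq_interp`).

**Non-cyclic groups.** The automorphisms of `ℂ(t)` over `ℂ` are Möbius transformations, and the
matrices `M` of the elements of the Galois group satisfy `A(M v) B(v) = A(v) B(M v)`. They permute
the `wᵢ` up to factors, and so the sum `Q` of all the `Q_rst` satisfies `Q(M v) = det M · Q(v)`. A
nonzero quadratic form with this property has two distinct zeros fixed by all `M`, or a double zero
fixed by all `M`; in the first case the finite group embeds into `ℂˣ`, in the second one it consists of
translations, hence is trivial. If the group is not cyclic, then `Q = 0` and `totalB` is constant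
(`legIsFlat_of_not_isCyclic`).

**Cyclic groups.** A birational `γ` preserving the Gauss map sends `t = y / x` to an element which
is algebraic over `ℂ(t)`, hence lies in `ℂ(t)`; so `γ` induces an element of the Galois group, and
the latter has order at least `d` (`IsGaloisFoliation.le_card`). If it is cyclic, a generator is
diagonalizable, and in eigencoordinates only the extreme monomials of `A` and `B` survive: the
foliation is `ℓᵈ ν + ℓ'ᵈ ν'` with linear forms `ℓ, ℓ'` and constant `1`-forms `ν, ν'`
(`exists_isDiagonal_of_isCyclic`). Then `[wᵢ, wᵢ']` is itself the value at `wᵢ` of a multiple of the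
quadratic form `ℓ ℓ'`, so that `totalB` is an affine function of `ℓ(e) ℓ'(e) / (ν(e) ν'(e))`
(`IsDiagonal.totalB_eq`). The web is flat exactly when this quotient is constant, that is when the
factors of `ν ν'` are those of `ℓ ℓ'`; the two ways to match the factors give the two models.
-/

namespace HomFol

open MvPolynomial Filter Topology

/-! ### Binary forms -/

/-- The value of the polynomial `F(x, y)` at a pair of elements of a `ℂ`-algebra. -/
noncomputable def bev {R : Type} [CommRing R] [Algebra ℂ R] (F : MvPolynomial (Fin 2) ℂ)
    (x y : R) : R :=
  aeval ![x, y] F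

section BinaryForms

variable {R S : Type} [CommRing R] [Algebra ℂ R] [CommRing S] [Algebra ℂ S]
  {F G : MvPolynomial (Fin 2) ℂ} {d : ℕ}

lemma bev_eq_eval (F : MvPolynomial (Fin 2) ℂ) (x y : ℂ) : bev F x y = eval ![x, y] F := by
  rw [bev, aeval_eq_eval]

lemma map_bev (φ : R →ₐ[ℂ] S) (F : MvPolynomial (Fin 2) ℂ) (x y : R) :
    φ (bev F x y) = bev F (φ x) (φ y) := by
  have h : (φ : R → S) ∘ ![x, y] = ![φ x, φ y] := by
    funext i; fin_cases i <;> rfl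
  rw [bev, ← AlgHom.comp_apply, comp_aeval]
  exact congrArg (fun v => aeval v F) h

@[simp] lemma bev_X_zero (x y : R) : bev (X 0) x y = x := by simp [bev]

@[simp] lemma bev_X_one (x y : R) : bev (X 1) x y = y := by simp [bev]

@[simp] lemma bev_C (c : ℂ) (x y : R) : bev (C c) x y = algebraMap ℂ R c := by simp [bev]

@[simp] lemma bev_add (x y : R) : bev (F + G) x y = bev F x y + bev G x y := by simp [bev]

@[simp] lemma bev_mul (x y : R) : bev (F * G) x y = bev F x y * bev G x y := by simp [bev]

@[simp] lemma bev_sub (x y : R) : bev (F - G) x y = bev F x y - bev G x y := by simp [bev]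

@[simp] lemma bev_neg (x y : R) : bev (-F) x y = -bev F x y := by simp [bev]

@[simp] lemma bev_pow (n : ℕ) (x y : R) : bev (F ^ n) x y = bev F x y ^ n := by simp [bev]

@[simp] lemma bev_zero (x y : R) : bev 0 x y = 0 := by simp [bev]

lemma bev_X_self (F : MvPolynomial (Fin 2) ℂ) : bev F (X 0) (X 1) = F := by
  have h : (![X 0, X 1] : Fin 2 → MvPolynomial (Fin 2) ℂ) = X := by
    funext i; fin_cases i <;> rfl
  rw [bev, h, aeval_X_left_apply]

lemma bev_bev (F : MvPolynomial (Fin 2) ℂ) (P Q : MvPolynomial (Fin 2) ℂ) (x y : R) :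
    bev (bev F P Q) x y = bev F (bev P x y) (bev Q x y) :=
  map_bev (aeval ![x, y]) F P Q

lemma eq_of_bev_eq (h : ∀ x y : ℂ, bev F x y = bev G x y) : F = G := by
  refine MvPolynomial.funext fun v => ?_
  have hv : v = ![v 0, v 1] := by funext i; fin_cases i <;> rfl
  rw [hv, ← bev_eq_eval, ← bev_eq_eval]
  exact h _ _

lemma exists_bev_eq_sum (hF : F.IsHomogeneous d) :
    ∃ c : ℕ → ℂ, ∀ (R : Type) [CommRing R] [Algebra ℂ R] (x y : R),
      bev F x y = ∑ k ∈ Finset.range (d + 1), algebraMap ℂ R (c k) * (x ^ (d - k) * y ^ k) := by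
  classical
  refine ⟨fun k => ∑ m ∈ F.support with m 1 = k, F.coeff m, fun R _ _ x y => ?_⟩
  have hdeg : ∀ m ∈ F.support, m 0 + m 1 = d := fun m hm => by
    have h := hF.degree_eq_sum_deg_support hm
    rw [h, ← Fin.sum_univ_two (fun i => m i)]
    exact (Finset.sum_subset (Finset.subset_univ _) fun i _ hi => by simpa using hi).symm
  rw [bev, aeval_def, eval₂_eq']
  rw [← Finset.sum_fiberwise_of_maps_to (t := Finset.range (d + 1)) (g := fun m => m 1)
    (fun m hm => Finset.mem_range.2 (by have := hdeg m hm; omega))]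
  refine Finset.sum_congr rfl fun k _ => ?_
  rw [map_sum, Finset.sum_mul]
  refine Finset.sum_congr rfl fun m hm => ?_
  obtain rfl := (Finset.mem_filter.1 hm).2
  have h0 : m 0 = d - m 1 := by have := hdeg m (Finset.mem_filter.1 hm).1; omega
  simp [Fin.prod_univ_two, h0]

lemma bev_smul (hF : F.IsHomogeneous d) (c x y : R) :
    bev F (c * x) (c * y) = c ^ d * bev F x y := by
  obtain ⟨a, ha⟩ := exists_bev_eq_sum hF
  rw [ha, ha, Finset.mul_sum]
  refine Finset.sum_congr rfl fun k hk => ?_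
  have hk' : d = (d - k) + k := by have := Finset.mem_range.1 hk; omega
  conv_rhs => rw [hk', pow_add]
  simp only [Nat.add_sub_cancel, mul_pow]
  ring

lemma natDegree_bev_linear_le (hF : F.IsHomogeneous d) (a₀ a₁ b₀ b₁ : ℂ) :
    (bev F (Polynomial.C a₀ + Polynomial.C a₁ * Polynomial.X)
      (Polynomial.C b₀ + Polynomial.C b₁ * Polynomial.X)).natDegree ≤ d := by
  obtain ⟨c, hc⟩ := exists_bev_eq_sum hF
  rw [hc]
  refine Polynomial.natDegree_sum_le_of_forall_le _ _ fun k hk => ?_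
  have hk' : d = 0 + ((d - k) * 1 + k * 1) := by have := Finset.mem_range.1 hk; omega
  have key : ∀ a b : ℂ, (Polynomial.C a + Polynomial.C b * Polynomial.X).natDegree ≤ 1 :=
    fun a b => by rw [add_comm]; exact Polynomial.natDegree_linear_le
  conv_rhs => rw [hk']
  exact Polynomial.natDegree_mul_le_of_le (by simp)
    (Polynomial.natDegree_mul_le_of_le (Polynomial.natDegree_pow_le_of_le _ (key _ _))
      (Polynomial.natDegree_pow_le_of_le _ (key _ _)))

lemma coeff_bev_linear (hF : F.IsHomogeneous d) (a₀ a₁ b₀ b₁ : ℂ) :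
    (bev F (Polynomial.C a₀ + Polynomial.C a₁ * Polynomial.X)
      (Polynomial.C b₀ + Polynomial.C b₁ * Polynomial.X)).coeff d = bev F a₁ b₁ := by
  obtain ⟨c, hc⟩ := exists_bev_eq_sum hF
  rw [hc, hc, Polynomial.finsetSum_coeff]
  refine Finset.sum_congr rfl fun k hk => ?_
  have hk' : d = (d - k) * 1 + k * 1 := by have := Finset.mem_range.1 hk; omega
  have key : ∀ a b : ℂ, (Polynomial.C a + Polynomial.C b * Polynomial.X).natDegree ≤ 1 :=
    fun a b => by rw [add_comm]; exact Polynomial.natDegree_linear_le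
  have h1 : ∀ (a b : ℂ) (n : ℕ),
      ((Polynomial.C a + Polynomial.C b * Polynomial.X) ^ n).coeff (n * 1) = b ^ n :=
      fun a b n => by
    rw [mul_comm, mul_one]
    simpa using Polynomial.coeff_pow_of_natDegree_le (n := 1) (m := n) (key a b)
  rw [Polynomial.algebraMap_eq, Polynomial.coeff_C_mul]
  congr 1
  conv_lhs => rw [hk']
  simp only [Nat.add_sub_cancel, mul_one] at h1 ⊢
  have hn : ∀ (a b : ℂ) (n : ℕ),
      ((Polynomial.C a + Polynomial.C b * Polynomial.X) ^ n).natDegree ≤ n := fun a b n => by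
    simpa using Polynomial.natDegree_pow_le_of_le n (key a b)
  rw [Polynomial.coeff_mul_add_eq_of_natDegree_le (hn _ _ _) (hn _ _ _), h1, h1]

lemma eval_bev (F : MvPolynomial (Fin 2) ℂ) (P Q : Polynomial ℂ) (s : ℂ) :
    (bev F P Q).eval s = bev F (P.eval s) (Q.eval s) := by
  have := map_bev (Polynomial.aeval s : Polynomial ℂ →ₐ[ℂ] ℂ) F P Q
  simpa [Polynomial.coe_aeval_eq_eval] using this

lemma exists_bev_one_ne_zero (hF : F.IsHomogeneous d)
    (hF0 : F ≠ 0) : ∃ s : ℂ, bev F 1 s ≠ 0 := by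
  by_contra! hall
  refine hF0 ((mul_eq_zero.1 (?_ : X 0 * F = 0)).resolve_left (X_ne_zero 0))
  refine eq_of_bev_eq fun x y => ?_
  by_cases hx : x = 0
  · simp [hx]
  have h2 := bev_smul hF x 1 (y / x)
  rw [mul_one, mul_div_cancel₀ _ hx, hall, mul_zero] at h2
  simp [h2]

/-- A form vanishing at the point `(x, y)` is divisible by the linear form vanishing there. -/
lemma linear_dvd_of_bev_eq_zero (hF : F.IsHomogeneous d) {x y : ℂ} (hxy : (x, y) ≠ 0)
    (h : bev F x y = 0) : C y * X 0 - C x * X 1 ∣ F := by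
  set ℓ : MvPolynomial (Fin 2) ℂ := C y * X 0 - C x * X 1
  let q := Ideal.Quotient.mkₐ ℂ (Ideal.span {ℓ})
  have hq : ∀ P, q P = 0 ↔ ℓ ∣ P := fun P => by
    rw [Ideal.Quotient.mkₐ_eq_mk, Ideal.Quotient.eq_zero_iff_mem, Ideal.mem_span_singleton]
  have hqF : q F = bev F (q (X 0)) (q (X 1)) := by rw [← map_bev, bev_X_self]
  have hrel : algebraMap ℂ _ y * q (X 0) = algebraMap ℂ _ x * q (X 1) := by
    have := (hq ℓ).2 dvd_rfl
    simp only [ℓ, map_sub, map_mul] at this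
    rw [← sub_eq_zero]
    convert this using 3 <;> exact (q.commutes _).symm
  have hconst : bev F (algebraMap ℂ (_ ⧸ Ideal.span {ℓ}) x) (algebraMap ℂ _ y) = 0 := by
    have := map_bev (Algebra.ofId ℂ (MvPolynomial (Fin 2) ℂ ⧸ Ideal.span {ℓ})) F x y
    rw [h, map_zero] at this
    exact this.symm
  rw [← hq, hqF]
  have key : ∀ c : ℂ, c ≠ 0 → (algebraMap ℂ (MvPolynomial (Fin 2) ℂ ⧸ Ideal.span {ℓ}) c) ^ d *
      bev F (q (X 0)) (q (X 1)) = 0 → bev F (q (X 0)) (q (X 1)) = 0 := fun c hc hh => by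
    have hu : IsUnit (algebraMap ℂ (MvPolynomial (Fin 2) ℂ ⧸ Ideal.span {ℓ}) c) :=
      (IsUnit.mk0 c hc).map _
    exact (hu.pow d).mul_right_eq_zero.1 hh
  by_cases hx : x = 0
  · have hy : y ≠ 0 := by rintro rfl; exact hxy (by simp [hx])
    refine key y hy ?_
    rw [← bev_smul hF, hrel, mul_comm (algebraMap ℂ _ x), mul_comm (algebraMap ℂ _ y),
      bev_smul hF, hconst, mul_zero]
  · refine key x hx ?_
    rw [← bev_smul hF, ← hrel, mul_comm (algebraMap ℂ _ x), mul_comm (algebraMap ℂ _ y),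
      bev_smul hF, hconst, mul_zero]

lemma not_isUnit_linear (x y : ℂ) :
    ¬ IsUnit (C y * X 0 - C x * X 1 : MvPolynomial (Fin 2) ℂ) := fun h => by
  have h2 := h.map (aeval ![x, y] : MvPolynomial (Fin 2) ℂ →ₐ[ℂ] ℂ)
  simp [mul_comm] at h2

lemma eq_zero_of_bev_eq_zero (hF : F.IsHomogeneous d) (hG : G.IsHomogeneous d)
    (hFG : IsRelPrime F G) {x y : ℂ} (h₁ : bev F x y = 0) (h₂ : bev G x y = 0) : (x, y) = 0 := by
  by_contra hxy
  exact not_isUnit_linear x y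
    (hFG (linear_dvd_of_bev_eq_zero hF hxy h₁) (linear_dvd_of_bev_eq_zero hG hxy h₂))

/-- A nonzero binary form of degree `d` with `d` distinct roots on the affine line
`{(m, p m - 1)}` does not vanish on the point at infinity of this line, and has no other root. -/
lemma roots_complete (hF : F.IsHomogeneous d) (hF0 : F ≠ 0) {p : ℂ} {m : Fin d → ℂ}
    (hm : Function.Injective m) (hroot : ∀ i, bev F (m i) (p * m i - 1) = 0) :
    bev F 1 p ≠ 0 ∧ ∀ x y : ℂ, (x, y) ≠ 0 → bev F x y = 0 →
      p * x - y ≠ 0 ∧ ∃ i, x = m i * (p * x - y) := by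
  set P : Polynomial ℂ := bev F (Polynomial.C 0 + Polynomial.C 1 * Polynomial.X)
      (Polynomial.C (-1) + Polynomial.C p * Polynomial.X) with hP
  have hPe : ∀ s, P.eval s = bev F s (p * s - 1) := fun s => by
    rw [hP, eval_bev]; congr 1 <;> simp [sub_eq_add_neg, add_comm]
  have hsc : ∀ x y : ℂ, p * x - y ≠ 0 →
      bev F x y = (p * x - y) ^ d * P.eval (x / (p * x - y)) := fun x y h => by
    rw [hPe, ← bev_smul hF, mul_sub, mul_div_cancel₀ _ h, mul_left_comm, mul_div_cancel₀ _ h]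
    ring_nf
  have hP0 : P ≠ 0 := fun h0 => hF0 <| by
    have : (C p * X 0 - X 1) * F = 0 := by
      refine eq_of_bev_eq fun x y => ?_
      by_cases hxy : p * x - y = 0
      · simp [hxy]
      · simp [hsc x y hxy, h0]
    refine (mul_eq_zero.1 this).resolve_left fun h => ?_
    have := congrArg (fun Q => bev Q (0 : ℂ) 1) h
    simp at this
  have himg : Finset.univ.image m ⊆ P.roots.toFinset := fun s hs => by
    obtain ⟨i, -, rfl⟩ := Finset.mem_image.1 hs
    rw [Multiset.mem_toFinset, Polynomial.mem_roots hP0, Polynomial.IsRoot, hPe, hroot]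
  have hcard : (Finset.univ.image m).card = d := by
    rw [Finset.card_image_of_injective _ hm, Finset.card_univ, Fintype.card_fin]
  have hcd : P.natDegree ≤ d := natDegree_bev_linear_le hF _ _ _ _
  have hroots : P.roots.toFinset.card ≤ P.natDegree :=
    (Multiset.toFinset_card_le _).trans P.card_roots'
  have hdeg : P.natDegree = d :=
    le_antisymm hcd (hcard ▸ (Finset.card_le_card himg).trans hroots)
  have hinf : bev F 1 p ≠ 0 := by
    rw [← coeff_bev_linear hF 0 1 (-1) p, ← hP, ← hdeg, Polynomial.coeff_natDegree]
    exact Polynomial.leadingCoeff_ne_zero.2 hP0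
  refine ⟨hinf, fun x y hxy h => ?_⟩
  have hne : p * x - y ≠ 0 := fun h0 => by
    have hy : y = p * x := (sub_eq_zero.1 h0).symm
    have hx : x ≠ 0 := by rintro rfl; exact hxy (by simp [hy])
    have : bev F x y = x ^ d * bev F 1 p := by rw [← bev_smul hF, mul_one, hy, mul_comm]
    rw [this] at h
    exact mul_ne_zero (pow_ne_zero _ hx) hinf h
  refine ⟨hne, ?_⟩
  have heq : Finset.univ.image m = P.roots.toFinset :=
    Finset.eq_of_subset_of_card_le himg (by rw [hcard, ← hdeg]; exact hroots)
  have hmem : x / (p * x - y) ∈ Finset.univ.image m := by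
    rw [heq, Multiset.mem_toFinset, Polynomial.mem_roots hP0, Polynomial.IsRoot]
    rw [hsc x y hne] at h
    exact (mul_eq_zero.1 h).resolve_left (pow_ne_zero _ hne)
  obtain ⟨i, -, hi⟩ := Finset.mem_image.1 hmem
  exact ⟨i, by rw [hi, div_mul_cancel₀ _ hne]⟩

end BinaryForms

/-- The binary form `A + p B`, whose zeros are the directions along which the leaves of `H` have
slope `p`. -/
noncomputable def HomogeneousFoliation.fiberForm {d : ℕ} (H : HomogeneousFoliation d) (p : ℂ) :
    MvPolynomial (Fin 2) ℂ :=
  H.A + C p * H.B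

namespace HomogeneousFoliation

variable {d : ℕ} (H : HomogeneousFoliation d)

@[simp] lemma bev_fiberForm (p x y : ℂ) :
    bev (H.fiberForm p) x y = bev H.A x y + p * bev H.B x y := by
  simp [fiberForm]

lemma isHomogeneous_fiberForm (p : ℂ) : (H.fiberForm p).IsHomogeneous d :=
  H.homogeneous_A.add (H.homogeneous_B.C_mul p)

lemma eq_zero_of_bev {x y : ℂ} (h₁ : bev H.A x y = 0) (h₂ : bev H.B x y = 0) : (x, y) = 0 :=
  eq_zero_of_bev_eq_zero H.homogeneous_A H.homogeneous_B H.gcd_eq_one h₁ h₂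

lemma B_ne_zero (hd : d ≠ 0) : H.B ≠ 0 := fun h => by
  have hu : IsUnit H.A := H.gcd_eq_one dvd_rfl (h ▸ dvd_zero _)
  have h2 := hu.map (aeval ![0, 0] : MvPolynomial (Fin 2) ℂ →ₐ[ℂ] ℂ)
  have h3 := bev_smul (R := ℂ) H.homogeneous_A 0 0 0
  simp only [mul_zero, zero_pow hd, zero_mul] at h3
  exact h2.ne_zero h3

lemma fiberForm_ne_zero (hd : d ≠ 0) (p : ℂ) : H.fiberForm p ≠ 0 := fun h => by
  have hA : H.A = H.B * (-C p) := by
    rw [fiberForm] at h; linear_combination h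
  have hu : IsUnit H.B := H.gcd_eq_one (hA ▸ dvd_mul_right _ _) dvd_rfl
  have h2 := hu.map (aeval ![0, 0] : MvPolynomial (Fin 2) ℂ →ₐ[ℂ] ℂ)
  have h3 := bev_smul (R := ℂ) H.homogeneous_B 0 0 0
  simp only [mul_zero, zero_pow hd, zero_mul] at h3
  exact h2.ne_zero h3

lemma legEquation_eq (z : ℂ × ℂ) (x : ℂ) :
    H.legEquation z x = bev (H.fiberForm z.1) x (z.1 * x - z.2) := by
  rw [bev_fiberForm, legEquation, bev_eq_eval, bev_eq_eval]

end HomogeneousFoliation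

/-! ### Webs invariant under the homotheties `(p, q) ↦ (p, c q)` -/

/-- The sum over `r < s < t`. -/
def sumTriples {d : ℕ} (f : Fin d → Fin d → Fin d → ℂ) : ℂ :=
  ∑ r, ∑ s, ∑ t, if r < s ∧ s < t then f r s t else 0

/-- The three values `mᵢ` and derivatives `mᵢ'` determine numbers `a, b` with
`a + b m_r = (m_t' - m_s') / (m_t - m_s)` and its cyclic analogues; this is `b`. -/
noncomputable def tripleB {d : ℕ} (m m' : Fin d → ℂ) (r s t : Fin d) : ℂ :=
  -(m' r / ((m r - m s) * (m r - m t)) + m' s / ((m s - m r) * (m s - m t)) +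
    m' t / ((m t - m r) * (m t - m s)))

/-- The number `a` of the relations `a + b m_r = (m_t' - m_s') / (m_t - m_s)`, see `tripleB`. -/
noncomputable def tripleA {d : ℕ} (m m' : Fin d → ℂ) (r s t : Fin d) : ℂ :=
  (m' t - m' s) / (m t - m s) - tripleB m m' r s t * m r

/-- The functions `q mᵢ(p)`, with `mᵢ` holomorphic, represent the slopes near `z`. -/
def IsBranchAt {d : ℕ} (slope : Fin d → ℂ × ℂ → ℂ) (z : ℂ × ℂ) (m : Fin d → ℂ → ℂ) : Prop :=
  ∀ i, AnalyticAt ℂ (m i) z.1 ∧ ∀ᶠ w in 𝓝 z, slope i w = w.2 * m i w.1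

section Triple

variable {d : ℕ} {m m' : Fin d → ℂ} {r s t : Fin d}

lemma tripleA_add_tripleB (hrs : m r ≠ m s) (hrt : m r ≠ m t) (hst : m s ≠ m t) :
    tripleA m m' r s t + tripleB m m' r s t * m r = (m' t - m' s) / (m t - m s) ∧
    tripleA m m' r s t + tripleB m m' r s t * m s = (m' r - m' t) / (m r - m t) ∧
    tripleA m m' r s t + tripleB m m' r s t * m t = (m' s - m' r) / (m s - m r) := by
  have h1 := sub_ne_zero.2 hrs
  have h2 := sub_ne_zero.2 hrt
  have h3 := sub_ne_zero.2 hst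
  have h1' := sub_ne_zero.2 hrs.symm
  have h2' := sub_ne_zero.2 hrt.symm
  have h3' := sub_ne_zero.2 hst.symm
  have e1 : m s - m r = -(m r - m s) := by ring
  have e2 : m t - m r = -(m r - m t) := by ring
  have e3 : m t - m s = -(m s - m t) := by ring
  refine ⟨by rw [tripleA]; ring, ?_, ?_⟩ <;>
  · rw [tripleA, tripleB, e1, e2, e3]
    field_simp
    ring

lemma eq_of_add_mul_eq {a b a' b' u v : ℂ} (huv : u ≠ v) (h1 : a + b * u = a' + b' * u)
    (h2 : a + b * v = a' + b' * v) : a = a' ∧ b = b' := by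
  have hb : b = b' := by
    have : (b - b') * (u - v) = 0 := by linear_combination h1 - h2
    exact sub_eq_zero.1 ((mul_eq_zero.1 this).resolve_right (sub_ne_zero.2 huv))
  subst hb
  exact ⟨by linear_combination h1, rfl⟩

/-- The solution of the linear system defining the fundamental form of a three-web of slopes
`q mᵢ(p)`. -/
lemma triple_system_iff (hrs : m r ≠ m s) (hrt : m r ≠ m t) (hst : m s ≠ m t) {q : ℂ} (hq : q ≠ 0)
    (η : ℂ × ℂ) :
    ((q * (m' t - m' s) + 2 * q * (m t - m s) * m r =
        η.1 * (q * (m t - m s)) + η.2 * (q * (m t - m s) * (q * m r))) ∧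
      (q * (m' r - m' t) + 2 * q * (m r - m t) * m s =
        η.1 * (q * (m r - m t)) + η.2 * (q * (m r - m t) * (q * m s))) ∧
      (q * (m' s - m' r) + 2 * q * (m s - m r) * m t =
        η.1 * (q * (m s - m r)) + η.2 * (q * (m s - m r) * (q * m t)))) ↔
    η = (tripleA m m' r s t, (2 + tripleB m m' r s t) / q) := by
  obtain ⟨h1, h2, h3⟩ := tripleA_add_tripleB (m' := m') hrs hrt hst
  have key : ∀ u v u' v' w a b : ℂ, u - v ≠ 0 → a + b * w = (u' - v') / (u - v) →
      ((q * (u' - v') + 2 * q * (u - v) * w =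
        η.1 * (q * (u - v)) + η.2 * (q * (u - v) * (q * w))) ↔
      η.1 + (η.2 * q) * w = a + (2 + b) * w) := fun u v u' v' w a b huv hab => by
    rw [eq_div_iff huv] at hab
    constructor
    · intro h
      have : (η.1 + (η.2 * q) * w - (a + (2 + b) * w)) * (q * (u - v)) = 0 := by
        linear_combination -h - q * hab
      exact sub_eq_zero.1 ((mul_eq_zero.1 this).resolve_right (mul_ne_zero hq huv))
    · intro h
      linear_combination -(q * (u - v)) * h - q * hab
  rw [key _ _ _ _ _ _ _ (sub_ne_zero.2 hst.symm) h1, key _ _ _ _ _ _ _ (sub_ne_zero.2 hrt) h2,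
    key _ _ _ _ _ _ _ (sub_ne_zero.2 hrs.symm) h3]
  constructor
  · rintro ⟨g1, g2, -⟩
    obtain ⟨ha, hb⟩ := eq_of_add_mul_eq hrs g1 g2
    ext
    · exact ha
    · rw [eq_div_iff hq]; exact hb
  · intro h
    have e1 : η.1 = tripleA m m' r s t := by rw [h]
    have e2 : η.2 * q = 2 + tripleB m m' r s t := by rw [h]; exact div_mul_cancel₀ _ hq
    rw [e1, e2]
    exact ⟨rfl, rfl, rfl⟩

end Triple

section Web

variable {d : ℕ} {slope : Fin d → ℂ × ℂ → ℂ} {z : ℂ × ℂ} {m : Fin d → ℂ → ℂ}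

lemma IsBranchAt.eq (h : IsBranchAt slope z m) (i : Fin d) : slope i z = z.2 * m i z.1 :=
  (h i).2.self_of_nhds

lemma extD_congr {α β : OneForm} (h : α =ᶠ[𝓝 z] β) : extD α z = extD β z := by
  have h1 : (fun w => (α w).1) =ᶠ[𝓝 z] fun w => (β w).1 := h.mono fun w hw => congrArg Prod.fst hw
  have h2 : (fun w => (α w).2) =ᶠ[𝓝 z] fun w => (β w).2 := h.mono fun w hw => congrArg Prod.snd hw
  rw [extD, extD, h1.fderiv_eq, h2.fderiv_eq]

lemma extD_mk {f g : ℂ × ℂ → ℂ} {f' g' : ℂ × ℂ →L[ℂ] ℂ} (hf : HasFDerivAt f f' z)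
    (hg : HasFDerivAt g g' z) : extD (fun w => (f w, g w)) z = g' (1, 0) - f' (0, 1) := by
  rw [extD, hf.fderiv, hg.fderiv]

lemma hasFDerivAt_comp_fst {f : ℂ → ℂ} (hf : DifferentiableAt ℂ f z.1) :
    HasFDerivAt (fun w : ℂ × ℂ => f w.1) (deriv f z.1 • ContinuousLinearMap.fst ℂ ℂ ℂ) z :=
  hf.hasDerivAt.comp_hasFDerivAt z hasFDerivAt_fst

lemma IsBranchAt.extD_eq (h : IsBranchAt slope z m) (r s t : Fin d) :
    extD (mulForm (wedge (fun z => (-slope s z, 1)) (fun z => (-slope t z, 1)))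
      (fun z => (-slope r z, 1))) z =
    z.2 * (deriv (m t) z.1 - deriv (m s) z.1) + 2 * z.2 * (m t z.1 - m s z.1) * m r z.1 := by
  have hev : mulForm (wedge (fun z => (-slope s z, 1)) (fun z => (-slope t z, 1)))
      (fun z => (-slope r z, 1)) =ᶠ[𝓝 z]
      fun w => (-(w.2 * (m t w.1 - m s w.1)) * (w.2 * m r w.1), w.2 * (m t w.1 - m s w.1)) := by
    filter_upwards [(h r).2, (h s).2, (h t).2] with w hr hs ht
    simp only [mulForm, wedge, hr, hs, ht, smul_eq_mul, Prod.smul_mk]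
    ext <;> ring
  rw [extD_congr hev]
  have hd : ∀ i, HasFDerivAt (fun w : ℂ × ℂ => m i w.1)
      (deriv (m i) z.1 • ContinuousLinearMap.fst ℂ ℂ ℂ) z :=
    fun i => hasFDerivAt_comp_fst (h i).1.differentiableAt
  have hsnd : HasFDerivAt (fun w : ℂ × ℂ => w.2) (ContinuousLinearMap.snd ℂ ℂ ℂ) z :=
    hasFDerivAt_snd
  have hg := hsnd.mul ((hd t).sub (hd s))
  have hf := hg.neg.mul (hsnd.mul (hd r))
  refine (extD_mk hf hg).trans ?_
  simp
  ring

/-- The fundamental form of the `3`-subweb `(r, s, t)` of a web of slopes `q mᵢ(p)`. -/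
noncomputable def tripleForm (slope : Fin d → ℂ × ℂ → ℂ) (r s t : Fin d) : OneForm := fun z =>
  (tripleA (fun i => slope i z / z.2) (fun i => fderiv ℂ (slope i) z (1, 0) / z.2) r s t,
    (2 + tripleB (fun i => slope i z / z.2)
      (fun i => fderiv ℂ (slope i) z (1, 0) / z.2) r s t) / z.2)

lemma IsBranchAt.fderiv_eq (h : IsBranchAt slope z m) (i : Fin d) :
    fderiv ℂ (slope i) z (1, 0) = z.2 * deriv (m i) z.1 := by
  have hd : HasFDerivAt (fun w : ℂ × ℂ => w.2 * m i w.1) _ z :=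
    (hasFDerivAt_snd (𝕜 := ℂ) (p := z)).mul (hasFDerivAt_comp_fst (h i).1.differentiableAt)
  rw [Filter.EventuallyEq.fderiv_eq (f := fun w : ℂ × ℂ => w.2 * m i w.1) (h i).2, hd.fderiv]
  simp

lemma IsBranchAt.tripleForm_eq (h : IsBranchAt slope z m) (hz : z.2 ≠ 0) (r s t : Fin d) :
    tripleForm slope r s t z =
      (tripleA (fun i => m i z.1) (fun i => deriv (m i) z.1) r s t,
        (2 + tripleB (fun i => m i z.1) (fun i => deriv (m i) z.1) r s t) / z.2) := by
  simp only [tripleForm, h.eq, h.fderiv_eq, mul_div_cancel_left₀ _ hz]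

lemma IsBranchAt.injective (h : IsBranchAt slope z m)
    (hinj : Function.Injective fun i => slope i z) :
    Function.Injective fun i => m i z.1 := fun i j hij => hinj <| by
  simp only [h.eq] at hij ⊢
  rw [hij]

lemma IsBranchAt.isFundamental_iff (h : IsBranchAt slope z m) (hz : z.2 ≠ 0)
    (hinj : Function.Injective fun i => slope i z) {r s t : Fin d} (hrs : r < s) (hst : s < t)
    (η : OneForm) :
    IsFundamentalForm₃ {z} (fun z => (-slope r z, 1)) (fun z => (-slope s z, 1))
      (fun z => (-slope t z, 1)) η ↔ η z = tripleForm slope r s t z := by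
  have hm := h.injective hinj
  rw [h.tripleForm_eq hz, ← triple_system_iff (hm.ne hrs.ne) (hm.ne (hrs.trans hst).ne)
    (hm.ne hst.ne) hz]
  simp only [IsFundamentalForm₃, Set.mem_singleton_iff, forall_eq, h.extD_eq]
  have key : ∀ i j k : Fin d, wedge η (mulForm (wedge (fun z => (-slope i z, 1))
      (fun z => (-slope j z, 1))) (fun z => (-slope k z, 1))) z =
      (η z).1 * (z.2 * (m j z.1 - m i z.1)) +
        (η z).2 * (z.2 * (m j z.1 - m i z.1) * (z.2 * m k z.1)) := fun i j k => by
    simp only [wedge, mulForm, h.eq, smul_eq_mul, Prod.smul_mk]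
    ring
  simp only [key]

lemma IsBranchAt.eventually (h : IsBranchAt slope z m) : ∀ᶠ w in 𝓝 z, IsBranchAt slope w m := by
  simp only [IsBranchAt]
  rw [eventually_all]
  intro i
  exact (continuousAt_fst.eventually (h i).1.eventually_analyticAt).and
    (h i).2.eventually_nhds

/-- The total coefficient whose derivative is, up to the factor `1 / q`, the curvature. -/
noncomputable def totalB (m : Fin d → ℂ → ℂ) (p : ℂ) : ℂ :=
  sumTriples (tripleB (fun i => m i p) (fun i => deriv (m i) p))

lemma sum_tripleForm (z : ℂ × ℂ) :
    ∑ r, ∑ s, ∑ t, (if r < s ∧ s < t then tripleForm slope r s t z else 0) =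
      (sumTriples fun r s t => (tripleForm slope r s t z).1,
        sumTriples fun r s t => (tripleForm slope r s t z).2) := by
  ext <;> simp only [sumTriples, Prod.fst_sum, Prod.snd_sum] <;>
  exact Finset.sum_congr rfl fun r _ => Finset.sum_congr rfl fun s _ =>
    Finset.sum_congr rfl fun t _ => by split_ifs <;> rfl

lemma differentiableAt_sumTriples {f : Fin d → Fin d → Fin d → ℂ → ℂ} {p : ℂ}
    (h : ∀ r s t, r < s → s < t → DifferentiableAt ℂ (f r s t) p) :
    DifferentiableAt ℂ (fun x => sumTriples fun r s t => f r s t x) p := by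
  unfold sumTriples
  refine DifferentiableAt.fun_sum fun r _ => DifferentiableAt.fun_sum fun s _ =>
    DifferentiableAt.fun_sum fun t _ => ?_
  by_cases hrst : r < s ∧ s < t
  · simpa only [if_pos hrst] using h r s t hrst.1 hrst.2
  · simp only [if_neg hrst, differentiableAt_const]

lemma IsBranchAt.differentiableAt_tripleB (h : IsBranchAt slope z m)
    (hinj : Function.Injective fun i => slope i z) {r s t : Fin d} (hrs : r < s) (hst : s < t) :
    DifferentiableAt ℂ
      (fun p => tripleB (fun i => m i p) (fun i => deriv (m i) p) r s t) z.1 := by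
  have hm := h.injective hinj
  have hd := fun i => (h i).1.differentiableAt
  have hd' := fun i => (h i).1.deriv.differentiableAt
  have key : ∀ i j k : Fin d, i ≠ j → i ≠ k → DifferentiableAt ℂ
      (fun p => deriv (m i) p / ((m i p - m j p) * (m i p - m k p))) z.1 := fun i j k hij hik =>
    (hd' i).div (((hd i).sub (hd j)).mul ((hd i).sub (hd k)))
      (mul_ne_zero (sub_ne_zero.2 (hm.ne hij)) (sub_ne_zero.2 (hm.ne hik)))
  have hrt := hrs.trans hst
  exact (((key r s t hrs.ne hrt.ne).add (key s r t hrs.ne' hst.ne)).add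
    (key t r s hrt.ne' hst.ne')).neg

lemma IsBranchAt.differentiableAt_tripleA (h : IsBranchAt slope z m)
    (hinj : Function.Injective fun i => slope i z) {r s t : Fin d} (hrs : r < s) (hst : s < t) :
    DifferentiableAt ℂ
      (fun p => tripleA (fun i => m i p) (fun i => deriv (m i) p) r s t) z.1 := by
  have hm := h.injective hinj
  have hd := fun i => (h i).1.differentiableAt
  have hd' := fun i => (h i).1.deriv.differentiableAt
  exact (((hd' t).sub (hd' s)).div ((hd t).sub (hd s)) (sub_ne_zero.2 (hm.ne hst.ne'))).sub
    ((h.differentiableAt_tripleB hinj hrs hst).mul (hd r))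

lemma IsBranchAt.extD_sum_tripleForm (h : IsBranchAt slope z m) (hz : z.2 ≠ 0)
    (hinj : Function.Injective fun i => slope i z) :
    extD (fun w => ∑ r, ∑ s, ∑ t, if r < s ∧ s < t then tripleForm slope r s t w else 0) z =
      deriv (totalB m) z.1 / z.2 := by
  set N : ℂ := sumTriples fun _ _ _ : Fin d => (2 : ℂ)
  let a : ℂ → ℂ := fun p =>
    sumTriples fun r s t => tripleA (fun i => m i p) (fun i => deriv (m i) p) r s t
  have hev : (fun w => ∑ r, ∑ s, ∑ t, if r < s ∧ s < t then tripleForm slope r s t w else 0)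
      =ᶠ[𝓝 z] fun w => (a w.1, (N + totalB m w.1) * w.2⁻¹) := by
    filter_upwards [h.eventually, continuousAt_snd.eventually_ne hz] with w hw hw2
    rw [sum_tripleForm]
    simp only [hw.tripleForm_eq hw2]
    refine Prod.ext rfl ?_
    simp only [N, totalB, sumTriples, ← Finset.sum_add_distrib, Finset.sum_mul]
    refine Finset.sum_congr rfl fun r _ => Finset.sum_congr rfl fun s _ =>
      Finset.sum_congr rfl fun t _ => ?_
    split_ifs <;> simp [div_eq_mul_inv]
  rw [extD_congr hev]
  have ha : DifferentiableAt ℂ a z.1 :=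
    differentiableAt_sumTriples fun r s t hrs hst => h.differentiableAt_tripleA hinj hrs hst
  have hb : DifferentiableAt ℂ (totalB m) z.1 :=
    differentiableAt_sumTriples fun r s t hrs hst => h.differentiableAt_tripleB hinj hrs hst
  have hinv : HasFDerivAt (fun w : ℂ × ℂ => w.2⁻¹)
      (-(z.2 ^ 2)⁻¹ • ContinuousLinearMap.snd ℂ ℂ ℂ) z :=
    (hasDerivAt_inv hz).comp_hasFDerivAt z hasFDerivAt_snd
  refine (extD_mk (hasFDerivAt_comp_fst ha)
    (((hasFDerivAt_comp_fst hb).const_add N).mul hinv)).trans ?_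
  simp [div_eq_mul_inv, mul_comm]

/-- A web of slopes `q mᵢ(p)` is flat if and only if the total coefficient `totalB` is locally
constant: its curvature is `totalB'(p) / q · dp ∧ dq`. -/
lemma exists_flat_iff {V : Set (ℂ × ℂ)} (hV : IsOpen V) (hq : ∀ z ∈ V, z.2 ≠ 0)
    (hinj : ∀ z ∈ V, Function.Injective fun i => slope i z)
    (hloc : ∀ z ∈ V, ∃ m, IsBranchAt slope z m) :
    (∃ η : OneForm, IsFundamentalForm V (fun i z => (-slope i z, 1)) η ∧
      ∀ z ∈ V, extD η z = 0) ↔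
    ∀ z ∈ V, ∀ m, IsBranchAt slope z m → deriv (totalB m) z.1 = 0 := by
  have hfund : ∀ r s t : Fin d, r < s → s < t → ∀ η : OneForm,
      IsFundamentalForm₃ V (fun z => (-slope r z, 1)) (fun z => (-slope s z, 1))
        (fun z => (-slope t z, 1)) η ↔ ∀ z ∈ V, η z = tripleForm slope r s t z := by
    intro r s t hrs hst η
    refine forall₂_congr fun z hz => ?_
    obtain ⟨m, hm⟩ := hloc z hz
    rw [← hm.isFundamental_iff (hq z hz) (hinj z hz) hrs hst]
    simp only [IsFundamentalForm₃, Set.mem_singleton_iff, forall_eq]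
  constructor
  · rintro ⟨η, ⟨e, he, hη⟩, hflat⟩ z hz m hm
    have hev : η =ᶠ[𝓝 z]
        fun w => ∑ r, ∑ s, ∑ t, if r < s ∧ s < t then tripleForm slope r s t w else 0 := by
      filter_upwards [hV.mem_nhds hz] with w hw
      rw [hη w hw]
      refine Finset.sum_congr rfl fun r _ => Finset.sum_congr rfl fun s _ =>
        Finset.sum_congr rfl fun t _ => ?_
      split_ifs with hrst
      · exact (hfund r s t hrst.1 hrst.2 _).1 (he r s t hrst.1 hrst.2) w hw
      · rfl
    have h0 := hflat z hz
    rw [extD_congr hev, hm.extD_sum_tripleForm (hq z hz) (hinj z hz)] at h0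
    exact (div_eq_zero_iff.1 h0).resolve_right (hq z hz)
  · intro h
    refine ⟨_, ⟨tripleForm slope, fun r s t hrs hst => (hfund r s t hrs hst _).2 fun _ _ => rfl,
      fun _ _ => rfl⟩, fun z hz => ?_⟩
    obtain ⟨m, hm⟩ := hloc z hz
    rw [hm.extD_sum_tripleForm (hq z hz) (hinj z hz), h z hz m hm, zero_div]

end Web

/-! ### The Legendre transform as a homothety-invariant web -/

namespace HomogeneousFoliation

variable {d : ℕ} (H : HomogeneousFoliation d) {slope : Fin d → ℂ × ℂ → ℂ}

lemma bev_div_of_legEquation {z : ℂ × ℂ} {x : ℂ} (hz : z.2 ≠ 0) (h : H.legEquation z x = 0) :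
    bev (H.fiberForm z.1) (x / z.2) (z.1 * (x / z.2) - 1) = 0 := by
  have h2 := bev_smul (H.isHomogeneous_fiberForm z.1) z.2 (x / z.2) (z.1 * (x / z.2) - 1)
  rw [mul_sub, mul_one, mul_left_comm, mul_div_cancel₀ _ hz, ← H.legEquation_eq, h] at h2
  exact (mul_eq_zero.1 h2.symm).resolve_left (pow_ne_zero _ hz)

/-- The numbers `mᵢ` are the `d` distinct solutions of `(A + p B)(m, p m - 1) = 0`. -/
def IsRootSystem (p : ℂ) (m : Fin d → ℂ) : Prop :=
  Function.Injective m ∧ ∀ i, bev (H.fiberForm p) (m i) (p * m i - 1) = 0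

lemma IsRootSystem.bev_ne_zero {H : HomogeneousFoliation d} {p : ℂ} {m : Fin d → ℂ}
    (h : H.IsRootSystem p m) (hd : d ≠ 0) : bev (H.fiberForm p) 1 p ≠ 0 :=
  (roots_complete (H.isHomogeneous_fiberForm p) (H.fiberForm_ne_zero hd p) h.1 h.2).1

lemma IsRootSystem.exists_eq {H : HomogeneousFoliation d} {p : ℂ} {m : Fin d → ℂ}
    (h : H.IsRootSystem p m) (hd : d ≠ 0) {x y : ℂ} (hxy : (x, y) ≠ 0)
    (h0 : bev (H.fiberForm p) x y = 0) : p * x - y ≠ 0 ∧ ∃ i, x = m i * (p * x - y) :=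
  (roots_complete (H.isHomogeneous_fiberForm p) (H.fiberForm_ne_zero hd p) h.1 h.2).2 x y hxy h0

lemma isRootSystem_of_legEquation {z : ℂ × ℂ} {x : Fin d → ℂ} (hz : z.2 ≠ 0)
    (hinj : Function.Injective x) (h : ∀ i, H.legEquation z (x i) = 0) :
    H.IsRootSystem z.1 fun i => x i / z.2 :=
  ⟨fun _ _ hij => hinj ((div_left_inj' hz).1 hij), fun i => H.bev_div_of_legEquation hz (h i)⟩

/-- The Legendre transform of `H` has no `d` distinct directions along the line `q = 0`. -/
lemma snd_ne_zero_of_mem (hd : 2 ≤ d) {V : Set (ℂ × ℂ)} (hV : IsOpen V)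
    (hinj : ∀ z ∈ V, Function.Injective fun i => slope i z)
    (hroot : ∀ z ∈ V, ∀ i, H.legEquation z (slope i z) = 0) {z : ℂ × ℂ} (hz : z ∈ V) :
    z.2 ≠ 0 := by
  intro h0
  obtain ⟨p, q⟩ := z
  obtain rfl : q = 0 := h0
  have hc : ContinuousAt (fun q : ℂ => (p, q)) 0 := by fun_prop
  have hev : ∀ᶠ q : ℂ in 𝓝[≠] 0, (p, q) ∈ V :=
    (hc.eventually (hV.mem_nhds hz)).filter_mono nhdsWithin_le_nhds
  obtain ⟨q, hq, hq0⟩ := (hev.and self_mem_nhdsWithin).exists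
  have hsys := H.isRootSystem_of_legEquation (z := (p, q)) hq0 (hinj (p, q) hq) (hroot (p, q) hq)
  have hinf := hsys.bev_ne_zero (by omega)
  have hzero : ∀ i, slope i (p, 0) = 0 := fun i => by
    have h := hroot (p, 0) hz i
    rw [H.legEquation_eq] at h
    have h2 := bev_smul (H.isHomogeneous_fiberForm p) (slope i (p, 0)) 1 p
    rw [mul_one, mul_comm _ p] at h2
    rw [sub_zero, h2] at h
    exact eq_zero_of_pow_eq_zero ((mul_eq_zero.1 h).resolve_right hinf)
  have h01 : (⟨0, by omega⟩ : Fin d) = ⟨1, by omega⟩ :=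
    hinj (p, 0) hz ((hzero _).trans (hzero _).symm)
  simp at h01

/-- The slopes of the Legendre transform are locally of the form `q mᵢ(p)`: for fixed `p`, the
quotients `slope / q` are continuous in `q` and take values in a finite set. -/
lemma exists_isBranchAt (hd : 2 ≤ d) {V : Set (ℂ × ℂ)} (hV : IsOpen V)
    (hdiff : ∀ i, DifferentiableOn ℂ (slope i) V)
    (hinj : ∀ z ∈ V, Function.Injective fun i => slope i z)
    (hroot : ∀ z ∈ V, ∀ i, H.legEquation z (slope i z) = 0) {z : ℂ × ℂ} (hz : z ∈ V) :
    ∃ m, IsBranchAt slope z m := by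
  have hq : ∀ w ∈ V, w.2 ≠ 0 := fun w hw => H.snd_ne_zero_of_mem hd hV hinj hroot hw
  obtain ⟨ε, hε, hball⟩ := Metric.isOpen_iff.1 hV z hz
  have hmem : ∀ p ∈ Metric.ball z.1 ε, ∀ q ∈ Metric.ball z.2 ε, (p, q) ∈ V := fun p hp q hq => by
    refine hball ?_
    rw [← ball_prod_same]
    exact ⟨hp, hq⟩
  have hz2 : z.2 ∈ Metric.ball z.2 ε := Metric.mem_ball_self hε
  refine ⟨fun i p => slope i (p, z.2) / z.2, fun i => ⟨?_, ?_⟩⟩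
  · rw [Complex.analyticAt_iff_eventually_differentiableAt]
    filter_upwards [Metric.ball_mem_nhds z.1 hε] with p hp
    have h1 : DifferentiableAt ℂ (slope i) (p, z.2) :=
      (hdiff i).differentiableAt (hV.mem_nhds (hmem p hp _ hz2))
    have h2 : DifferentiableAt ℂ (fun p : ℂ => (p, z.2)) p := by fun_prop
    exact (h1.comp p h2).div_const _
  · filter_upwards [Metric.ball_mem_nhds z hε] with w hw
    rw [← ball_prod_same] at hw
    obtain ⟨hw1, hw2⟩ := hw
    have hw0 : w.2 ≠ 0 := hq _ (hmem _ hw1 _ hw2)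
    let T : Set ℂ := Set.range fun j => slope j (w.1, z.2) / z.2
    have hT : T.Finite := Set.finite_range _
    have hcont : ContinuousOn (fun q => slope i (w.1, q) / q) (Metric.ball z.2 ε) := by
      refine ContinuousOn.div ?_ continuousOn_id fun q hq' => hq (w.1, q) (hmem w.1 hw1 q hq')
      exact (hdiff i).continuousOn.comp (by fun_prop) fun q hq' => hmem w.1 hw1 q hq'
    have hmaps : Set.MapsTo (fun q => slope i (w.1, q) / q) (Metric.ball z.2 ε) T := by
      intro q hq'
      have hbase := hmem w.1 hw1 z.2 hz2
      have hqV := hmem w.1 hw1 q hq'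
      have hsys := H.isRootSystem_of_legEquation (hq _ hbase) (hinj _ hbase) (hroot _ hbase)
      have h0 := H.bev_div_of_legEquation (hq _ hqV) (hroot _ hqV i)
      obtain ⟨-, j, hj⟩ := hsys.exists_eq (by omega) (fun h0 => by
        obtain ⟨h1, h2⟩ := Prod.mk.inj h0
        rw [h1] at h2
        simp at h2) h0
      exact ⟨j, by rw [sub_sub_cancel, mul_one] at hj; exact hj.symm⟩
    have hconst : slope i (w.1, w.2) / w.2 = slope i (w.1, z.2) / z.2 :=
      (convex_ball z.2 ε).isPreconnected.constant_of_mapsTo hT.isDiscrete hcont hmaps hw2 hz2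
    rw [← hconst, mul_div_cancel₀ _ hw0]

lemma eventually_isRootSystem {V : Set (ℂ × ℂ)} (hV : IsOpen V)
    (hq : ∀ z ∈ V, z.2 ≠ 0)
    (hinj : ∀ z ∈ V, Function.Injective fun i => slope i z)
    (hroot : ∀ z ∈ V, ∀ i, H.legEquation z (slope i z) = 0) {z : ℂ × ℂ} (hz : z ∈ V)
    {m : Fin d → ℂ → ℂ} (hm : IsBranchAt slope z m) :
    ∀ᶠ p in 𝓝 z.1, H.IsRootSystem p fun i => m i p := by
  have hev : ∀ᶠ w in 𝓝 z, w ∈ V ∧ IsBranchAt slope w m :=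
    Filter.Eventually.and (hV.mem_nhds hz) hm.eventually
  have hc : ContinuousAt (fun p : ℂ => (p, z.2)) z.1 := by fun_prop
  filter_upwards [hc.eventually hev] with p hp
  obtain ⟨hpV, hpm⟩ := hp
  have h := H.isRootSystem_of_legEquation (hq _ hpV) (hinj _ hpV) (hroot _ hpV)
  simpa only [hpm.eq, mul_div_cancel_left₀ _ (hq _ hpV)] using h

/-- `Leg H` is flat as soon as `totalB` is locally constant for all local systems of solutions. -/
lemma legIsFlat_of_deriv_totalB (hd : 2 ≤ d)
    (h : ∀ (m : Fin d → ℂ → ℂ) (p : ℂ), (∀ i, AnalyticAt ℂ (m i) p) →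
      (∀ᶠ x in 𝓝 p, H.IsRootSystem x fun i => m i x) → deriv (totalB m) p = 0) : H.LegIsFlat := by
  intro V slope hV hdiff hinj hroot
  have hq : ∀ w ∈ V, w.2 ≠ 0 := fun w hw => H.snd_ne_zero_of_mem hd hV hinj hroot hw
  refine (exists_flat_iff hV hq hinj
    fun z hz => H.exists_isBranchAt hd hV hdiff hinj hroot hz).2 fun z hz m hm => ?_
  exact h m z.1 (fun i => (hm i).1) (H.eventually_isRootSystem hV hq hinj hroot hz hm)

/-- If `Leg H` is flat then `totalB` is locally constant for every local system of solutions. -/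
lemma LegIsFlat.deriv_totalB {H : HomogeneousFoliation d} (h : H.LegIsFlat)
    {m : Fin d → ℂ → ℂ} {U : Set ℂ} (hU : IsOpen U) (hm : ∀ i, DifferentiableOn ℂ (m i) U)
    (hroot : ∀ p ∈ U, H.IsRootSystem p fun i => m i p) {p : ℂ} (hp : p ∈ U) :
    deriv (totalB m) p = 0 := by
  let V : Set (ℂ × ℂ) := U ×ˢ {0}ᶜ
  have hV : IsOpen V := hU.prod isOpen_compl_singleton
  let slope : Fin d → ℂ × ℂ → ℂ := fun i z => z.2 * m i z.1
  have hinj : ∀ z ∈ V, Function.Injective fun i => slope i z := fun z hz i j hij =>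
    (hroot z.1 hz.1).1 (mul_left_cancel₀ hz.2 hij)
  have hbr : ∀ z ∈ V, IsBranchAt slope z m := fun z hz i =>
    ⟨(hm i).analyticAt (hU.mem_nhds hz.1), Eventually.of_forall fun _ => rfl⟩
  have hflat := h V slope hV
    (fun i => differentiableOn_snd.mul ((hm i).comp differentiableOn_fst fun z hz => hz.1)) hinj
    (fun z hz i => by
      have h1 := bev_smul (H.isHomogeneous_fiberForm z.1) z.2 (m i z.1) (z.1 * m i z.1 - 1)
      rw [(hroot z.1 hz.1).2 i, mul_zero] at h1
      rw [H.legEquation_eq, ← h1]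
      congr 1
      simp only [slope]
      ring)
  exact (exists_flat_iff hV (fun z hz => hz.2) hinj fun z hz => ⟨m, hbr z hz⟩).1 hflat (p, 1)
    ⟨hp, one_ne_zero⟩ m (hbr (p, 1) ⟨hp, one_ne_zero⟩)

end HomogeneousFoliation

/-! ### Quadratic forms interpolating values at points of the projective line -/

/-- The determinant of two vectors of `ℂ²`. -/
def bracket (v w : ℂ × ℂ) : ℂ := v.1 * w.2 - v.2 * w.1

/-- The product of a matrix and a vector of `ℂ²`. -/
def matAct (M : Matrix (Fin 2) (Fin 2) ℂ) (v : ℂ × ℂ) : ℂ × ℂ :=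
  (M 0 0 * v.1 + M 0 1 * v.2, M 1 0 * v.1 + M 1 1 * v.2)

lemma bracket_matAct (M : Matrix (Fin 2) (Fin 2) ℂ) (v w : ℂ × ℂ) :
    bracket (matAct M v) (matAct M w) = M.det * bracket v w := by
  simp only [bracket, matAct, Matrix.det_fin_two]
  ring

lemma bracket_smul_left (c : ℂ) (v w : ℂ × ℂ) : bracket (c • v) w = c * bracket v w := by
  simp only [bracket, Prod.smul_fst, Prod.smul_snd, smul_eq_mul]
  ring

lemma bracket_smul_right (c : ℂ) (v w : ℂ × ℂ) : bracket v (c • w) = c * bracket v w := by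
  simp only [bracket, Prod.smul_fst, Prod.smul_snd, smul_eq_mul]
  ring

/-- `f` is a quadratic form on `ℂ²`. -/
def IsQuadratic (f : ℂ × ℂ → ℂ) : Prop :=
  ∃ a b c : ℂ, ∀ v, f v = a * v.1 ^ 2 + b * (v.1 * v.2) + c * v.2 ^ 2

lemma IsQuadratic.add {f g : ℂ × ℂ → ℂ} (hf : IsQuadratic f) (hg : IsQuadratic g) :
    IsQuadratic fun v => f v + g v := by
  obtain ⟨a, b, c, h⟩ := hf
  obtain ⟨a', b', c', h'⟩ := hg
  exact ⟨a + a', b + b', c + c', fun v => by simp only [h, h']; ring⟩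

lemma IsQuadratic.sum {ι : Type*} (s : Finset ι) {f : ι → ℂ × ℂ → ℂ}
    (hf : ∀ i, IsQuadratic (f i)) : IsQuadratic fun v => ∑ i ∈ s, f i v := by
  choose a b c h using hf
  refine ⟨∑ i ∈ s, a i, ∑ i ∈ s, b i, ∑ i ∈ s, c i, fun v => ?_⟩
  simp only [h, Finset.sum_add_distrib, Finset.sum_mul]

lemma isQuadratic_bracket_mul (k l : ℂ) (w w' : ℂ × ℂ) :
    IsQuadratic fun v => k * (bracket v w * bracket v w') / l :=
  ⟨k * (w.2 * w'.2) / l, -(k * (w.2 * w'.1 + w.1 * w'.2)) / l, k * (w.1 * w'.1) / l, fun v => by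
    simp only [bracket]; ring⟩

section Interpolation

variable {d : ℕ}

/-- The quadratic form which takes the values `D_r`, `D_s`, `D_t` at the points
`w_r`, `w_s`, `w_t`, when these are pairwise independent. -/
noncomputable def interp (w : Fin d → ℂ × ℂ) (D : Fin d → ℂ) (v : ℂ × ℂ) (r s t : Fin d) : ℂ :=
  D r * (bracket v (w s) * bracket v (w t)) / (bracket (w r) (w s) * bracket (w r) (w t)) +
  D s * (bracket v (w r) * bracket v (w t)) / (bracket (w s) (w r) * bracket (w s) (w t)) +
  D t * (bracket v (w r) * bracket v (w s)) / (bracket (w t) (w r) * bracket (w t) (w s))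

lemma interp_swap_left (w : Fin d → ℂ × ℂ) (D : Fin d → ℂ) (v : ℂ × ℂ) (r s t : Fin d) :
    interp w D v s r t = interp w D v r s t := by
  simp only [interp, mul_comm (bracket (w t) _) (bracket (w t) _),
    mul_comm (bracket v (w s)) (bracket v (w r))]
  ring

lemma interp_swap_right (w : Fin d → ℂ × ℂ) (D : Fin d → ℂ) (v : ℂ × ℂ) (r s t : Fin d) :
    interp w D v r t s = interp w D v r s t := by
  simp only [interp]
  ring

lemma sumTriples_eq_distinct {f : Fin d → Fin d → Fin d → ℂ}
    (h1 : ∀ r s t, f s r t = f r s t) (h2 : ∀ r s t, f r t s = f r s t) :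
    6 * sumTriples f = ∑ r, ∑ s, ∑ t, if r ≠ s ∧ r ≠ t ∧ s ≠ t then f r s t else 0 := by
  let g : Fin d → Fin d → Fin d → ℂ := fun r s t => if r < s ∧ s < t then f r s t else 0
  have key : ∀ r s t, (if r ≠ s ∧ r ≠ t ∧ s ≠ t then f r s t else 0) =
      g r s t + g r t s + g s r t + g s t r + g t r s + g t s r := by
    intro r s t
    have e1 : f r t s = f r s t := h2 r s t
    have e2 : f s r t = f r s t := h1 r s t
    have e3 : f s t r = f r s t := (h2 s r t).trans e2
    have e4 : f t r s = f r s t := (h1 r t s).trans e1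
    have e5 : f t s r = f r s t := (h2 t r s).trans e4
    simp only [g, e1, e2, e3, e4, e5]
    split_ifs <;> first | (exfalso; omega) | simp
  simp only [key, Finset.sum_add_distrib]
  have c1 : ∀ k : Fin d → Fin d → Fin d → ℂ,
      ∑ r, ∑ s, ∑ t, k r t s = ∑ r, ∑ s, ∑ t, k r s t := fun k =>
    Finset.sum_congr rfl fun r _ => Finset.sum_comm
  have c2 : ∀ k : Fin d → Fin d → Fin d → ℂ,
      ∑ r, ∑ s, ∑ t, k s r t = ∑ r, ∑ s, ∑ t, k r s t := fun k => Finset.sum_comm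
  rw [c1 g, c2 g, (c2 fun a b c => g a c b).trans (c1 g), (c1 fun a b c => g b a c).trans (c2 g),
    (c1 fun a b c => g b c a).trans ((c2 fun a b c => g a c b).trans (c1 g))]
  change 6 * (∑ r, ∑ s, ∑ t, g r s t) = _
  ring

lemma sumTriples_perm {f : Fin d → Fin d → Fin d → ℂ}
    (h1 : ∀ r s t, f s r t = f r s t) (h2 : ∀ r s t, f r t s = f r s t) (π : Equiv.Perm (Fin d)) :
    sumTriples (fun r s t => f (π r) (π s) (π t)) = sumTriples f := by
  have h6 : (6 : ℂ) ≠ 0 := by norm_num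
  refine mul_left_cancel₀ h6 ?_
  rw [sumTriples_eq_distinct h1 h2, sumTriples_eq_distinct
    (f := fun r s t => f (π r) (π s) (π t)) (fun r s t => h1 _ _ _) fun r s t => h2 _ _ _]
  conv_rhs => rw [← Equiv.sum_comp π]
  refine Finset.sum_congr rfl fun r _ => ?_
  conv_rhs => rw [← Equiv.sum_comp π]
  refine Finset.sum_congr rfl fun s _ => ?_
  conv_rhs => rw [← Equiv.sum_comp π]
  refine Finset.sum_congr rfl fun t _ => ?_
  simp only [ne_eq, EmbeddingLike.apply_eq_iff_eq]

lemma sumTriples_congr {f g : Fin d → Fin d → Fin d → ℂ}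
    (h : ∀ r s t, r < s → s < t → f r s t = g r s t) : sumTriples f = sumTriples g :=
  Finset.sum_congr rfl fun r _ => Finset.sum_congr rfl fun s _ => Finset.sum_congr rfl fun t _ => by
    split_ifs with hrst
    · exact h r s t hrst.1 hrst.2
    · rfl

lemma mul_sumTriples (c : ℂ) (f : Fin d → Fin d → Fin d → ℂ) :
    c * sumTriples f = sumTriples fun r s t => c * f r s t := by
  simp only [sumTriples, Finset.mul_sum, mul_ite, mul_zero]

lemma sumTriples_sub (f g : Fin d → Fin d → Fin d → ℂ) :
    sumTriples (fun r s t => f r s t - g r s t) = sumTriples f - sumTriples g := by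
  simp only [sumTriples, ← Finset.sum_sub_distrib]
  exact Finset.sum_congr rfl fun r _ => Finset.sum_congr rfl fun s _ =>
    Finset.sum_congr rfl fun t _ => by split_ifs <;> simp

/-- The sum of the interpolating quadratic forms over all triples. -/
noncomputable def sumInterp (w : Fin d → ℂ × ℂ) (D : Fin d → ℂ) (v : ℂ × ℂ) : ℂ :=
  sumTriples (interp w D v)

lemma isQuadratic_sumInterp (w : Fin d → ℂ × ℂ) (D : Fin d → ℂ) : IsQuadratic (sumInterp w D) := by
  change IsQuadratic fun v => ∑ r, ∑ s, ∑ t, if r < s ∧ s < t then interp w D v r s t else 0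
  refine IsQuadratic.sum _ fun r => IsQuadratic.sum _ fun s => IsQuadratic.sum _ fun t => ?_
  by_cases h : r < s ∧ s < t
  · simp only [if_pos h]
    exact ((isQuadratic_bracket_mul _ _ _ _).add (isQuadratic_bracket_mul _ _ _ _)).add
      (isQuadratic_bracket_mul _ _ _ _)
  · simp only [if_neg h]
    exact ⟨0, 0, 0, fun v => by ring⟩

/-- If a linear map permutes the points `wᵢ` of the projective line, and the values `Dᵢ` behave as
the values of a quadratic form with weight `det`, then so does the sum of the interpolating
quadratic forms. -/
lemma sumInterp_matAct {M : Matrix (Fin 2) (Fin 2) ℂ} (hM : M.det ≠ 0) {w : Fin d → ℂ × ℂ}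
    {D : Fin d → ℂ} {π : Equiv.Perm (Fin d)} {c : Fin d → ℂ} (hc : ∀ i, c i ≠ 0)
    (hw : ∀ i, matAct M (w i) = c i • w (π i)) (hD : ∀ i, D i * M.det = c i ^ 2 * D (π i))
    (v : ℂ × ℂ) : sumInterp w D (matAct M v) = M.det * sumInterp w D v := by
  have hbr : ∀ i j, c i * (c j * bracket (w (π i)) (w (π j))) = M.det * bracket (w i) (w j) :=
    fun i j => by rw [← bracket_matAct, hw, hw, bracket_smul_left, bracket_smul_right]
  have hv : ∀ i, c i * bracket (matAct M v) (w (π i)) = M.det * bracket v (w i) := fun i => by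
    rw [← bracket_matAct, hw, bracket_smul_right]
  have hbr' : ∀ i j, bracket (w (π i)) (w (π j)) = M.det * bracket (w i) (w j) / (c i * c j) :=
    fun i j => by
      rw [← hbr, eq_div_iff (mul_ne_zero (hc i) (hc j))]; ring
  have hv' : ∀ i, bracket (matAct M v) (w (π i)) = M.det * bracket v (w i) / c i := fun i => by
    rw [← hv, mul_div_cancel_left₀ _ (hc i)]
  have hD' : ∀ i, D (π i) = D i * M.det / c i ^ 2 := fun i => by
    rw [hD, mul_div_cancel_left₀ _ (pow_ne_zero 2 (hc i))]
  have term : ∀ i j k, D (π i) * (bracket (matAct M v) (w (π j)) * bracket (matAct M v) (w (π k))) /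
      (bracket (w (π i)) (w (π j)) * bracket (w (π i)) (w (π k))) =
      M.det * (D i * (bracket v (w j) * bracket v (w k)) /
        (bracket (w i) (w j) * bracket (w i) (w k))) := fun i j k => by
    rw [hD', hv', hv', hbr', hbr']
    have h1 := hc i
    have h2 := hc j
    have h3 := hc k
    by_cases g1 : bracket (w i) (w j) = 0
    · simp [g1]
    by_cases g2 : bracket (w i) (w k) = 0
    · simp [g2]
    field_simp
  rw [sumInterp, ← sumTriples_perm (interp_swap_left _ _ _) (interp_swap_right _ _ _) π, sumInterp,
    mul_sumTriples]
  refine sumTriples_congr fun r s t _ _ => ?_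
  simp only [interp, term]
  ring

/-- The points of the line `y = p x - 1` with abscissas `mᵢ`. -/
def linePoint (p m : ℂ) : ℂ × ℂ := (m, p * m - 1)

lemma bracket_linePoint (p a b : ℂ) : bracket (linePoint p a) (linePoint p b) = b - a := by
  simp only [bracket, linePoint]; ring

lemma bracket_one_linePoint (p a : ℂ) : bracket (1, p) (linePoint p a) = -1 := by
  simp only [bracket, linePoint]; ring

lemma tripleB_eq_interp {p : ℂ} {m m' : Fin d → ℂ} {r s t : Fin d} (hrs : m r ≠ m s)
    (hrt : m r ≠ m t) (hst : m s ≠ m t) :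
    tripleB m m' r s t =
      1 - interp (fun i => linePoint p (m i)) (fun i => m' i + m i ^ 2) (1, p) r s t := by
  have h1 := sub_ne_zero.2 hrs
  have h2 := sub_ne_zero.2 hrt
  have h3 := sub_ne_zero.2 hst
  have e1 : m s - m r = -(m r - m s) := by ring
  have e2 : m t - m r = -(m r - m t) := by ring
  have e3 : m t - m s = -(m s - m t) := by ring
  simp only [tripleB, interp, bracket_linePoint, bracket_one_linePoint, e1, e2, e3]
  field_simp
  ring

lemma totalB_eq {p : ℂ} {m : Fin d → ℂ → ℂ} (hm : Function.Injective fun i => m i p) :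
    totalB m p = sumTriples (fun _ _ _ : Fin d => (1 : ℂ)) -
      sumInterp (fun i => linePoint p (m i p)) (fun i => deriv (m i) p + m i p ^ 2) (1, p) := by
  rw [sumInterp, ← sumTriples_sub]
  exact sumTriples_congr fun r s t hrs hst =>
    tripleB_eq_interp (hm.ne hrs.ne) (hm.ne (hrs.trans hst).ne) (hm.ne hst.ne)

end Interpolation

lemma ne_zero_of_bracket {l l' : ℂ × ℂ} (h : bracket l l' ≠ 0) : l ≠ 0 := by
  rintro rfl; exact h (by simp [bracket])

lemma exists_smul_of_bracket {l n : ℂ × ℂ} (hl : l ≠ 0) (hn : n ≠ 0) (h : bracket n l = 0) :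
    ∃ c : ℂ, c ≠ 0 ∧ n = c • l := by
  obtain ⟨c, rfl⟩ : ∃ c : ℂ, n = c • l := by
    simp only [bracket] at h
    by_cases h1 : l.1 = 0
    · have h2 : l.2 ≠ 0 := fun h2 => hl (Prod.ext h1 h2)
      have h3 : n.1 = 0 := (mul_eq_zero.1 (by rw [h1] at h; linear_combination h :
        n.1 * l.2 = 0)).resolve_right h2
      refine ⟨n.2 / l.2, Prod.ext ?_ ?_⟩ <;> simp [h1, h2, h3]
    · refine ⟨n.1 / l.1, Prod.ext ?_ ?_⟩
      · simp [h1]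
      · simp only [Prod.smul_snd, smul_eq_mul]
        field_simp
        linear_combination -h
  exact ⟨c, fun hc => hn (by simp [hc]), rfl⟩

lemma exists_bracket_ne_zero {l : ℂ × ℂ} (hl : l ≠ 0) : ∃ u, bracket u l ≠ 0 := by
  by_cases h1 : l.1 = 0
  · exact ⟨(1, 0), by simpa [bracket] using fun h2 => hl (Prod.ext h1 h2)⟩
  · exact ⟨(0, 1), by simpa [bracket] using h1⟩

/-! ### Linear symmetries of the Gauss map -/

namespace HomogeneousFoliation

variable {d : ℕ} (H : HomogeneousFoliation d)

/-- The invertible matrix `M` leaves the slope `-A/B` invariant. -/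
def IsSymmetry (M : Matrix (Fin 2) (Fin 2) ℂ) : Prop :=
  M.det ≠ 0 ∧ ∀ v : ℂ × ℂ, bev H.A (matAct M v).1 (matAct M v).2 * bev H.B v.1 v.2 =
    bev H.A v.1 v.2 * bev H.B (matAct M v).1 (matAct M v).2

variable {H} {M : Matrix (Fin 2) (Fin 2) ℂ}

lemma IsSymmetry.bev_fiberForm_eq_zero (hM : H.IsSymmetry M) {p : ℂ} {v : ℂ × ℂ} (hv : v ≠ 0)
    (h : bev (H.fiberForm p) v.1 v.2 = 0) :
    bev (H.fiberForm p) (matAct M v).1 (matAct M v).2 = 0 := by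
  have h2 := hM.2 v
  rw [bev_fiberForm] at h ⊢
  have hB : bev H.B v.1 v.2 ≠ 0 := fun hB => by
    rw [hB, mul_zero, add_zero] at h
    exact hv (H.eq_zero_of_bev h hB)
  refine (mul_eq_zero.1 (?_ : _ * bev H.B v.1 v.2 = 0)).resolve_right hB
  linear_combination h2 + bev H.B (matAct M v).1 (matAct M v).2 * h

lemma linePoint_ne_zero (p m : ℂ) : linePoint p m ≠ 0 := fun h => by
  obtain ⟨h1, h2⟩ := Prod.mk.inj h
  rw [h1] at h2
  simp at h2

lemma matAct_ne_zero (hM : M.det ≠ 0) {v : ℂ × ℂ} (hv : v ≠ 0) : matAct M v ≠ 0 := fun h => hv <| by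
  obtain ⟨h1, h2⟩ := Prod.mk.inj h
  rw [Matrix.det_fin_two] at hM
  ext
  · refine (mul_eq_zero.1 (?_ : _ * v.1 = 0)).resolve_left hM
    linear_combination M 1 1 * h1 - M 0 1 * h2
  · refine (mul_eq_zero.1 (?_ : _ * v.2 = 0)).resolve_left hM
    linear_combination M 0 0 * h2 - M 1 0 * h1

lemma IsSymmetry.exists_smul (hM : H.IsSymmetry M) (hd : d ≠ 0) {p : ℂ} {m : Fin d → ℂ}
    (hm : H.IsRootSystem p m) (i : Fin d) :
    ∃ (j : Fin d) (c : ℂ), c ≠ 0 ∧ matAct M (linePoint p (m i)) = c • linePoint p (m j) := by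
  have h0 := matAct_ne_zero hM.1 (linePoint_ne_zero p (m i))
  obtain ⟨hc, j, hj⟩ := hm.exists_eq (x := (matAct M (linePoint p (m i))).1)
    (y := (matAct M (linePoint p (m i))).2) hd h0
    (hM.bev_fiberForm_eq_zero (linePoint_ne_zero p (m i)) (hm.2 i))
  generalize matAct M (linePoint p (m i)) = u at *
  refine ⟨j, p * u.1 - u.2, hc, Prod.ext ?_ ?_⟩
  · simp only [linePoint, Prod.smul_mk, smul_eq_mul]
    linear_combination hj
  · simp only [linePoint, Prod.smul_mk, smul_eq_mul]
    linear_combination p * hj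

/-- A symmetry of the Gauss map permutes the branches of its inverse. -/
lemma IsSymmetry.exists_perm (hM : H.IsSymmetry M) (hd : d ≠ 0) {p : ℂ} {m : Fin d → ℂ}
    (hm : H.IsRootSystem p m) :
    ∃ (π : Equiv.Perm (Fin d)) (c : Fin d → ℂ), (∀ i, c i ≠ 0) ∧
      ∀ i, matAct M (linePoint p (m i)) = c i • linePoint p (m (π i)) := by
  choose f c hc hf using hM.exists_smul hd hm
  have hinj : Function.Injective f := fun i j hij => by
    have h := bracket_matAct M (linePoint p (m i)) (linePoint p (m j))
    rw [hf, hf, hij, bracket_smul_left, bracket_smul_right, bracket_linePoint, bracket_linePoint,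
      sub_self, mul_zero, mul_zero] at h
    exact (hm.1 (sub_eq_zero.1 ((mul_eq_zero.1 h.symm).resolve_left hM.1))).symm
  exact ⟨Equiv.ofBijective f (Finite.injective_iff_bijective.1 hinj), c, hc, hf⟩

/-- The derivatives of the branches permuted by a symmetry of the Gauss map. With
`wᵢ(p) = (mᵢ, p mᵢ - 1)`, the number `mᵢ' + mᵢ²` is the Wronskian `det(wᵢ, wᵢ')`, which behaves
like a quadratic form of weight `det`. -/
lemma IsSymmetry.deriv_eq (hM : H.IsSymmetry M) (hd : d ≠ 0) {p : ℂ} {m : Fin d → ℂ → ℂ}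
    (han : ∀ i, AnalyticAt ℂ (m i) p) (hm : ∀ᶠ x in 𝓝 p, H.IsRootSystem x fun i => m i x)
    {i j : Fin d} {c : ℂ} (hc : c ≠ 0)
    (hij : matAct M (linePoint p (m i p)) = c • linePoint p (m j p)) :
    (deriv (m i) p + m i p ^ 2) * M.det = c ^ 2 * (deriv (m j) p + m j p ^ 2) := by
  have hcont : ∀ k, ContinuousAt (m k) p := fun k => (han k).continuousAt
  have hne : ∀ᶠ x in 𝓝 p, ∀ k, k ≠ j →
      bracket (matAct M (linePoint x (m i x))) (linePoint x (m k x)) ≠ 0 := by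
    rw [eventually_all]
    intro k
    by_cases hk : k = j
    · simp [hk]
    simp only [ne_eq, hk, not_false_eq_true, forall_const]
    have hci := hcont i
    have hck := hcont k
    refine ContinuousAt.eventually_ne ?_ ?_
    · simp only [bracket, matAct, linePoint]
      fun_prop
    · rw [hij, bracket_smul_left, bracket_linePoint]
      exact mul_ne_zero hc (sub_ne_zero.2 (hm.self_of_nhds.1.ne hk))
  -- the symmetry sends the `i`-th branch to the `j`-th branch on a whole neighbourhood of `p`
  have hzero : (fun x => bracket (matAct M (linePoint x (m i x))) (linePoint x (m j x)))
      =ᶠ[𝓝 p] fun _ => 0 := by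
    filter_upwards [hne, hm] with x hx hmx
    obtain ⟨k, a, -, hk⟩ := hM.exists_smul hd hmx i
    have hkj : k = j := by
      by_contra hkj
      refine hx k hkj ?_
      rw [hk, bracket_smul_left, bracket_linePoint, sub_self, mul_zero]
    rw [hk, hkj, bracket_smul_left, bracket_linePoint, sub_self, mul_zero]
  have hi := (han i).differentiableAt.hasDerivAt
  have hj := (han j).differentiableAt.hasDerivAt
  have hli := ((hasDerivAt_id p).mul hi).sub_const 1
  have hlj := ((hasDerivAt_id p).mul hj).sub_const 1
  have hder := (((hi.const_mul (M 0 0)).add (hli.const_mul (M 0 1))).mul hlj).sub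
    (((hi.const_mul (M 1 0)).add (hli.const_mul (M 1 1))).mul hj)
  have h0 := hder.unique ((hasDerivAt_const p (0 : ℂ)).congr_of_eventuallyEq hzero)
  obtain ⟨h1, h2⟩ := Prod.mk.inj hij
  simp only [linePoint, smul_eq_mul] at h1 h2
  simp only [Pi.mul_apply, Pi.add_apply, id, one_mul] at h0
  rw [Matrix.det_fin_two]
  generalize deriv (m i) p = a' at *
  generalize deriv (m j) p = b' at *
  generalize m i p = a at *
  generalize m j p = b at *
  generalize M 0 0 = m00 at *
  generalize M 0 1 = m01 at *
  generalize M 1 0 = m10 at *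
  generalize M 1 1 = m11 at *
  linear_combination (m10 * a' + m11 * (a + p * a')) * h1 - (m00 * a' + m01 * (a + p * a')) * h2 -
    c * h0 + c * (b + p * b') * h1 - c * b' * h2

/-- If the symmetries of the Gauss map have no common nonzero semi-invariant quadratic form of
weight `det`, then `Leg H` is flat. -/
lemma legIsFlat_of_no_invariant (hd : 2 ≤ d)
    (hinv : ∀ f, IsQuadratic f → (∀ M, H.IsSymmetry M → ∀ v, f (matAct M v) = M.det * f v) →
      ∀ v, f v = 0) : H.LegIsFlat := by
  refine H.legIsFlat_of_deriv_totalB hd fun m p han hm => ?_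
  have hconst : totalB m =ᶠ[𝓝 p] fun _ => sumTriples fun _ _ _ : Fin d => (1 : ℂ) := by
    filter_upwards [hm.eventually_nhds, eventually_all.2 fun i => (han i).eventually_analyticAt]
      with x hx hax
    have hx0 := hx.self_of_nhds
    rw [totalB_eq hx0.1, hinv _ (isQuadratic_sumInterp _ _), sub_zero]
    intro M hM v
    obtain ⟨π, c, hc, hπ⟩ := hM.exists_perm (by omega) hx0
    exact sumInterp_matAct hM.1 hc hπ
      (fun i => hM.deriv_eq (by omega) hax hx (hc i) (hπ i)) v
  rw [hconst.deriv_eq, deriv_const]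

end HomogeneousFoliation

/-! ### The Galois group of the Gauss map acts by Möbius transformations -/

lemma ratFunc_algHom_ext {L : Type} [Field L] [Algebra ℂ L] {φ ψ : RatFunc ℂ →ₐ[ℂ] L}
    (h : φ RatFunc.X = ψ RatFunc.X) : φ = ψ := by
  have key : ∀ (χ : RatFunc ℂ →ₐ[ℂ] L) (P : Polynomial ℂ),
      χ (algebraMap _ _ P) = Polynomial.aeval (χ RatFunc.X) P := fun χ P => by
    rw [← RatFunc.aeval_X_left_eq_algebraMap, Polynomial.aeval_algHom_apply]
  ext u
  rw [← RatFunc.num_div_denom u, map_div₀, map_div₀, key, key, key, key, h]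

/-- A nonzero binary form does not vanish at `(1, r)` when `r` is transcendental. -/
lemma bev_one_ne_zero {L : Type} [Field L] [Algebra ℂ L] {r : L} (hr : Transcendental ℂ r)
    {F : MvPolynomial (Fin 2) ℂ} {d : ℕ} (hF : F.IsHomogeneous d) (hF0 : F ≠ 0) :
    bev F 1 r ≠ 0 := by
  have h : bev F 1 r = Polynomial.aeval r (bev F 1 (Polynomial.X : Polynomial ℂ)) := by
    rw [map_bev, map_one, Polynomial.aeval_X]
  rw [h]
  intro h0
  have hP : bev F 1 (Polynomial.X : Polynomial ℂ) = 0 := by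
    by_contra hne
    exact hr ⟨_, hne, h0⟩
  have : X 0 * F = 0 := by
    refine eq_of_bev_eq fun x y => ?_
    by_cases hx : x = 0
    · simp [hx]
    have h1 := congrArg (Polynomial.eval (y / x)) hP
    rw [eval_bev, Polynomial.eval_one, Polynomial.eval_X, Polynomial.eval_zero] at h1
    have h2 := bev_smul hF x 1 (y / x)
    rw [mul_one, mul_div_cancel₀ _ hx, h1, mul_zero] at h2
    simp [h2]
  exact hF0 ((mul_eq_zero.1 this).resolve_left (X_ne_zero 0))

namespace HomogeneousFoliation

variable {d : ℕ} {H : HomogeneousFoliation d}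

lemma gaussLine_eq (H : HomogeneousFoliation d) :
    H.gaussLine = -(bev H.A 1 RatFunc.X / bev H.B 1 RatFunc.X) := by
  have key : ∀ F : MvPolynomial (Fin 2) ℂ, algebraMap (Polynomial ℂ) (RatFunc ℂ)
      (aeval ![1, Polynomial.X] F) = bev F 1 RatFunc.X := fun F => by
    have h := map_bev (IsScalarTower.toAlgHom ℂ (Polynomial ℂ) (RatFunc ℂ)) F 1 Polynomial.X
    rw [map_one, IsScalarTower.coe_toAlgHom', RatFunc.algebraMap_X] at h
    exact h
  rw [gaussLine, key, key]

lemma gaussLine_ne_C (hd : d ≠ 0) : ¬ ∃ c, H.gaussLine = RatFunc.C c := by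
  rintro ⟨c, hc⟩
  have hB := bev_one_ne_zero RatFunc.transcendental_X H.homogeneous_B (H.B_ne_zero hd)
  refine bev_one_ne_zero RatFunc.transcendental_X (H.isHomogeneous_fiberForm c)
    (H.fiberForm_ne_zero hd c) ?_
  rw [gaussLine_eq, neg_eq_iff_eq_neg, div_eq_iff hB] at hc
  simp only [fiberForm, bev_add, bev_mul, bev_C, RatFunc.algebraMap_eq_C, hc]
  ring

lemma galois_algebraMap (σ : H.galoisGroup) (c : ℂ) :
    σ (algebraMap ℂ (RatFunc ℂ) c) = algebraMap ℂ (RatFunc ℂ) c :=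
  (σ.restrictScalars ℂ).commutes c

lemma galois_gaussLine (σ : H.galoisGroup) : σ H.gaussLine = H.gaussLine :=
  σ.commutes ⟨H.gaussLine, IntermediateField.mem_adjoin_simple_self ℂ _⟩

lemma galois_ext {σ τ : H.galoisGroup} (h : σ RatFunc.X = τ RatFunc.X) : σ = τ := by
  have h2 := ratFunc_algHom_ext (φ := (σ.restrictScalars ℂ : RatFunc ℂ →ₐ[ℂ] RatFunc ℂ))
    (ψ := (τ.restrictScalars ℂ : RatFunc ℂ →ₐ[ℂ] RatFunc ℂ)) h
  ext u
  exact DFunLike.congr_fun h2 u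

lemma finite_galoisGroup (hd : d ≠ 0) : Finite H.galoisGroup := by
  have hne := gaussLine_ne_C (H := H) hd
  have hpos : 0 < Module.finrank (IntermediateField.adjoin ℂ {H.gaussLine}) (RatFunc ℂ) := by
    rw [RatFunc.finrank_eq_max_natDegree, Nat.pos_iff_ne_zero, Ne, Nat.max_eq_zero_iff,
      ← RatFunc.eq_C_iff]
    exact hne
  have := Module.finite_of_finrank_pos hpos
  infer_instance

/-- The element `ℓ(1, t) = l₁ + l₂ t` of `ℂ(t)`. -/
noncomputable def linEv (l : ℂ × ℂ) : RatFunc ℂ :=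
  algebraMap ℂ (RatFunc ℂ) l.1 + algebraMap ℂ (RatFunc ℂ) l.2 * RatFunc.X

lemma linEv_eq_algebraMap (l : ℂ × ℂ) : linEv l =
    algebraMap (Polynomial ℂ) (RatFunc ℂ) (Polynomial.C l.1 + Polynomial.C l.2 * Polynomial.X) := by
  simp [linEv, RatFunc.algebraMap_eq_C]

lemma linEv_eq_zero {l : ℂ × ℂ} (h : linEv l = 0) : l = 0 := by
  rw [linEv_eq_algebraMap, map_eq_zero_iff _ (RatFunc.algebraMap_injective ℂ)] at h
  have h0 := congrArg (Polynomial.coeff · 0) h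
  have h1 := congrArg (Polynomial.coeff · 1) h
  simp at h0 h1
  exact Prod.ext h0 h1

/-- The linear form `ℓ ∘ M`. -/
def linComp (l : ℂ × ℂ) (M : Matrix (Fin 2) (Fin 2) ℂ) : ℂ × ℂ :=
  (l.1 * M 0 0 + l.2 * M 1 0, l.1 * M 0 1 + l.2 * M 1 1)

lemma bracket_linComp (l l' : ℂ × ℂ) (M : Matrix (Fin 2) (Fin 2) ℂ) :
    bracket (linComp l M) (linComp l' M) = M.det * bracket l l' := by
  simp only [bracket, linComp, Matrix.det_fin_two]
  ring

/-- `σ` is the Möbius transformation of matrix `M`. -/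
def IsMobius (σ : H.galoisGroup) (M : Matrix (Fin 2) (Fin 2) ℂ) : Prop :=
  linEv (M 0 0, M 0 1) ≠ 0 ∧
    ∀ l : ℂ × ℂ, σ (linEv l) * linEv (M 0 0, M 0 1) = linEv (linComp l M)

lemma isMobius_of_X {σ : H.galoisGroup} {M : Matrix (Fin 2) (Fin 2) ℂ}
    (h0 : linEv (M 0 0, M 0 1) ≠ 0)
    (h : σ RatFunc.X * linEv (M 0 0, M 0 1) = linEv (M 1 0, M 1 1)) : IsMobius σ M := by
  refine ⟨h0, fun l => ?_⟩
  rw [linEv, map_add, map_mul, galois_algebraMap, galois_algebraMap, add_mul, mul_assoc, h]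
  simp only [linEv, linComp, map_add, map_mul]
  ring

/-- An automorphism of `ℂ(t)` has degree one. -/
lemma exists_isMobius (σ : H.galoisGroup) :
    ∃ M : Matrix (Fin 2) (Fin 2) ℂ, M.det ≠ 0 ∧ IsMobius σ M := by
  set r := σ RatFunc.X with hr
  have hrC : ¬ ∃ c, r = RatFunc.C c := by
    rintro ⟨c, hc⟩
    have h2 : σ RatFunc.X = σ (algebraMap ℂ (RatFunc ℂ) c) := by
      rw [galois_algebraMap, RatFunc.algebraMap_eq_C]; exact hc
    refine RatFunc.transcendental_X (K := ℂ) ?_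
    rw [σ.injective h2]
    exact isAlgebraic_algebraMap c
  have htop : IntermediateField.adjoin ℂ {r} = ⊤ := by
    have h1 := IntermediateField.adjoin_map ℂ {(RatFunc.X : RatFunc ℂ)}
      (σ.restrictScalars ℂ : RatFunc ℂ →ₐ[ℂ] RatFunc ℂ)
    rw [RatFunc.adjoin_X, Set.image_singleton] at h1
    have h2 : IntermediateField.map (σ.restrictScalars ℂ : RatFunc ℂ →ₐ[ℂ] RatFunc ℂ) ⊤ = ⊤ := by
      rw [eq_top_iff]
      intro u _
      exact ⟨σ.symm u, trivial, σ.apply_symm_apply u⟩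
    rw [h2] at h1
    exact h1.symm
  have hdeg : max r.num.natDegree r.denom.natDegree = 1 := by
    rw [← RatFunc.finrank_eq_max_natDegree, htop, IntermediateField.finrank_top]
  have hn : r.num.natDegree ≤ 1 := by omega
  have hm : r.denom.natDegree ≤ 1 := by omega
  obtain ⟨b, a, hab⟩ := Polynomial.exists_eq_X_add_C_of_natDegree_le_one hn
  obtain ⟨e, c, hce⟩ := Polynomial.exists_eq_X_add_C_of_natDegree_le_one hm
  have hden : linEv (c, e) = algebraMap _ _ r.denom := by
    rw [linEv_eq_algebraMap, hce, add_comm]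
  have hnum : linEv (a, b) = algebraMap _ _ r.num := by
    rw [linEv_eq_algebraMap, hab, add_comm]
  have hden0 : linEv (c, e) ≠ 0 := by
    rw [hden]; exact RatFunc.algebraMap_ne_zero r.denom_ne_zero
  have hrel : r * linEv (c, e) = linEv (a, b) := by
    rw [hden, hnum]
    nth_rewrite 1 [← RatFunc.num_div_denom r]
    rw [div_mul_cancel₀ _ (RatFunc.algebraMap_ne_zero r.denom_ne_zero)]
  refine ⟨!![c, e; a, b], fun hdet => hrC ?_, isMobius_of_X (by simpa using hden0)
    (by simpa using hrel)⟩
  rw [Matrix.det_fin_two_of] at hdet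
  have key : ∀ u v : ℂ, u ≠ 0 → algebraMap ℂ (RatFunc ℂ) u * linEv (a, b) =
      algebraMap ℂ (RatFunc ℂ) v * linEv (c, e) → ∃ k, r = RatFunc.C k := fun u v hu huv => by
    refine ⟨v / u, ?_⟩
    have hu' : algebraMap ℂ (RatFunc ℂ) u ≠ 0 := (map_ne_zero _).2 hu
    rw [← RatFunc.algebraMap_eq_C, map_div₀, eq_div_iff hu']
    refine mul_right_cancel₀ hden0 ?_
    rw [← huv, ← hrel]
    ring
  have hdet' : algebraMap ℂ (RatFunc ℂ) c * algebraMap ℂ (RatFunc ℂ) b =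
      algebraMap ℂ (RatFunc ℂ) e * algebraMap ℂ (RatFunc ℂ) a := by
    rw [← map_mul, ← map_mul, sub_eq_zero.1 hdet]
  by_cases he : e = 0
  · have hc0 : c ≠ 0 := by
      rintro rfl
      exact hden0 (by simp [linEv, he])
    refine key c a hc0 ?_
    simp only [linEv]
    linear_combination RatFunc.X * hdet'
  · refine key e b he ?_
    simp only [linEv]
    linear_combination -hdet'

lemma isSymmetry_of_isMobius (hd : d ≠ 0) {σ : H.galoisGroup} {M : Matrix (Fin 2) (Fin 2) ℂ}
    (hdet : M.det ≠ 0) (h : IsMobius σ M) : H.IsSymmetry M := by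
  set D := linEv (M 0 0, M 0 1) with hD
  set N := linEv (M 1 0, M 1 1) with hN
  set r := σ RatFunc.X with hr
  have hX : r * D = N := by
    have := h.2 (0, 1)
    rw [hD, hN]
    simpa only [linEv, linComp, map_zero, map_one, zero_mul, one_mul, zero_add] using this
  have hrt : Transcendental ℂ r := fun halg => RatFunc.transcendental_X (K := ℂ)
    ((isAlgebraic_algHom_iff (σ.restrictScalars ℂ : RatFunc ℂ →ₐ[ℂ] RatFunc ℂ) σ.injective).1 halg)
  have hσ : ∀ F : MvPolynomial (Fin 2) ℂ, σ (bev F 1 RatFunc.X) = bev F 1 r := fun F => by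
    have := map_bev (σ.restrictScalars ℂ : RatFunc ℂ →ₐ[ℂ] RatFunc ℂ) F 1 RatFunc.X
    rw [map_one] at this
    exact this
  have hB := bev_one_ne_zero RatFunc.transcendental_X H.homogeneous_B (H.B_ne_zero hd)
  have hBr := bev_one_ne_zero hrt H.homogeneous_B (H.B_ne_zero hd)
  have h1 := (congrArg σ (gaussLine_eq H)).symm.trans ((galois_gaussLine σ).trans (gaussLine_eq H))
  rw [map_neg, map_div₀, hσ, hσ, neg_inj, div_eq_div_iff hBr hB] at h1
  have hA2 : bev H.A D N = D ^ d * bev H.A 1 r := by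
    rw [← bev_smul H.homogeneous_A, mul_one, ← hX, mul_comm]
  have hB2 : bev H.B D N = D ^ d * bev H.B 1 r := by
    rw [← bev_smul H.homogeneous_B, mul_one, ← hX, mul_comm]
  have h2 : bev H.A D N * bev H.B 1 RatFunc.X = bev H.A 1 RatFunc.X * bev H.B D N := by
    rw [hA2, hB2]
    linear_combination D ^ d * h1
  set ι := IsScalarTower.toAlgHom ℂ (Polynomial ℂ) (RatFunc ℂ)
  set PD : Polynomial ℂ := Polynomial.C (M 0 0) + Polynomial.C (M 0 1) * Polynomial.X
  set PN : Polynomial ℂ := Polynomial.C (M 1 0) + Polynomial.C (M 1 1) * Polynomial.X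
  have hDι : D = ι PD := linEv_eq_algebraMap _
  have hNι : N = ι PN := linEv_eq_algebraMap _
  have hXι : RatFunc.X = ι Polynomial.X := RatFunc.algebraMap_X.symm
  have h3 : bev H.A PD PN * bev H.B 1 Polynomial.X = bev H.A 1 Polynomial.X * bev H.B PD PN := by
    refine RatFunc.algebraMap_injective ℂ (?_ : ι _ = ι _)
    rw [map_mul, map_mul, map_bev, map_bev, map_bev, map_bev, map_one, ← hDι, ← hNι, ← hXι, h2]
  let P0 : MvPolynomial (Fin 2) ℂ := C (M 0 0) * X 0 + C (M 0 1) * X 1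
  let P1 : MvPolynomial (Fin 2) ℂ := C (M 1 0) * X 0 + C (M 1 1) * X 1
  have h4 : X 0 * (bev H.A P0 P1 * H.B - H.A * bev H.B P0 P1) = 0 := by
    refine eq_of_bev_eq fun x y => ?_
    simp only [bev_mul, bev_sub, bev_bev, bev_X_zero, bev_zero, P0, P1, bev_add, bev_C, bev_X_one,
      Algebra.algebraMap_self, RingHom.id_apply]
    by_cases hx : x = 0
    · rw [hx, zero_mul]
    have h5 := congrArg (Polynomial.eval (y / x)) h3
    simp only [Polynomial.eval_mul, eval_bev, Polynomial.eval_one, Polynomial.eval_X, PD, PN,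
      Polynomial.eval_add, Polynomial.eval_C] at h5
    have e1 : ∀ a b : ℂ, a * x + b * y = x * (a + b * (y / x)) := fun a b => by field_simp
    have e2 : y = x * (y / x) := (mul_div_cancel₀ _ hx).symm
    have e3 : ∀ {F : MvPolynomial (Fin 2) ℂ}, F.IsHomogeneous d →
        bev F x y = x ^ d * bev F 1 (y / x) := fun hF => by
      rw [← bev_smul hF, mul_one, ← e2]
    rw [e3 H.homogeneous_A, e3 H.homogeneous_B, e1, e1, bev_smul H.homogeneous_A,
      bev_smul H.homogeneous_B]
    linear_combination x * x ^ d * x ^ d * h5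
  have h6 := sub_eq_zero.1 ((mul_eq_zero.1 h4).resolve_left (X_ne_zero 0))
  refine ⟨hdet, fun v => ?_⟩
  have h7 := congrArg (fun F => bev F v.1 v.2) h6
  simpa only [bev_mul, bev_bev, bev_X_zero, P0, P1, bev_add, bev_C, bev_X_one,
      Algebra.algebraMap_self, RingHom.id_apply, matAct] using h7

/-! ### Invariant quadratic forms and cyclic groups -/

lemma eq_one_of_fixes {σ : H.galoisGroup} {l l' : ℂ × ℂ} (hl : bracket l l' ≠ 0)
    (h : σ (linEv l / linEv l') = linEv l / linEv l') : σ = 1 := by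
  have hl' : l' ≠ 0 := by rintro rfl; exact hl (by simp [bracket])
  have h0 : linEv l' ≠ 0 := fun h => hl' (linEv_eq_zero h)
  have h1 : σ (linEv l') ≠ 0 := (map_ne_zero σ).2 h0
  rw [map_div₀, div_eq_div_iff h1 h0] at h
  refine galois_ext ?_
  rw [AlgEquiv.one_apply]
  simp only [linEv, map_add, map_mul, galois_algebraMap] at h
  have h2 : algebraMap ℂ (RatFunc ℂ) (bracket l l') * (σ RatFunc.X - RatFunc.X) = 0 := by
    simp only [bracket, map_sub, map_mul]
    linear_combination -h
  exact sub_eq_zero.1 ((mul_eq_zero.1 h2).resolve_left ((map_ne_zero _).2 hl))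

/-- If every element of the Galois group fixes two points of the projective line, the Galois group
is cyclic: it embeds into the multiplicative group by the multipliers. -/
lemma isCyclic_of_multiplier (hd : d ≠ 0) {l l' : ℂ × ℂ} (hl : bracket l l' ≠ 0)
    (h : ∀ σ : H.galoisGroup, ∃ c : ℂ,
      σ (linEv l / linEv l') = algebraMap ℂ (RatFunc ℂ) c * (linEv l / linEv l')) :
    IsCyclic H.galoisGroup := by
  have := finite_galoisGroup (H := H) hd
  set θ := linEv l / linEv l' with hθ
  have hl0 : l ≠ 0 := by rintro rfl; exact hl (by simp [bracket])
  have hl' : l' ≠ 0 := by rintro rfl; exact hl (by simp [bracket])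
  have hθ0 : θ ≠ 0 := div_ne_zero (fun h => hl0 (linEv_eq_zero h)) fun h => hl' (linEv_eq_zero h)
  choose c hc using h
  have hinj := (algebraMap ℂ (RatFunc ℂ)).injective
  let φ : H.galoisGroup →* ℂ :=
    { toFun := c
      map_one' := hinj <| mul_right_cancel₀ hθ0 <| by
        rw [← hc, map_one, one_mul, AlgEquiv.one_apply]
      map_mul' := fun σ τ => hinj <| mul_right_cancel₀ hθ0 <| by
        rw [← hc, AlgEquiv.mul_apply, hc τ, map_mul, galois_algebraMap, hc σ, map_mul]
        ring }
  refine isCyclic_of_injective_ringHom φ ((injective_iff_map_eq_one φ).2 fun σ hσ => ?_)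
  have hσ' : c σ = 1 := hσ
  exact eq_one_of_fixes hl (by rw [← hθ, hc, hσ', map_one, one_mul])

/-- An element of finite order is not a nontrivial translation. -/
lemma eq_one_of_translation (hd : d ≠ 0) {σ : H.galoisGroup} {l l' : ℂ × ℂ}
    (hl : bracket l l' ≠ 0) {c : ℂ}
    (h : σ (linEv l / linEv l') = linEv l / linEv l' + algebraMap ℂ (RatFunc ℂ) c) : σ = 1 := by
  have := finite_galoisGroup (H := H) hd
  have hpow : ∀ n : ℕ, (σ ^ n) (linEv l / linEv l') =
      linEv l / linEv l' + algebraMap ℂ (RatFunc ℂ) (n * c) := fun n => by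
    induction n with
    | zero => simp
    | succ n ih =>
      rw [pow_succ', AlgEquiv.mul_apply, ih, map_add, galois_algebraMap, h]
      rw [add_assoc, ← map_add]
      push_cast
      ring_nf
  have h1 := hpow (orderOf σ)
  rw [pow_orderOf_eq_one, AlgEquiv.one_apply, left_eq_add, map_eq_zero, mul_eq_zero,
    Nat.cast_eq_zero] at h1
  have hc : c = 0 := h1.resolve_left (orderOf_pos σ).ne'
  exact eq_one_of_fixes hl (by rw [h, hc, map_zero, add_zero])

lemma IsMobius.map_div {σ : H.galoisGroup} {M : Matrix (Fin 2) (Fin 2) ℂ} (h : IsMobius σ M)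
    (l l' : ℂ × ℂ) :
    σ (linEv l / linEv l') = linEv (linComp l M) / linEv (linComp l' M) := by
  rw [map_div₀, ← h.2, ← h.2, mul_div_mul_right _ _ h.1]

lemma linEv_smul_add (a b : ℂ) (l l' : ℂ × ℂ) : linEv (a • l + b • l') =
    algebraMap ℂ (RatFunc ℂ) a * linEv l + algebraMap ℂ (RatFunc ℂ) b * linEv l' := by
  simp only [linEv, Prod.fst_add, Prod.snd_add, Prod.smul_fst, Prod.smul_snd, smul_eq_mul, map_add,
    map_mul]
  ring

/-- A lower triangular Möbius transformation with equal diagonal entries is a translation. -/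
lemma eq_one_of_unipotent (hd : d ≠ 0) {σ : H.galoisGroup} {M : Matrix (Fin 2) (Fin 2) ℂ}
    (h : IsMobius σ M) {l l' : ℂ × ℂ} (hl : bracket l l' ≠ 0) {a b : ℂ} (ha : a ≠ 0)
    (h1 : linComp l' M = a • l') (h2 : linComp l M = a • l + b • l') : σ = 1 := by
  have hl' : l' ≠ 0 := by rintro rfl; exact hl (by simp [bracket])
  have h0 : linEv l' ≠ 0 := fun h => hl' (linEv_eq_zero h)
  refine eq_one_of_translation hd hl (c := b / a) ?_
  have ha' : algebraMap ℂ (RatFunc ℂ) a ≠ 0 := (map_ne_zero _).2 ha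
  have h3 : linEv (linComp l' M) = algebraMap ℂ (RatFunc ℂ) a * linEv l' := by
    rw [h1]
    simpa using linEv_smul_add a 0 l' l'
  rw [h.map_div, h2, h3, linEv_smul_add, map_div₀]
  field_simp

lemma map_div_of_diagonal {σ : H.galoisGroup} {M : Matrix (Fin 2) (Fin 2) ℂ}
    (h : IsMobius σ M) {l l' : ℂ × ℂ} {a b : ℂ}
    (h1 : linComp l M = a • l) (h2 : linComp l' M = b • l') :
    σ (linEv l / linEv l') = algebraMap ℂ (RatFunc ℂ) (a / b) * (linEv l / linEv l') := by
  have e : ∀ (k : ℂ) (u : ℂ × ℂ), linEv (k • u) = algebraMap ℂ (RatFunc ℂ) k * linEv u :=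
    fun k u => by simpa using linEv_smul_add k 0 u u
  rw [h.map_div, h1, h2, e, e, map_div₀, mul_div_mul_comm]

lemma exists_decomposition {l l' : ℂ × ℂ} (hl : bracket l l' ≠ 0) (u : ℂ × ℂ) :
    ∃ a b : ℂ, u = a • l + b • l' := by
  refine ⟨bracket u l' / bracket l l', bracket l u / bracket l l', Prod.ext ?_ ?_⟩ <;>
  · simp only [Prod.fst_add, Prod.snd_add, Prod.smul_fst, Prod.smul_snd, smul_eq_mul]
    field_simp
    simp only [bracket]
    ring

/-- The value of a linear form. -/
def linAp (l v : ℂ × ℂ) : ℂ := l.1 * v.1 + l.2 * v.2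

lemma linAp_matAct (l v : ℂ × ℂ) (M : Matrix (Fin 2) (Fin 2) ℂ) :
    linAp l (matAct M v) = linAp (linComp l M) v := by
  simp only [linAp, matAct, linComp]; ring

lemma linAp_smul (a : ℂ) (l v : ℂ × ℂ) : linAp (a • l) v = a * linAp l v := by
  simp only [linAp, Prod.smul_fst, Prod.smul_snd, smul_eq_mul]; ring

lemma linAp_smul_add (a b : ℂ) (l l' v : ℂ × ℂ) :
    linAp (a • l + b • l') v = a * linAp l v + b * linAp l' v := by
  simp only [linAp, Prod.fst_add, Prod.snd_add, Prod.smul_fst, Prod.smul_snd, smul_eq_mul]; ring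

lemma exists_linAp_eq {l l' : ℂ × ℂ} (hl : bracket l l' ≠ 0) (s t : ℂ) :
    ∃ v, linAp l v = s ∧ linAp l' v = t := by
  refine ⟨((s * l'.2 - t * l.2) / bracket l l', (t * l.1 - s * l'.1) / bracket l l'), ?_, ?_⟩ <;>
  · simp only [linAp]
    field_simp
    simp only [bracket]
    ring

lemma bracket_smul_add (a b a' b' : ℂ) (l l' : ℂ × ℂ) :
    bracket (a • l + b • l') (a' • l + b' • l') = (a * b' - b * a') * bracket l l' := by
  simp only [bracket, Prod.fst_add, Prod.snd_add, Prod.smul_fst, Prod.smul_snd, smul_eq_mul]; ring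

/-- A quadratic form over `ℂ` is a product of two linear forms. -/
lemma _root_.HomFol.IsQuadratic.exists_factor {f : ℂ × ℂ → ℂ} (hf : IsQuadratic f) :
    ∃ l l' : ℂ × ℂ, ∀ v, f v = linAp l v * linAp l' v := by
  obtain ⟨a, b, c, h⟩ := hf
  by_cases hc : c = 0
  · exact ⟨(1, 0), (a, b), fun v => by rw [h, hc]; simp only [linAp]; ring⟩
  · obtain ⟨s, hs⟩ := IsAlgClosed.exists_pow_nat_eq (b ^ 2 - 4 * a * c) (n := 2) (by norm_num)
    refine ⟨((b - s) / 2, c), ((b + s) / (2 * c), 1), fun v => ?_⟩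
    rw [h]
    simp only [linAp]
    field_simp
    linear_combination v.1 ^ 2 * hs

/-- If a nonzero quadratic form is semi-invariant of weight `det` under the Galois group, then
the Galois group is cyclic. -/
lemma isCyclic_of_invariant (hd : d ≠ 0) {f : ℂ × ℂ → ℂ} (hf : IsQuadratic f)
    (hinv : ∀ M, H.IsSymmetry M → ∀ v, f (matAct M v) = M.det * f v) {v₀ : ℂ × ℂ}
    (hv₀ : f v₀ ≠ 0) : IsCyclic H.galoisGroup := by
  obtain ⟨l, l', hll⟩ := hf.exists_factor
  by_cases hl : bracket l l' = 0
  · -- `f` is a multiple of a square: every element of the group is unipotent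
    have hl0 : l ≠ 0 := by rintro rfl; exact hv₀ (by simp [hll, linAp])
    have hl0' : l' ≠ 0 := by rintro rfl; exact hv₀ (by simp [hll, linAp])
    obtain ⟨k, hk0, hk⟩ := exists_smul_of_bracket hl0 hl0'
      (by simp only [bracket] at hl ⊢; linear_combination -hl)
    obtain ⟨n, hn⟩ := exists_bracket_ne_zero hl0
    have htriv : ∀ σ : H.galoisGroup, σ = 1 := fun σ => by
      obtain ⟨M, hdet, hM⟩ := exists_isMobius σ
      have hMs := isSymmetry_of_isMobius hd hdet hM
      obtain ⟨a, b, hab⟩ := exists_decomposition hn (linComp l M)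
      obtain ⟨a', b', hab'⟩ := exists_decomposition hn (linComp n M)
      have hsq : ∀ s t : ℂ, (a * s + b * t) ^ 2 = M.det * t ^ 2 := fun s t => by
        obtain ⟨v, hs, ht⟩ := exists_linAp_eq hn s t
        have h1 := hinv M hMs v
        rw [hll, hll, hk, linAp_matAct, linAp_matAct] at h1
        rw [← linAp_matAct (k • l), linAp_smul, linAp_smul, linAp_matAct, hab,
          linAp_smul_add, hs, ht] at h1
        refine mul_left_cancel₀ hk0 ?_
        linear_combination h1
      have ha : a = 0 := by simpa using hsq 1 0
      have hb : b ^ 2 = M.det := by simpa using hsq 0 1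
      have hb0 : b ≠ 0 := by rintro rfl; exact hdet (by rw [← hb]; ring)
      have hdet2 := bracket_linComp n l M
      rw [hab, hab', bracket_smul_add, ← hb, ha] at hdet2
      have hab2 : a' = b := by
        have h3 := mul_right_cancel₀ hn hdet2
        refine mul_right_cancel₀ hb0 ?_
        linear_combination h3
      refine eq_one_of_unipotent hd hM hn hb0 ?_ (by rw [hab', hab2])
      rw [hab, ha, zero_smul, zero_add]
    have : Subsingleton H.galoisGroup := ⟨fun σ τ => (htriv σ).trans (htriv τ).symm⟩
    infer_instance
  · -- every element of the group preserves the two lines of zeros of `f`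
    refine isCyclic_of_multiplier hd hl fun σ => ?_
    obtain ⟨M, hdet, hM⟩ := exists_isMobius σ
    have hMs := isSymmetry_of_isMobius hd hdet hM
    obtain ⟨a, b, hab⟩ := exists_decomposition hl (linComp l M)
    obtain ⟨a', b', hab'⟩ := exists_decomposition hl (linComp l' M)
    have hsq : ∀ s t : ℂ, (a * s + b * t) * (a' * s + b' * t) = M.det * (s * t) := fun s t => by
      obtain ⟨v, hs, ht⟩ := exists_linAp_eq hl s t
      have h1 := hinv M hMs v
      rwa [hll, hll, linAp_matAct, linAp_matAct, hab, hab', linAp_smul_add, linAp_smul_add, hs,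
        ht] at h1
    have hdet2 := bracket_linComp l l' M
    rw [hab, hab', bracket_smul_add] at hdet2
    have h3 := mul_right_cancel₀ hl hdet2
    have h10 := hsq 1 0
    have h01 := hsq 0 1
    have h11 := hsq 1 1
    simp only [mul_one, mul_zero, add_zero, zero_add] at h10 h01 h11
    -- exchanging the two lines would give the weight `-det`
    have hba : b * a' = 0 := by linear_combination (h11 - h10 - h01 - h3) / 2
    have hab0 : a * b' ≠ 0 := fun h => hdet (by linear_combination h - hba - h3)
    have ha : a ≠ 0 := left_ne_zero_of_mul hab0
    have hb' : b' ≠ 0 := right_ne_zero_of_mul hab0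
    have ha' : a' = 0 := (mul_eq_zero.1 h10).resolve_left ha
    have hb : b = 0 := (mul_eq_zero.1 h01).resolve_right hb'
    rw [hb, zero_smul, add_zero] at hab
    rw [ha', zero_smul, zero_add] at hab'
    exact ⟨a / b', map_div_of_diagonal hM hab hab'⟩

lemma legIsFlat_of_not_isCyclic (hd : 2 ≤ d) (h : ¬ IsCyclic H.galoisGroup) : H.LegIsFlat :=
  legIsFlat_of_no_invariant hd fun f hf hinv v => by
    by_contra hv
    exact h (isCyclic_of_invariant (by omega) hf hinv hv)

end HomogeneousFoliation

/-! ### The order of the Galois group -/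

/-- The substitution `x ↦ s`, `y ↦ t s` is injective on polynomials: the coefficient of `sⁿ` in the
image is the value at `(1, t)` of the homogeneous component of degree `n`. -/
lemma injective_substitution {R : Type} [Field R] [Algebra ℂ R] {t : R} (ht : Transcendental ℂ t) :
    Function.Injective (fun F : MvPolynomial (Fin 2) ℂ =>
      bev F (Polynomial.X : Polynomial R) (Polynomial.C t * Polynomial.X)) := by
  have h0 : ∀ F : MvPolynomial (Fin 2) ℂ,
      bev F (Polynomial.X : Polynomial R) (Polynomial.C t * Polynomial.X) = 0 → F = 0 := by
    intro F hF
    have hcomp : ∀ n, bev (homogeneousComponent n F) (Polynomial.X : Polynomial R)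
        (Polynomial.C t * Polynomial.X) =
        Polynomial.C (bev (homogeneousComponent n F) 1 t) * Polynomial.X ^ n := fun n => by
      have h1 := bev_smul (homogeneousComponent_isHomogeneous n F) (Polynomial.X : Polynomial R) 1
        (Polynomial.C t)
      have h2 := map_bev (IsScalarTower.toAlgHom ℂ R (Polynomial R)) (homogeneousComponent n F) 1 t
      rw [map_one] at h2
      rw [mul_one, mul_comm Polynomial.X (Polynomial.C t)] at h1
      rw [h1, mul_comm]
      exact congrArg (· * Polynomial.X ^ n) h2.symm
    have hsum : bev F (Polynomial.X : Polynomial R) (Polynomial.C t * Polynomial.X) =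
        ∑ n ∈ Finset.range (F.totalDegree + 1),
          Polynomial.C (bev (homogeneousComponent n F) 1 t) * Polynomial.X ^ n := by
      conv_lhs => rw [← sum_homogeneousComponent F]
      simp only [← hcomp]
      exact map_sum (aeval _) _ _
    rw [hsum] at hF
    rw [← sum_homogeneousComponent F]
    refine Finset.sum_eq_zero fun n hn => ?_
    have h3 := congrArg (Polynomial.coeff · n) hF
    simp only [Polynomial.finsetSum_coeff, Polynomial.coeff_C_mul_X_pow, Polynomial.coeff_zero,
      Finset.sum_ite_eq, hn, if_true] at h3
    by_contra hne
    exact bev_one_ne_zero ht (homogeneousComponent_isHomogeneous n F) hne h3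
  intro F G hFG
  refine sub_eq_zero.1 (h0 _ ?_)
  rw [bev_sub]
  exact sub_eq_zero.2 hFG

/-- The coordinate `x` of `ℂ(x, y)`. -/
noncomputable def coordX : FunField := algebraMap (MvPolynomial (Fin 2) ℂ) FunField (X 0)

/-- The coordinate `y` of `ℂ(x, y)`. -/
noncomputable def coordY : FunField := algebraMap (MvPolynomial (Fin 2) ℂ) FunField (X 1)

/-- The function `t = y / x` of `ℂ(x, y)`. -/
noncomputable def coordT : FunField := coordY / coordX

lemma coordX_ne_zero : coordX ≠ 0 := by
  rw [coordX, Ne, map_eq_zero_iff _ (IsFractionRing.injective _ _)]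
  exact X_ne_zero 0

/-- The embedding `x ↦ s`, `y ↦ t s` of `ℂ(x, y)` into `ℂ(t)(s)`. -/
lemma exists_embedding : ∃ j : FunField →ₐ[ℂ] RatFunc (RatFunc ℂ),
    j coordT = algebraMap (RatFunc ℂ) (RatFunc (RatFunc ℂ)) RatFunc.X := by
  let φ : MvPolynomial (Fin 2) ℂ →ₐ[ℂ] RatFunc (RatFunc ℂ) :=
    aeval ![RatFunc.X, algebraMap (RatFunc ℂ) (RatFunc (RatFunc ℂ)) RatFunc.X * RatFunc.X]
  let ι := IsScalarTower.toAlgHom ℂ (Polynomial (RatFunc ℂ)) (RatFunc (RatFunc ℂ))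
  have hφ : Function.Injective φ := by
    have h : (φ : MvPolynomial (Fin 2) ℂ → _) = ι ∘ fun F =>
        bev F (Polynomial.X : Polynomial (RatFunc ℂ)) (Polynomial.C RatFunc.X * Polynomial.X) := by
      funext F
      rw [Function.comp_apply, map_bev, map_mul]
      have e1 : ι Polynomial.X = RatFunc.X := RatFunc.algebraMap_X
      have e2 : ι (Polynomial.C RatFunc.X) = algebraMap (RatFunc ℂ) _ RatFunc.X :=
        RatFunc.algebraMap_C _
      rw [e1, e2]
      rfl
    rw [h]
    exact (RatFunc.algebraMap_injective _).comp (injective_substitution RatFunc.transcendental_X)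
  have hX : IsFractionRing.liftAlgHom (K := FunField) hφ coordX = RatFunc.X := by
    rw [coordX, IsFractionRing.liftAlgHom_apply, IsFractionRing.lift_algebraMap]
    simp [φ]
  have hY : IsFractionRing.liftAlgHom (K := FunField) hφ coordY =
      algebraMap (RatFunc ℂ) (RatFunc (RatFunc ℂ)) RatFunc.X * RatFunc.X := by
    rw [coordY, IsFractionRing.liftAlgHom_apply, IsFractionRing.lift_algebraMap]
    simp [φ]
  refine ⟨IsFractionRing.liftAlgHom hφ, ?_⟩
  rw [coordT, map_div₀, hX, hY]
  exact (div_eq_iff RatFunc.X_ne_zero).2 rfl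

lemma coordT_mul_coordX : coordT * coordX = coordY := div_mul_cancel₀ _ coordX_ne_zero

lemma algebraMap_eq_bev (F : MvPolynomial (Fin 2) ℂ) :
    algebraMap (MvPolynomial (Fin 2) ℂ) FunField F = bev F coordX coordY := by
  have h := map_bev (IsScalarTower.toAlgHom ℂ (MvPolynomial (Fin 2) ℂ) FunField) F (X 0) (X 1)
  rw [bev_X_self] at h
  exact h

lemma transcendental_coordT : Transcendental ℂ coordT := by
  obtain ⟨j, h2⟩ := exists_embedding
  intro h
  have h3 := h.algHom j
  rw [h2, isAlgebraic_algebraMap_iff (algebraMap (RatFunc ℂ) (RatFunc (RatFunc ℂ))).injective] at h3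
  exact RatFunc.transcendental_X h3

lemma algEquiv_ext_of_coord {γ γ' : Bir} (hx : γ coordX = γ' coordX) (hy : γ coordY = γ' coordY) :
    γ = γ' := by
  have key : ∀ F : MvPolynomial (Fin 2) ℂ,
      γ (algebraMap (MvPolynomial (Fin 2) ℂ) FunField F) = γ' (algebraMap _ _ F) := fun F => by
    rw [algebraMap_eq_bev]
    exact (map_bev (γ : FunField →ₐ[ℂ] FunField) F coordX coordY).trans
      ((congrArg₂ (bev F) hx hy).trans (map_bev (γ' : FunField →ₐ[ℂ] FunField) F _ _).symm)
  ext u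
  obtain ⟨a, b, -, rfl⟩ := IsFractionRing.div_surjective (A := MvPolynomial (Fin 2) ℂ) u
  rw [map_div₀, map_div₀, key, key]

namespace HomogeneousFoliation

variable {d : ℕ} {H : HomogeneousFoliation d}

lemma gaussP_eq : H.gaussP = -(bev H.A 1 coordT / bev H.B 1 coordT) := by
  have key : ∀ {F : MvPolynomial (Fin 2) ℂ}, F.IsHomogeneous d →
      algebraMap (MvPolynomial (Fin 2) ℂ) FunField F = coordX ^ d * bev F 1 coordT := fun hF => by
    rw [algebraMap_eq_bev, ← bev_smul hF, mul_one, mul_comm, coordT_mul_coordX]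
  rw [gaussP, key H.homogeneous_A, key H.homogeneous_B,
    mul_div_mul_left _ _ (pow_ne_zero _ coordX_ne_zero)]

lemma X_mul_A_add_ne_zero (hd : 2 ≤ d) : X 0 * H.A + X 1 * H.B ≠ 0 := by
  intro h
  have hdvd : (X 0 : MvPolynomial (Fin 2) ℂ) ∣ X 1 * H.B :=
    ⟨-H.A, by linear_combination h⟩
  obtain ⟨Q, hQ⟩ := ((X_prime (R := ℂ) (i := (0 : Fin 2))).dvd_or_dvd hdvd).resolve_left
    fun h01 => by simpa using (X_dvd_X (R := ℂ) (i := (0 : Fin 2)) (j := 1)).1 h01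
  have hA : H.A = Q * (-X 1) := by
    refine mul_left_cancel₀ (X_ne_zero (R := ℂ) (0 : Fin 2)) ?_
    linear_combination h - X 1 * hQ
  have hu : IsUnit Q := H.gcd_eq_one (hA ▸ dvd_mul_right _ _) (hQ ▸ dvd_mul_left _ _)
  -- `B` is divisible by `x` exactly once, although it is a multiple of `x ^ d` along `y = 0`
  have hpoly : IsUnit (bev Q (Polynomial.X : Polynomial ℂ) 0) :=
    hu.map (aeval ![Polynomial.X, 0] : MvPolynomial (Fin 2) ℂ →ₐ[ℂ] Polynomial ℂ)
  have h1 := bev_smul H.homogeneous_B (Polynomial.X : Polynomial ℂ) 1 0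
  rw [mul_one, mul_zero] at h1
  have h2 : bev H.B (Polynomial.X : Polynomial ℂ) 0 = Polynomial.X * bev Q Polynomial.X 0 := by
    rw [hQ, bev_mul, bev_X_zero]
  have h3 : (Polynomial.X : Polynomial ℂ) * Polynomial.X ∣ Polynomial.X * bev Q Polynomial.X 0 := by
    rw [← h2, h1, ← sq]
    exact (pow_dvd_pow _ hd).mul_right _
  have h4 := (mul_dvd_mul_iff_left Polynomial.X_ne_zero).1 h3
  exact Polynomial.not_isUnit_X (isUnit_of_dvd_unit h4 hpoly)

lemma gaussP_ne_coordT (hd : 2 ≤ d) : H.gaussP ≠ coordT := by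
  intro h
  have hB := bev_one_ne_zero transcendental_coordT H.homogeneous_B (H.B_ne_zero (by omega))
  have hhom : (X 0 * H.A + X 1 * H.B).IsHomogeneous (1 + d) :=
    ((isHomogeneous_X ℂ 0).mul H.homogeneous_A).add ((isHomogeneous_X ℂ 1).mul H.homogeneous_B)
  refine bev_one_ne_zero transcendental_coordT hhom (X_mul_A_add_ne_zero hd) ?_
  rw [gaussP_eq, neg_eq_iff_eq_neg, div_eq_iff hB] at h
  simp only [bev_add, bev_mul, bev_X_zero, bev_X_one, h]
  ring

/-- An element of `ℂ(t)(s)` on which the Gauss map takes the same value as on `t` is algebraic over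
`ℂ(t)`, hence lies in `ℂ(t)`. -/
lemma exists_eq_algebraMap (hd : d ≠ 0) {r : RatFunc (RatFunc ℂ)}
    (h : bev H.A 1 r * algebraMap (RatFunc ℂ) _ (bev H.B 1 RatFunc.X) =
      algebraMap (RatFunc ℂ) _ (bev H.A 1 RatFunc.X) * bev H.B 1 r) :
    ∃ c : RatFunc ℂ, r = algebraMap (RatFunc ℂ) _ c := by
  by_contra hr
  have htr := RatFunc.transcendental_of_ne_C r fun ⟨c, hc⟩ =>
    hr ⟨c, by rw [hc, RatFunc.algebraMap_eq_C]⟩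
  set a := bev H.A 1 (RatFunc.X : RatFunc ℂ)
  set b := bev H.B 1 (RatFunc.X : RatFunc ℂ) with hb
  have hb0 : b ≠ 0 := bev_one_ne_zero RatFunc.transcendental_X H.homogeneous_B (H.B_ne_zero hd)
  let P : Polynomial (RatFunc ℂ) :=
    bev H.A 1 Polynomial.X * Polynomial.C b - Polynomial.C a * bev H.B 1 Polynomial.X
  have hP : Polynomial.aeval r P = 0 := by
    have key : ∀ F : MvPolynomial (Fin 2) ℂ,
        Polynomial.aeval r (bev F 1 (Polynomial.X : Polynomial (RatFunc ℂ))) = bev F 1 r :=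
      fun F => by
        have := map_bev ((Polynomial.aeval r : Polynomial (RatFunc ℂ) →ₐ[RatFunc ℂ] _).restrictScalars
          ℂ) F 1 Polynomial.X
        rw [map_one, AlgHom.restrictScalars_apply, AlgHom.restrictScalars_apply,
          Polynomial.aeval_X] at this
        exact this
    simp only [P, map_sub, map_mul, key, Polynomial.aeval_C]
    rw [h, sub_self]
  have hP0 : P = 0 := by
    by_contra hne
    exact htr ⟨P, hne, hP⟩
  -- the form `b A - a B` vanishes at all constants, so that the Gauss map is constant
  have hval : ∀ s : ℂ, algebraMap ℂ (RatFunc ℂ) (bev H.A 1 s) * b =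
      a * algebraMap ℂ (RatFunc ℂ) (bev H.B 1 s) := fun s => by
    have key : ∀ F : MvPolynomial (Fin 2) ℂ,
        Polynomial.aeval (algebraMap ℂ (RatFunc ℂ) s)
          (bev F 1 (Polynomial.X : Polynomial (RatFunc ℂ))) =
        algebraMap ℂ (RatFunc ℂ) (bev F 1 s) := fun F => by
      have h1 := map_bev ((Polynomial.aeval (algebraMap ℂ (RatFunc ℂ) s) :
        Polynomial (RatFunc ℂ) →ₐ[RatFunc ℂ] _).restrictScalars ℂ) F 1 Polynomial.X
      rw [map_one, AlgHom.restrictScalars_apply, AlgHom.restrictScalars_apply,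
        Polynomial.aeval_X] at h1
      have h2 := map_bev (Algebra.ofId ℂ (RatFunc ℂ)) F 1 s
      rw [map_one] at h2
      exact h1.trans h2.symm
    have h1 := congrArg (Polynomial.aeval (algebraMap ℂ (RatFunc ℂ) s)) hP0
    simp only [P, map_sub, map_mul, key, Polynomial.aeval_C, map_zero,
      Algebra.algebraMap_self, RingHom.id_apply] at h1
    exact sub_eq_zero.1 h1
  obtain ⟨s, hs⟩ := exists_bev_one_ne_zero H.homogeneous_B (H.B_ne_zero hd)
  refine gaussLine_ne_C (H := H) hd ⟨-(bev H.A 1 s / bev H.B 1 s), ?_⟩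
  have hs' : algebraMap ℂ (RatFunc ℂ) (bev H.B 1 s) ≠ 0 := (map_ne_zero _).2 hs
  rw [gaussLine_eq, ← RatFunc.algebraMap_eq_C, map_neg, map_div₀, neg_inj, div_eq_div_iff hb0 hs']
  exact (hval s).symm

/-- A solution in `ℂ(t)` of `f(c) = f(t)`, where `f` is the Gauss map, is the image of `t` by an
element of the Galois group. -/
lemma exists_galois_apply_eq (hd : d ≠ 0) {c : RatFunc ℂ} (hc : Transcendental ℂ c)
    (h : bev H.A 1 c * bev H.B 1 RatFunc.X = bev H.A 1 RatFunc.X * bev H.B 1 c) :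
    ∃ σ : H.galoisGroup, σ RatFunc.X = c := by
  have hinj : Function.Injective (Polynomial.aeval c : Polynomial ℂ →ₐ[ℂ] RatFunc ℂ) :=
    transcendental_iff_injective.1 hc
  let φ : RatFunc ℂ →ₐ[ℂ] RatFunc ℂ := IsFractionRing.liftAlgHom hinj
  have hX : φ RatFunc.X = c := by
    rw [← RatFunc.algebraMap_X, IsFractionRing.liftAlgHom_apply, IsFractionRing.lift_algebraMap]
    exact Polynomial.aeval_X c
  have hf : φ H.gaussLine = H.gaussLine := by
    have hB := bev_one_ne_zero RatFunc.transcendental_X H.homogeneous_B (H.B_ne_zero hd)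
    have hBc := bev_one_ne_zero hc H.homogeneous_B (H.B_ne_zero hd)
    rw [gaussLine_eq, map_neg, map_div₀, map_bev, map_bev, map_one, hX, neg_inj,
      div_eq_div_iff hBc hB]
    exact h
  have hfix : ∀ u ∈ IntermediateField.adjoin ℂ {H.gaussLine}, φ u = u := fun u hu => by
    induction hu using IntermediateField.adjoin_induction with
    | mem x hx => rw [Set.mem_singleton_iff.1 hx, hf]
    | algebraMap x => exact φ.commutes x
    | add x y _ _ hx hy => rw [map_add, hx, hy]
    | inv x _ hx => rw [map_inv₀, hx]
    | mul x y _ _ hx hy => rw [map_mul, hx, hy]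
  let ψ : RatFunc ℂ →ₐ[IntermediateField.adjoin ℂ {H.gaussLine}] RatFunc ℂ :=
    { (φ : RatFunc ℂ →+* RatFunc ℂ) with commutes' := fun u => hfix u u.2 }
  have halg : Algebra.IsAlgebraic (IntermediateField.adjoin ℂ {H.gaussLine}) (RatFunc ℂ) :=
    RatFunc.isAlgebraic_adjoin_simple_X' _ (gaussLine_ne_C hd)
  exact ⟨AlgEquiv.ofBijective ψ (Algebra.IsAlgebraic.algHom_bijective ψ), hX⟩

/-- For a Galois foliation of degree `d`, the Galois group of the Gauss map has at least `d`
elements: a birational transformation which preserves the Gauss map preserves the subfield `ℂ(t)`,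
and is determined by its restriction to it. -/
lemma IsGaloisFoliation.le_card (hd : 2 ≤ d) (h : H.IsGaloisFoliation) :
    d ≤ Nat.card H.galoisGroup := by
  have hd0 : d ≠ 0 := by omega
  have := finite_galoisGroup (H := H) hd0
  obtain ⟨G, hG, hfix⟩ := h
  obtain ⟨j, hjt⟩ := exists_embedding
  have hjinj : Function.Injective j := j.toRingHom.injective
  have hex : ∀ γ : G, ∃ σ : H.galoisGroup,
      j ((γ : Bir) coordT) = algebraMap (RatFunc ℂ) _ (σ RatFunc.X) := by
    intro γ
    have hP := (hfix γ γ.2).1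
    set r := (γ : Bir) coordT with hr
    have hrt : Transcendental ℂ r := fun halg => transcendental_coordT
      ((isAlgebraic_algHom_iff ((γ : Bir) : FunField →ₐ[ℂ] FunField) (γ : Bir).injective).1 halg)
    have hγ : ∀ F : MvPolynomial (Fin 2) ℂ, (γ : Bir) (bev F 1 coordT) = bev F 1 r := fun F => by
      have := map_bev ((γ : Bir) : FunField →ₐ[ℂ] FunField) F 1 coordT
      rw [map_one] at this
      exact this
    have hB := bev_one_ne_zero transcendental_coordT H.homogeneous_B (H.B_ne_zero hd0)
    have hBr := bev_one_ne_zero hrt H.homogeneous_B (H.B_ne_zero hd0)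
    rw [gaussP_eq, map_neg, map_div₀, hγ, hγ, neg_inj, div_eq_div_iff hBr hB] at hP
    have hj : ∀ F : MvPolynomial (Fin 2) ℂ,
        j (bev F 1 coordT) = algebraMap (RatFunc ℂ) _ (bev F 1 RatFunc.X) := fun F => by
      have := map_bev (IsScalarTower.toAlgHom ℂ (RatFunc ℂ) (RatFunc (RatFunc ℂ))) F 1 RatFunc.X
      rw [map_one] at this
      rw [map_bev, map_one, hjt]
      exact this.symm
    have hP2 := congrArg j hP
    rw [map_mul, map_mul, hj, hj, map_bev, map_bev, map_one] at hP2
    obtain ⟨c, hc⟩ := exists_eq_algebraMap hd0 hP2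
    have hct : Transcendental ℂ c := fun halg => hrt <| by
      rw [← isAlgebraic_algHom_iff j hjinj, hc]
      exact halg.algebraMap
    have hrel : bev H.A 1 c * bev H.B 1 RatFunc.X = bev H.A 1 RatFunc.X * bev H.B 1 c := by
      have e : ∀ F : MvPolynomial (Fin 2) ℂ, bev F 1 (j r) =
          algebraMap (RatFunc ℂ) _ (bev F 1 c) := fun F => by
        have := map_bev (IsScalarTower.toAlgHom ℂ (RatFunc ℂ) (RatFunc (RatFunc ℂ))) F 1 c
        rw [map_one] at this
        rw [hc]
        exact this.symm
      rw [e, e, ← map_mul, ← map_mul] at hP2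
      exact (algebraMap (RatFunc ℂ) (RatFunc (RatFunc ℂ))).injective hP2
    obtain ⟨σ, hσ⟩ := exists_galois_apply_eq hd0 hct hrel
    exact ⟨σ, by rw [hc, hσ]⟩
  choose σ hσ using hex
  have hinj : Function.Injective σ := fun γ γ' hγ => by
    have hT : (γ : Bir) coordT = (γ' : Bir) coordT := hjinj (by rw [hσ, hσ, hγ])
    have hQ : ∀ γ : G, H.gaussQ = (γ : Bir) coordX * (H.gaussP - (γ : Bir) coordT) := fun γ => by
      have h1 : H.gaussQ = coordX * (H.gaussP - coordT) := by
        rw [mul_sub, mul_comm coordX coordT, coordT_mul_coordX, mul_comm]; rfl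
      conv_lhs => rw [← (hfix γ γ.2).2, h1, map_mul, map_sub, (hfix γ γ.2).1]
    have hne : H.gaussP - (γ : Bir) coordT ≠ 0 := by
      rw [← (hfix γ γ.2).1, ← map_sub, map_ne_zero]
      exact sub_ne_zero.2 (gaussP_ne_coordT hd)
    have hx : (γ : Bir) coordX = (γ' : Bir) coordX := by
      refine mul_right_cancel₀ hne ?_
      rw [← hQ γ, hT, ← hQ γ']
    refine Subtype.ext (algEquiv_ext_of_coord hx ?_)
    rw [← coordT_mul_coordX, map_mul, map_mul, hx, hT]
  refine hG.symm.le.trans ?_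
  exact Nat.card_le_card_of_injective σ hinj

end HomogeneousFoliation

/-! ### Foliations defined by `ℓ₁ᵈ ν₁ + ℓ₂ᵈ ν₂` -/

/-- Lagrange interpolation reproduces a quadratic form from its values at three points. -/
lemma interp_quadratic {d : ℕ} {f : ℂ × ℂ → ℂ} (hf : IsQuadratic f) {p : ℂ} {m : Fin d → ℂ}
    {r s t : Fin d} (hrs : m r ≠ m s) (hrt : m r ≠ m t) (hst : m s ≠ m t) :
    interp (fun i => linePoint p (m i)) (fun i => f (linePoint p (m i))) (1, p) r s t =
      f (1, p) := by
  obtain ⟨a, b, c, h⟩ := hf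
  have h1 := sub_ne_zero.2 hrs
  have h2 := sub_ne_zero.2 hrt
  have h3 := sub_ne_zero.2 hst
  have e1 : m s - m r = -(m r - m s) := by ring
  have e2 : m t - m r = -(m r - m t) := by ring
  have e3 : m t - m s = -(m s - m t) := by ring
  simp only [interp, bracket_linePoint, bracket_one_linePoint, e1, e2, e3, h]
  simp only [linePoint]
  field_simp
  ring

lemma totalB_eq_of_quadratic {d : ℕ} {p : ℂ} {m : Fin d → ℂ → ℂ}
    (hm : Function.Injective fun i => m i p) {f : ℂ × ℂ → ℂ} (hf : IsQuadratic f)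
    (hD : ∀ i, deriv (m i) p + m i p ^ 2 = f (linePoint p (m i p))) :
    totalB m p = sumTriples (fun _ _ _ : Fin d => (1 : ℂ)) * (1 - f (1, p)) := by
  have h : sumInterp (fun i => linePoint p (m i p)) (fun i => deriv (m i) p + m i p ^ 2) (1, p) =
      f (1, p) * sumTriples (fun _ _ _ : Fin d => (1 : ℂ)) := by
    rw [mul_sumTriples, sumInterp]
    simp only [hD]
    refine sumTriples_congr fun r s t hrs hst => ?_
    rw [interp_quadratic hf (m := fun i => m i p) (hm.ne hrs.ne) (hm.ne (hrs.trans hst).ne)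
      (hm.ne hst.ne), mul_one]
  rw [totalB_eq hm, h]
  ring

lemma sumTriples_one_ne_zero {d : ℕ} (hd : 3 ≤ d) :
    sumTriples (fun _ _ _ : Fin d => (1 : ℂ)) ≠ 0 := by
  have h : sumTriples (fun _ _ _ : Fin d => (1 : ℂ)) =
      ((∑ r : Fin d, ∑ s : Fin d, ∑ t : Fin d, if r < s ∧ s < t then 1 else 0 : ℕ) : ℂ) := by
    simp only [sumTriples]
    push_cast
    rfl
  rw [h, Nat.cast_ne_zero]
  intro h0
  have h1 := (Finset.sum_eq_zero_iff.1 h0) ⟨0, by omega⟩ (Finset.mem_univ _)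
  have h2 := (Finset.sum_eq_zero_iff.1 h1) ⟨1, by omega⟩ (Finset.mem_univ _)
  have h3 := (Finset.sum_eq_zero_iff.1 h2) ⟨2, by omega⟩ (Finset.mem_univ _)
  simp at h3

namespace HomogeneousFoliation

variable {d : ℕ} {H : HomogeneousFoliation d}

/-- The foliation `H` is defined by the form `ℓᵈ ν + ℓ'ᵈ ν'`, where `ℓ, ℓ'` are independent linear
forms and `ν, ν'` are independent constant `1`-forms. -/
def IsDiagonal (H : HomogeneousFoliation d) (l l' n n' : ℂ × ℂ) : Prop :=
  bracket l l' ≠ 0 ∧ bracket n n' ≠ 0 ∧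
    ∀ v : ℂ × ℂ, bev H.A v.1 v.2 = n.1 * linAp l v ^ d + n'.1 * linAp l' v ^ d ∧
      bev H.B v.1 v.2 = n.2 * linAp l v ^ d + n'.2 * linAp l' v ^ d

section

variable {l l' n n' : ℂ × ℂ}

lemma IsDiagonal.bev_fiberForm (h : H.IsDiagonal l l' n n') (p : ℂ) (v : ℂ × ℂ) :
    bev (H.fiberForm p) v.1 v.2 =
      linAp n (1, p) * linAp l v ^ d + linAp n' (1, p) * linAp l' v ^ d := by
  rw [HomogeneousFoliation.bev_fiberForm, (h.2.2 v).1, (h.2.2 v).2]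
  simp only [linAp]
  ring

lemma eq_zero_of_linAp {l l' : ℂ × ℂ} (hl : bracket l l' ≠ 0) {v : ℂ × ℂ} (h : linAp l v = 0)
    (h' : linAp l' v = 0) : v = 0 := by
  simp only [linAp, bracket] at *
  ext
  · refine (mul_eq_zero.1 (?_ : _ * v.1 = 0)).resolve_left hl
    linear_combination l'.2 * h - l.2 * h'
  · refine (mul_eq_zero.1 (?_ : _ * v.2 = 0)).resolve_left hl
    linear_combination l.1 * h' - l'.1 * h

lemma bracket_mul_eq (l l' v w : ℂ × ℂ) :
    bracket l l' * bracket v w = linAp l v * linAp l' w - linAp l' v * linAp l w := by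
  simp only [bracket, linAp]; ring

lemma IsDiagonal.symm (h : H.IsDiagonal l l' n n') : H.IsDiagonal l' l n' n := by
  refine ⟨fun h0 => h.1 ?_, fun h0 => h.2.1 ?_, fun v => ?_⟩
  · simp only [bracket] at h0 ⊢; linear_combination -h0
  · simp only [bracket] at h0 ⊢; linear_combination -h0
  · rw [(h.2.2 v).1, (h.2.2 v).2]
    exact ⟨add_comm _ _, add_comm _ _⟩

lemma IsDiagonal.linAp_ne_zero (hd : 2 ≤ d) (h : H.IsDiagonal l l' n n') {p : ℂ} {m : Fin d → ℂ}
    (hm : H.IsRootSystem p m) : linAp n (1, p) ≠ 0 ∧ ∀ i, linAp l (linePoint p (m i)) ≠ 0 := by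
  have hroot : ∀ i, linAp n (1, p) * linAp l (linePoint p (m i)) ^ d +
      linAp n' (1, p) * linAp l' (linePoint p (m i)) ^ d = 0 := fun i => by
    rw [← h.bev_fiberForm]; exact hm.2 i
  have hn : linAp n (1, p) ≠ 0 := by
    intro h0
    have hn' : linAp n' (1, p) ≠ 0 := fun h1 => by
      have := eq_zero_of_linAp h.2.1 h0 h1
      simp at this
    have hz : ∀ i, linAp l' (linePoint p (m i)) = 0 := fun i => by
      have := hroot i
      rw [h0, zero_mul, zero_add] at this
      exact eq_zero_of_pow_eq_zero ((mul_eq_zero.1 this).resolve_left hn')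
    -- all the roots would be proportional
    have hij := bracket_mul_eq l l' (linePoint p (m ⟨0, by omega⟩)) (linePoint p (m ⟨1, by omega⟩))
    rw [hz, hz, mul_zero, zero_mul, sub_zero, bracket_linePoint] at hij
    have := hm.1 (sub_eq_zero.1 ((mul_eq_zero.1 hij).resolve_left h.1))
    simp at this
  refine ⟨hn, fun i h0 => ?_⟩
  have hn' : linAp n' (1, p) ≠ 0 := by
    intro h1
    have hz : ∀ i, linAp l (linePoint p (m i)) = 0 := fun i => by
      have := hroot i
      rw [h1, zero_mul, add_zero] at this
      exact eq_zero_of_pow_eq_zero ((mul_eq_zero.1 this).resolve_left hn)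
    have hij := bracket_mul_eq l l' (linePoint p (m ⟨0, by omega⟩)) (linePoint p (m ⟨1, by omega⟩))
    rw [hz, hz, mul_zero, zero_mul, sub_zero, bracket_linePoint] at hij
    have := hm.1 (sub_eq_zero.1 ((mul_eq_zero.1 hij).resolve_left h.1))
    simp at this
  have h1 := hroot i
  rw [h0, zero_pow (by omega), mul_zero, zero_add] at h1
  have h2 := eq_zero_of_pow_eq_zero ((mul_eq_zero.1 h1).resolve_left hn')
  exact linePoint_ne_zero p (m i) (eq_zero_of_linAp h.1 h0 h2)

/-- For a foliation `ℓᵈ ν + ℓ'ᵈ ν'`, the Wronskians `mᵢ' + mᵢ²` of the branches are the values of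
a multiple of the quadratic form `ℓ ℓ'`. -/
lemma IsDiagonal.deriv_add_sq (hd : 2 ≤ d) (h : H.IsDiagonal l l' n n') {p : ℂ}
    {m : Fin d → ℂ → ℂ} (han : ∀ i, AnalyticAt ℂ (m i) p)
    (hm : ∀ᶠ x in 𝓝 p, H.IsRootSystem x fun i => m i x) (i : Fin d) :
    deriv (m i) p + m i p ^ 2 =
      -bracket n n' / (d * bracket l l' * (linAp n (1, p) * linAp n' (1, p))) *
        (linAp l (linePoint p (m i p)) * linAp l' (linePoint p (m i p))) := by
  obtain ⟨hn, hu⟩ := h.linAp_ne_zero hd hm.self_of_nhds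
  obtain ⟨hn', hu'⟩ := h.symm.linAp_ne_zero hd hm.self_of_nhds
  have hu := hu i
  have hu' := hu' i
  have hd0 : (d : ℂ) ≠ 0 := Nat.cast_ne_zero.2 (by omega)
  have hi := (han i).differentiableAt.hasDerivAt
  have hlin : ∀ k : ℂ × ℂ, HasDerivAt (fun x => linAp k (linePoint x (m i x)))
      (linAp k (deriv (m i) p, m i p + p * deriv (m i) p)) p := fun k => by
    have h1 := (hi.const_mul k.1).add ((((hasDerivAt_id p).mul hi).sub_const 1).const_mul k.2)
    exact h1.congr_deriv (by simp [linAp])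
  have hnd : ∀ k : ℂ × ℂ, HasDerivAt (fun x : ℂ => linAp k (1, x)) k.2 p := fun k => by
    have h1 := ((hasDerivAt_id p).const_mul k.2).const_add (k.1 * 1)
    exact h1.congr_deriv (by simp)
  have hder := ((hnd n).mul ((hlin l).pow d)).add ((hnd n').mul ((hlin l').pow d))
  have hzero : (fun x => linAp n (1, x) * linAp l (linePoint x (m i x)) ^ d +
      linAp n' (1, x) * linAp l' (linePoint x (m i x)) ^ d) =ᶠ[𝓝 p] fun _ => 0 := by
    filter_upwards [hm] with x hx
    rw [← h.bev_fiberForm]; exact hx.2 i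
  have h0 := hder.unique ((hasDerivAt_const p (0 : ℂ)).congr_of_eventuallyEq hzero)
  have hT := hzero.self_of_nhds
  have hW := bracket_mul_eq l l' (linePoint p (m i p)) (deriv (m i) p, m i p + p * deriv (m i) p)
  have hW2 : bracket (linePoint p (m i p)) (deriv (m i) p, m i p + p * deriv (m i) p) =
      deriv (m i) p + m i p ^ 2 := by
    simp only [bracket, linePoint]; ring
  rw [hW2] at hW
  have hnn : n.2 * linAp n' (1, p) - n'.2 * linAp n (1, p) = -bracket n n' := by
    simp only [linAp, bracket]; ring
  obtain ⟨e, rfl⟩ : ∃ e, d = e + 1 := ⟨d - 1, by omega⟩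
  simp only [Pi.pow_apply, Nat.add_sub_cancel, pow_succ] at h0 hT
  generalize linAp l (linePoint p (m i p)) = u at *
  generalize linAp l' (linePoint p (m i p)) = u' at *
  generalize linAp l (deriv (m i) p, m i p + p * deriv (m i) p) = w at *
  generalize linAp l' (deriv (m i) p, m i p + p * deriv (m i) p) = w' at *
  generalize linAp n (1, p) = ν at *
  generalize linAp n' (1, p) = ν' at *
  generalize deriv (m i) p + m i p ^ 2 = D at *
  rw [div_mul_eq_mul_div, eq_div_iff (mul_ne_zero (mul_ne_zero hd0 h.1) (mul_ne_zero hn hn')),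
    ← hnn]
  have hue : u ^ e ≠ 0 := pow_ne_zero _ hu
  refine mul_left_cancel₀ (mul_ne_zero hue hu) ?_
  generalize ((e + 1 : ℕ) : ℂ) = δ at *
  generalize u ^ e = a at *
  generalize u' ^ e = a' at *
  linear_combination (a * u * δ * ν * ν') * hW - ν' * u * u' * h0 +
    (n'.2 * u * u' + ν' * δ * w' * u) * hT

lemma IsDiagonal.totalB_eq (hd : 2 ≤ d) (h : H.IsDiagonal l l' n n') {p : ℂ}
    {m : Fin d → ℂ → ℂ} (han : ∀ i, AnalyticAt ℂ (m i) p)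
    (hm : ∀ᶠ x in 𝓝 p, H.IsRootSystem x fun i => m i x) :
    totalB m p = sumTriples (fun _ _ _ : Fin d => (1 : ℂ)) *
      (1 + bracket n n' / (d * bracket l l') *
        (linAp l (1, p) * linAp l' (1, p) / (linAp n (1, p) * linAp n' (1, p)))) := by
  have hquad : ∀ k : ℂ, IsQuadratic fun v => k * (linAp l v * linAp l' v) := fun k =>
    ⟨k * (l.1 * l'.1), k * (l.1 * l'.2 + l.2 * l'.1), k * (l.2 * l'.2), fun v => by
      simp only [linAp]; ring⟩
  rw [totalB_eq_of_quadratic hm.self_of_nhds.1 (hquad _) (h.deriv_add_sq hd han hm)]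
  ring

/-- If `ν ν'` is proportional to `ℓ ℓ'`, then the Legendre transform is flat. -/
lemma IsDiagonal.legIsFlat (hd : 2 ≤ d) (h : H.IsDiagonal l l' n n') {g : ℂ}
    (hg : ∀ p, linAp l (1, p) * linAp l' (1, p) = g * (linAp n (1, p) * linAp n' (1, p))) :
    H.LegIsFlat := by
  refine H.legIsFlat_of_deriv_totalB hd fun m p han hm => ?_
  have hconst : totalB m =ᶠ[𝓝 p] fun _ => sumTriples (fun _ _ _ : Fin d => (1 : ℂ)) *
      (1 + bracket n n' / (d * bracket l l') * g) := by
    filter_upwards [hm.eventually_nhds, eventually_all.2 fun i => (han i).eventually_analyticAt]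
      with x hx hax
    have hn := (h.linAp_ne_zero hd hx.self_of_nhds).1
    have hn' := (h.symm.linAp_ne_zero hd hx.self_of_nhds).1
    rw [h.totalB_eq hd hax hx, hg, mul_div_assoc, div_self (mul_ne_zero hn hn'), mul_one]
  rw [hconst.deriv_eq, deriv_const]

/-- The linear form as a polynomial. -/
noncomputable def linPoly (l : ℂ × ℂ) : MvPolynomial (Fin 2) ℂ := C l.1 * X 0 + C l.2 * X 1

@[simp] lemma bev_linPoly (l : ℂ × ℂ) (x y : ℂ) : bev (linPoly l) x y = linAp l (x, y) := by
  simp [linPoly, linAp]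

lemma isHomogeneous_linPoly (l : ℂ × ℂ) : (linPoly l).IsHomogeneous 1 :=
  (isHomogeneous_C_mul_X _ _).add (isHomogeneous_C_mul_X _ _)

lemma linPoly_ne_zero {l : ℂ × ℂ} (hl : l ≠ 0) : linPoly l ≠ 0 := fun h => hl <| by
  have h1 := congrArg (fun F => bev F (1 : ℂ) 0) h
  have h2 := congrArg (fun F => bev F (0 : ℂ) 1) h
  simp [linAp] at h1 h2
  exact Prod.ext h1 h2

/-- Local branches of the inverse of the Gauss map of a foliation `ℓᵈ ν + ℓ'ᵈ ν'`: the solutions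
of `ℓ' = ξ τ ℓ`, where `ξ` runs over the `d`-th roots of unity and `τᵈ = -ν/ν'`. -/
lemma IsDiagonal.exists_branch (hd : 2 ≤ d) (h : H.IsDiagonal l l' n n') {p₀ : ℂ}
    (hn : linAp n (1, p₀) ≠ 0) (hn' : linAp n' (1, p₀) ≠ 0)
    (hinf : bev (H.fiberForm p₀) 1 p₀ ≠ 0) :
    ∃ (U : Set ℂ) (m : Fin d → ℂ → ℂ), IsOpen U ∧ p₀ ∈ U ∧ (∀ i, DifferentiableOn ℂ (m i) U) ∧
      ∀ p ∈ U, H.IsRootSystem p fun i => m i p := by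
  have hd0 : d ≠ 0 := by omega
  have hdC : (d : ℂ) ≠ 0 := Nat.cast_ne_zero.2 hd0
  have hlc : ∀ k : ℂ × ℂ, Differentiable ℂ fun p : ℂ => linAp k (1, p) := fun k => by
    simp only [linAp]; fun_prop
  let ρ : ℂ → ℂ := fun p => -linAp n (1, p) / linAp n' (1, p)
  have hρ0 : ρ p₀ ≠ 0 := div_ne_zero (neg_ne_zero.2 hn) hn'
  obtain ⟨τ₀, hτ₀⟩ := IsAlgClosed.exists_pow_nat_eq (ρ p₀) (Nat.pos_of_ne_zero hd0)
  let τ : ℂ → ℂ := fun p => τ₀ * Complex.exp (Complex.log (ρ p / ρ p₀) / d)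
  let ξ : Fin d → ℂ := fun i => Complex.exp (2 * Real.pi * Complex.I / d) ^ (i : ℕ)
  have hprim := Complex.isPrimitiveRoot_exp d hd0
  have hξ : ∀ i, ξ i ^ d = 1 := fun i => by
    simp only [ξ]
    rw [← pow_mul, mul_comm (i : ℕ) d, pow_mul, hprim.pow_eq_one, one_pow]
  have hξinj : Function.Injective ξ := fun i j hij => Fin.ext (hprim.pow_inj i.2 j.2 hij)
  have hfib : ∀ p, bev (H.fiberForm p) 1 p =
      linAp n (1, p) * linAp l (1, p) ^ d + linAp n' (1, p) * linAp l' (1, p) ^ d :=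
    fun p => h.bev_fiberForm p (1, p)
  have hcont : ContinuousAt ρ p₀ :=
    ((hlc n).continuous.neg.continuousAt).div (hlc n').continuous.continuousAt hn'
  have hev : ∀ᶠ p in 𝓝 p₀, linAp n (1, p) ≠ 0 ∧ linAp n' (1, p) ≠ 0 ∧
      bev (H.fiberForm p) 1 p ≠ 0 ∧ ρ p / ρ p₀ ∈ Complex.slitPlane := by
    refine ((hlc n).continuous.continuousAt.eventually_ne hn).and
      (((hlc n').continuous.continuousAt.eventually_ne hn').and (Eventually.and ?_ ?_))
    · simp only [hfib] at hinf ⊢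
      have := (hlc n).continuous
      have := (hlc n').continuous
      have := (hlc l).continuous
      have := (hlc l').continuous
      refine ContinuousAt.eventually_ne ?_ hinf
      fun_prop
    · refine (hcont.div_const (ρ p₀)).eventually (Complex.isOpen_slitPlane.mem_nhds ?_)
      change ρ p₀ / ρ p₀ ∈ Complex.slitPlane
      rw [div_self hρ0]
      exact Complex.one_mem_slitPlane
  obtain ⟨U, hU, hUo, hpU⟩ := eventually_nhds_iff.1 hev
  have hτpow : ∀ p ∈ U, τ p ^ d = ρ p := fun p hp => by
    have hρp : ρ p / ρ p₀ ≠ 0 := Complex.slitPlane_ne_zero (hU p hp).2.2.2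
    simp only [τ]
    rw [mul_pow, hτ₀, ← Complex.exp_nat_mul, mul_div_cancel₀ _ hdC, Complex.exp_log hρp,
      mul_div_cancel₀ _ hρ0]
  have hρrel : ∀ p ∈ U, ∀ i, linAp n (1, p) + linAp n' (1, p) * (ξ i * τ p) ^ d = 0 :=
    fun p hp i => by
      rw [mul_pow, hξ, one_mul, hτpow p hp]
      simp only [ρ]
      rw [mul_div_cancel₀ _ (hU p hp).2.1, add_neg_cancel]
  have hτ0 : ∀ p ∈ U, τ p ≠ 0 := fun p hp h0 => by
    have h1 := hτpow p hp
    rw [h0, zero_pow hd0] at h1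
    exact div_ne_zero (neg_ne_zero.2 (hU p hp).1) (hU p hp).2.1 h1.symm
  let den : Fin d → ℂ → ℂ := fun i p => linAp l' (1, p) - ξ i * τ p * linAp l (1, p)
  have hden : ∀ p ∈ U, ∀ i, den i p ≠ 0 := fun p hp i h0 => by
    refine (hU p hp).2.2.1 ?_
    rw [hfib, sub_eq_zero.1 h0, mul_pow]
    linear_combination linAp l (1, p) ^ d * hρrel p hp i
  let m : Fin d → ℂ → ℂ := fun i p => (l'.2 - ξ i * τ p * l.2) / den i p
  have hm : ∀ p ∈ U, ∀ i, linAp l' (linePoint p (m i p)) =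
      ξ i * τ p * linAp l (linePoint p (m i p)) := fun p hp i => by
    have h1 : m i p * den i p = l'.2 - ξ i * τ p * l.2 := div_mul_cancel₀ _ (hden p hp i)
    simp only [den, linAp, linePoint] at h1 ⊢
    linear_combination h1
  refine ⟨U, m, hUo, hpU, fun i => ?_, fun p hp => ⟨fun i j hij => ?_, fun i => ?_⟩⟩
  · intro p hp
    refine DifferentiableAt.differentiableWithinAt ?_
    have h1 : DifferentiableAt ℂ ρ p :=
      ((hlc n).neg.differentiableAt).div (hlc n').differentiableAt (hU p hp).2.1
    have h2 : DifferentiableAt ℂ τ p :=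
      ((((h1.div_const _).clog (hU p hp).2.2.2).div_const _).cexp).const_mul _
    exact ((differentiableAt_const _).sub ((h2.const_mul _).mul_const _)).div
      ((hlc l').differentiableAt.sub ((h2.const_mul _).mul (hlc l).differentiableAt)) (hden p hp i)
  · have hij' : m i p = m j p := hij
    have h1 := hm p hp i
    rw [hij', hm p hp j] at h1
    have hne : linAp l (linePoint p (m j p)) ≠ 0 := fun h0 =>
      linePoint_ne_zero p (m j p) (eq_zero_of_linAp h.1 h0 (by rw [hm p hp j, h0, mul_zero]))
    exact hξinj (mul_right_cancel₀ (hτ0 p hp) (mul_right_cancel₀ hne h1)).symm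
  · have h1 := h.bev_fiberForm p (linePoint p (m i p))
    rw [hm p hp i, mul_pow] at h1
    refine h1.trans ?_
    linear_combination linAp l (linePoint p (m i p)) ^ d * hρrel p hp i

/-- If the Legendre transform of `ℓᵈ ν + ℓ'ᵈ ν'` is flat, then `ν ν'` is proportional to `ℓ ℓ'`. -/
lemma IsDiagonal.exists_of_legIsFlat (hd : 3 ≤ d) (h : H.IsDiagonal l l' n n')
    (hflat : H.LegIsFlat) : ∃ g : ℂ, g ≠ 0 ∧
      ∀ p, linAp l (1, p) * linAp l' (1, p) = g * (linAp n (1, p) * linAp n' (1, p)) := by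
  have hd2 : 2 ≤ d := by omega
  have hhom : (X 0 * H.A + X 1 * H.B).IsHomogeneous (1 + d) :=
    ((isHomogeneous_X ℂ 0).mul H.homogeneous_A).add ((isHomogeneous_X ℂ 1).mul H.homogeneous_B)
  obtain ⟨p₀, hp₀⟩ := exists_bev_one_ne_zero
    (((((isHomogeneous_linPoly l).mul (isHomogeneous_linPoly l')).mul
      (isHomogeneous_linPoly n)).mul (isHomogeneous_linPoly n')).mul hhom)
    (mul_ne_zero (mul_ne_zero (mul_ne_zero (mul_ne_zero
      (linPoly_ne_zero (ne_zero_of_bracket h.1)) (linPoly_ne_zero (ne_zero_of_bracket h.symm.1)))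
      (linPoly_ne_zero (ne_zero_of_bracket h.2.1)))
      (linPoly_ne_zero (ne_zero_of_bracket h.symm.2.1))) (X_mul_A_add_ne_zero hd2))
  simp only [bev_mul, bev_add, bev_linPoly, bev_X_zero, bev_X_one, one_mul, mul_ne_zero_iff] at hp₀
  obtain ⟨⟨⟨⟨hl, hl'⟩, hn⟩, hn'⟩, hinf⟩ := hp₀
  obtain ⟨U, m, hU, hpU, hdiff, hroot⟩ := h.exists_branch hd2 hn hn'
    (by rw [HomogeneousFoliation.bev_fiberForm]; exact hinf)
  set N := sumTriples (fun _ _ _ : Fin d => (1 : ℂ)) with hN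
  set k := bracket n n' / (d * bracket l l') with hk
  have hk0 : k ≠ 0 :=
    div_ne_zero h.2.1 (mul_ne_zero (Nat.cast_ne_zero.2 (by omega)) h.1)
  have hN0 : N ≠ 0 := sumTriples_one_ne_zero hd
  let g : ℂ → ℂ := fun p => linAp l (1, p) * linAp l' (1, p) / (linAp n (1, p) * linAp n' (1, p))
  have htot : ∀ p ∈ U, totalB m p = N * (1 + k * g p) := fun p hp =>
    h.totalB_eq hd2 (fun i => (hdiff i).analyticAt (hU.mem_nhds hp))
      (by filter_upwards [hU.mem_nhds hp] with x hx using hroot x hx)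
  have hne : ∀ p ∈ U, linAp n (1, p) * linAp n' (1, p) ≠ 0 := fun p hp =>
    mul_ne_zero (h.linAp_ne_zero hd2 (hroot p hp)).1 (h.symm.linAp_ne_zero hd2 (hroot p hp)).1
  have hlc : ∀ k : ℂ × ℂ, Differentiable ℂ fun p : ℂ => linAp k (1, p) := fun k => by
    simp only [linAp]; fun_prop
  have hgd : ∀ p ∈ U, DifferentiableAt ℂ g p := fun p hp =>
    ((hlc l).mul (hlc l')).differentiableAt.div ((hlc n).mul (hlc n')).differentiableAt (hne p hp)
  have hg' : ∀ p ∈ U, deriv g p = 0 := fun p hp => by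
    have h1 := LegIsFlat.deriv_totalB hflat hU hdiff hroot hp
    have h2 : totalB m =ᶠ[𝓝 p] fun p => N * (1 + k * g p) := by
      filter_upwards [hU.mem_nhds hp] with x hx using htot x hx
    have h3 : HasDerivAt (fun p => N * (1 + k * g p)) (N * (k * deriv g p)) p :=
      (((hgd p hp).hasDerivAt.const_mul k).const_add 1).const_mul N
    rw [h2.deriv_eq, h3.deriv] at h1
    exact (mul_eq_zero.1 ((mul_eq_zero.1 h1).resolve_left hN0)).resolve_left hk0
  obtain ⟨ε, hε, hball⟩ := Metric.isOpen_iff.1 hU p₀ hpU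
  have hconst : ∀ p ∈ Metric.ball p₀ ε, g p = g p₀ := fun p hp =>
    Metric.isOpen_ball.is_const_of_deriv_eq_zero (convex_ball p₀ ε).isPreconnected
      (fun x hx => (hgd x (hball hx)).differentiableWithinAt) (fun x hx => hg' x (hball hx))
      hp (Metric.mem_ball_self hε)
  refine ⟨g p₀, div_ne_zero (mul_ne_zero hl hl') (mul_ne_zero hn hn'), ?_⟩
  let F : MvPolynomial (Fin 2) ℂ := linPoly l * linPoly l' - C (g p₀) * (linPoly n * linPoly n')
  have hFev : ∀ p : ℂ, (bev F 1 (Polynomial.X : Polynomial ℂ)).eval p =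
      linAp l (1, p) * linAp l' (1, p) - g p₀ * (linAp n (1, p) * linAp n' (1, p)) := fun p => by
    rw [eval_bev]
    simp [F]
  have hP : bev F 1 (Polynomial.X : Polynomial ℂ) = 0 := by
    refine Polynomial.eq_zero_of_infinite_isRoot _ ?_
    refine Set.Infinite.mono (s := Metric.ball p₀ ε) (fun p hp => ?_) ?_
    · change (bev F 1 (Polynomial.X : Polynomial ℂ)).eval p = 0
      rw [hFev, ← hconst p hp, div_mul_cancel₀ _ (hne p (hball hp)), sub_self]
    · exact infinite_of_mem_nhds p₀ (Metric.ball_mem_nhds p₀ hε)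
  intro p
  have := hFev p
  rw [hP, Polynomial.eval_zero] at this
  exact sub_eq_zero.1 this.symm

end

end HomogeneousFoliation

/-! ### Normal form of a cyclic foliation -/

/-- If `a / b` is invariant under `s ↦ ζ s`, where `ζᵏ ≠ 1` for `0 < k < d`, then `a` and `b` have
no coefficient of degree strictly between `0` and `d`. -/
lemma coeff_eq_zero_of_comp_eq {a b : Polynomial ℂ} (hab : IsCoprime a b) {ζ : ℂ} {d : ℕ}
    (hζ0 : ζ ≠ 0) (hζ : ∀ k, 0 < k → k < d → ζ ^ k ≠ 1)
    (h : a.comp (Polynomial.C ζ * Polynomial.X) * b = a * b.comp (Polynomial.C ζ * Polynomial.X))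
    {k : ℕ} (hk0 : 0 < k) (hkd : k < d) : a.coeff k = 0 ∧ b.coeff k = 0 := by
  obtain ⟨c, hca, hcb⟩ : ∃ c, a.comp (Polynomial.C ζ * Polynomial.X) = a * Polynomial.C c ∧
      b.comp (Polynomial.C ζ * Polynomial.X) = b * Polynomial.C c := by
    by_cases ha : a = 0
    · subst ha
      obtain ⟨r, -, rfl⟩ := Polynomial.isUnit_iff.1 (isCoprime_zero_left.1 hab)
      exact ⟨1, by simp, by simp⟩
    obtain ⟨q, hq⟩ : a ∣ a.comp (Polynomial.C ζ * Polynomial.X) :=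
      hab.dvd_of_dvd_mul_right ⟨_, h⟩
    have hne : a.comp (Polynomial.C ζ * Polynomial.X) ≠ 0 := by
      rwa [Ne, Polynomial.comp_C_mul_X_eq_zero_iff (mem_nonZeroDivisors_of_ne_zero hζ0)]
    have hq0 : q ≠ 0 := by
      rintro rfl; exact hne (by rw [hq, mul_zero])
    have hdeg := congrArg Polynomial.natDegree hq
    rw [Polynomial.natDegree_comp, Polynomial.natDegree_C_mul_X _ hζ0, mul_one,
      Polynomial.natDegree_mul ha hq0] at hdeg
    obtain ⟨c, rfl⟩ := Polynomial.natDegree_eq_zero.1 (by omega : q.natDegree = 0)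
    refine ⟨c, hq, mul_left_cancel₀ ha ?_⟩
    rw [← h, hq]
    ring
  have hca' : ∀ n, a.coeff n * ζ ^ n = a.coeff n * c := fun n => by
    rw [← Polynomial.comp_C_mul_X_coeff, hca, Polynomial.coeff_mul_C]
  have hcb' : ∀ n, b.coeff n * ζ ^ n = b.coeff n * c := fun n => by
    rw [← Polynomial.comp_C_mul_X_coeff, hcb, Polynomial.coeff_mul_C]
  -- the coefficients of degree `0` do not both vanish, so `c = 1`
  have hc : c = 1 := by
    by_contra hc
    have key : ∀ x : ℂ, x * ζ ^ 0 = x * c → x = 0 := fun x hx =>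
      (mul_eq_zero.1 (by linear_combination hx : x * (1 - c) = 0)).resolve_right
        (sub_ne_zero.2 (Ne.symm hc))
    obtain ⟨u, v, huv⟩ := hab
    have := congrArg (Polynomial.eval 0) huv
    simp [← Polynomial.coeff_zero_eq_eval_zero, key _ (hca' 0), key _ (hcb' 0)] at this
  have key : ∀ x : ℂ, x * ζ ^ k = x * c → x = 0 := fun x hx =>
    (mul_eq_zero.1 (by rw [hc] at hx; linear_combination hx : x * (ζ ^ k - 1) = 0)).resolve_right
      (sub_ne_zero.2 (hζ k hk0 hkd))
  exact ⟨key _ (hca' k), key _ (hcb' k)⟩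

/-- A binary form whose dehomogenization in the basis `v₁, v₂` only has coefficients of degree `0`
and `d` is a combination of `d`-th powers of the coordinates in this basis. -/
lemma bev_eq_of_coeff {F : MvPolynomial (Fin 2) ℂ} {d : ℕ} (hd : d ≠ 0) (hF : F.IsHomogeneous d)
    (v₁ v₂ : ℂ × ℂ)
    (h : ∀ k, 0 < k → k < d → (bev F (Polynomial.C v₁.1 + Polynomial.C v₂.1 * Polynomial.X)
      (Polynomial.C v₁.2 + Polynomial.C v₂.2 * Polynomial.X)).coeff k = 0) (x y : ℂ) :
    bev F (x * v₁.1 + y * v₂.1) (x * v₁.2 + y * v₂.2) =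
      bev F v₁.1 v₁.2 * x ^ d + bev F v₂.1 v₂.2 * y ^ d := by
  set P := bev F (Polynomial.C v₁.1 + Polynomial.C v₂.1 * Polynomial.X)
      (Polynomial.C v₁.2 + Polynomial.C v₂.2 * Polynomial.X) with hP
  have hPe : ∀ s, P.eval s = bev F (v₁.1 + v₂.1 * s) (v₁.2 + v₂.2 * s) := fun s => by
    rw [hP, eval_bev]; simp
  have hP0 : P.coeff 0 = bev F v₁.1 v₁.2 := by
    rw [Polynomial.coeff_zero_eq_eval_zero, hPe]; simp
  have hPd : P.coeff d = bev F v₂.1 v₂.2 := coeff_bev_linear hF _ _ _ _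
  have hPs : ∀ s, P.eval s = bev F v₁.1 v₁.2 + bev F v₂.1 v₂.2 * s ^ d := fun s => by
    obtain ⟨e, rfl⟩ := Nat.exists_eq_succ_of_ne_zero hd
    rw [Polynomial.eval_eq_sum_range' (Nat.lt_succ_of_le (natDegree_bev_linear_le hF _ _ _ _)),
      Finset.sum_range_succ, Finset.sum_range_succ', hPd, hP0, Finset.sum_eq_zero, zero_add,
      pow_zero, mul_one]
    intro k hk
    rw [h (k + 1) (Nat.succ_pos k) (by have := Finset.mem_range.1 hk; omega), zero_mul]
  by_cases hx : x = 0
  · rw [hx, zero_mul, zero_mul, zero_add, zero_add, bev_smul hF, zero_pow hd]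
    ring
  · have h1 := bev_smul hF x (v₁.1 + v₂.1 * (y / x)) (v₁.2 + v₂.2 * (y / x))
    have e : ∀ a b : ℂ, x * (a + b * (y / x)) = x * a + y * b := fun a b => by
      field_simp
    rw [e, e, ← hPe, hPs] at h1
    rw [h1, div_pow]
    have := pow_ne_zero d hx
    field_simp

namespace HomogeneousFoliation

variable {d : ℕ} {H : HomogeneousFoliation d}

lemma exists_eigenform (M : Matrix (Fin 2) (Fin 2) ℂ) :
    ∃ (l : ℂ × ℂ) (a : ℂ), l ≠ 0 ∧ linComp l M = a • l := by
  obtain ⟨a, ha⟩ : ∃ a : ℂ, a * a - (M 0 0 + M 1 1) * a + M.det = 0 := by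
    have hq : (1 : ℂ) ≠ 0 := one_ne_zero
    obtain ⟨s, hs⟩ := IsAlgClosed.exists_eq_mul_self
      (discrim 1 (-(M 0 0 + M 1 1)) M.det)
    refine ⟨(-(-(M 0 0 + M 1 1)) + s) / (2 * 1), ?_⟩
    have := (quadratic_eq_zero_iff hq hs ((-(-(M 0 0 + M 1 1)) + s) / (2 * 1))).2 (Or.inl rfl)
    linear_combination this
  rw [Matrix.det_fin_two] at ha
  by_cases h0 : M 1 0 = 0 ∧ a = M 0 0
  · by_cases h1 : M 0 1 = 0 ∧ a = M 1 1
    · refine ⟨(1, 0), a, by simp, ?_⟩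
      ext <;> simp [linComp, h0.2, h1.1]
    · refine ⟨(M 1 1 - a, -M 0 1), a, fun h => h1 ?_, ?_⟩
      · obtain ⟨h2, h3⟩ := Prod.mk.inj h
        exact ⟨neg_eq_zero.1 h3, (sub_eq_zero.1 h2).symm⟩
      · ext
        · simp only [linComp, Prod.smul_fst, smul_eq_mul]
          linear_combination ha
        · simp only [linComp, Prod.smul_snd, smul_eq_mul]
          ring
  · refine ⟨(M 1 0, a - M 0 0), a, fun h => h0 ?_, ?_⟩
    · obtain ⟨h2, h3⟩ := Prod.mk.inj h
      exact ⟨h2, sub_eq_zero.1 h3⟩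
    · ext
      · simp only [linComp, Prod.smul_fst, smul_eq_mul]
        ring
      · simp only [linComp, Prod.smul_snd, smul_eq_mul]
        linear_combination -ha

/-- The matrix of a nontrivial element of the Galois group is diagonalizable, because this element
has finite order. -/
lemma IsMobius.exists_diagonalization (hd : d ≠ 0) {σ : H.galoisGroup}
    {M : Matrix (Fin 2) (Fin 2) ℂ} (hM : IsMobius σ M) (hdet : M.det ≠ 0) (hσ : σ ≠ 1) :
    ∃ (l l' : ℂ × ℂ) (a b : ℂ), bracket l l' ≠ 0 ∧ a ≠ 0 ∧ b ≠ 0 ∧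
      linComp l M = a • l ∧ linComp l' M = b • l' := by
  obtain ⟨l', b, hl', hb⟩ := exists_eigenform M
  obtain ⟨u, hu⟩ := exists_bracket_ne_zero hl'
  obtain ⟨a, c, hac⟩ := exists_decomposition hu (linComp u M)
  have hab : a * b = M.det := by
    refine mul_right_cancel₀ hu ?_
    rw [← bracket_linComp, hb, hac]
    simp only [bracket, Prod.fst_add, Prod.snd_add, Prod.smul_fst, Prod.smul_snd, smul_eq_mul]
    ring
  have ha0 : a ≠ 0 := fun h => hdet (by rw [← hab, h, zero_mul])
  have hb0 : b ≠ 0 := fun h => hdet (by rw [← hab, h, mul_zero])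
  have hne : a - b ≠ 0 := fun h => hσ <| by
    obtain rfl := sub_eq_zero.1 h
    exact eq_one_of_unipotent hd hM hu ha0 hb hac
  refine ⟨u + (c / (a - b)) • l', l', a, b, ?_, ha0, hb0, ?_, hb⟩
  · convert hu using 1
    simp only [bracket, Prod.fst_add, Prod.snd_add, Prod.smul_fst, Prod.smul_snd, smul_eq_mul]
    ring
  · have e : linComp (u + (c / (a - b)) • l') M = linComp u M + (c / (a - b)) • linComp l' M := by
      ext <;>
      · simp only [linComp, Prod.fst_add, Prod.snd_add, Prod.smul_fst, Prod.smul_snd, smul_eq_mul]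
        ring
    rw [e, hac, hb]
    have e2 : c = (c / (a - b)) * (a - b) := (div_mul_cancel₀ _ hne).symm
    generalize c / (a - b) = k at *
    subst e2
    ext <;>
    · simp only [Prod.fst_add, Prod.snd_add, Prod.smul_fst, Prod.smul_snd, smul_eq_mul]
      ring

/-- Normal form of the foliations having a diagonal symmetry of order at least `d`. -/
lemma exists_isDiagonal_of_isSymmetry (hd : d ≠ 0) {M : Matrix (Fin 2) (Fin 2) ℂ}
    (hM : H.IsSymmetry M) {l l' : ℂ × ℂ} {α β : ℂ} (hl : bracket l l' ≠ 0) (hα : α ≠ 0)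
    (hβ : β ≠ 0) (h1 : linComp l M = α • l) (h2 : linComp l' M = β • l')
    (hζ : ∀ k, 0 < k → k < d → (β / α) ^ k ≠ 1) : ∃ n n', H.IsDiagonal l l' n n' := by
  obtain ⟨v₁, h11, h12⟩ := exists_linAp_eq hl 1 0
  obtain ⟨v₂, h21, h22⟩ := exists_linAp_eq hl 0 1
  have hext : ∀ v w : ℂ × ℂ, linAp l v = linAp l w → linAp l' v = linAp l' w → v = w :=
    fun v w e e' => sub_eq_zero.1 <| eq_zero_of_linAp hl
      (by simp only [linAp, Prod.fst_sub, Prod.snd_sub] at *; linear_combination e)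
      (by simp only [linAp, Prod.fst_sub, Prod.snd_sub] at *; linear_combination e')
  have hlin : ∀ (k : ℂ × ℂ) (x y : ℂ), linAp k (x * v₁.1 + y * v₂.1, x * v₁.2 + y * v₂.2) =
      x * linAp k v₁ + y * linAp k v₂ := fun k x y => by
    simp only [linAp]; ring
  have hdec : ∀ v : ℂ × ℂ, v = (linAp l v * v₁.1 + linAp l' v * v₂.1,
      linAp l v * v₁.2 + linAp l' v * v₂.2) := fun v => by
    refine hext _ _ ?_ ?_
    · rw [hlin, h11, h21]; ring
    · rw [hlin, h12, h22]; ring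
  have hMv : ∀ x y : ℂ, matAct M (x * v₁.1 + y * v₂.1, x * v₁.2 + y * v₂.2) =
      (α * x * v₁.1 + β * y * v₂.1, α * x * v₁.2 + β * y * v₂.2) := fun x y => by
    refine hext _ _ ?_ ?_
    · rw [linAp_matAct, h1, hlin, hlin, linAp_smul, linAp_smul, h11, h21]
      ring
    · rw [linAp_matAct, h2, hlin, hlin, linAp_smul, linAp_smul, h12, h22]
      ring
  let P : MvPolynomial (Fin 2) ℂ → Polynomial ℂ := fun F =>
    bev F (Polynomial.C v₁.1 + Polynomial.C v₂.1 * Polynomial.X)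
      (Polynomial.C v₁.2 + Polynomial.C v₂.2 * Polynomial.X)
  have hPe : ∀ F s, (P F).eval s = bev F (v₁.1 + s * v₂.1) (v₁.2 + s * v₂.2) := fun F s => by
    simp only [P]; rw [eval_bev]; simp [mul_comm s]
  have hcop : IsCoprime (P H.A) (P H.B) := by
    rw [Polynomial.isCoprime_iff_aeval_ne_zero_of_isAlgClosed ℂ ℂ]
    intro s
    by_contra! h
    rw [Polynomial.coe_aeval_eq_eval, hPe, hPe] at h
    have h0 := hlin l 1 s
    simp only [one_mul] at h0
    rw [H.eq_zero_of_bev h.1 h.2, h11, h21] at h0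
    simp [linAp] at h0
  have hcomp : (P H.A).comp (Polynomial.C (β / α) * Polynomial.X) * P H.B =
      P H.A * (P H.B).comp (Polynomial.C (β / α) * Polynomial.X) := by
    refine Polynomial.funext fun s => ?_
    simp only [Polynomial.eval_mul, Polynomial.eval_comp, Polynomial.eval_C, Polynomial.eval_X, hPe]
    have h3 := hM.2 (1 * v₁.1 + s * v₂.1, 1 * v₁.2 + s * v₂.2)
    rw [hMv] at h3
    have e : ∀ a b : ℂ, α * 1 * a + β * s * b = α * (a + β / α * s * b) := fun a b => by
      field_simp
    simp only [e, one_mul] at h3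
    rw [bev_smul H.homogeneous_A, bev_smul H.homogeneous_B] at h3
    refine mul_left_cancel₀ (pow_ne_zero d hα) ?_
    linear_combination h3
  have hmid := fun k hk0 hkd =>
    coeff_eq_zero_of_comp_eq hcop (div_ne_zero hβ hα) hζ hcomp (k := k) hk0 hkd
  have hA : ∀ v : ℂ × ℂ, bev H.A v.1 v.2 =
      bev H.A v₁.1 v₁.2 * linAp l v ^ d + bev H.A v₂.1 v₂.2 * linAp l' v ^ d := fun v => by
    conv_lhs => rw [hdec v]
    exact bev_eq_of_coeff hd H.homogeneous_A v₁ v₂ (fun k h h' => (hmid k h h').1) _ _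
  have hB : ∀ v : ℂ × ℂ, bev H.B v.1 v.2 =
      bev H.B v₁.1 v₁.2 * linAp l v ^ d + bev H.B v₂.1 v₂.2 * linAp l' v ^ d := fun v => by
    conv_lhs => rw [hdec v]
    exact bev_eq_of_coeff hd H.homogeneous_B v₁ v₂ (fun k h h' => (hmid k h h').2) _ _
  refine ⟨(bev H.A v₁.1 v₁.2, bev H.B v₁.1 v₁.2), (bev H.A v₂.1 v₂.2, bev H.B v₂.1 v₂.2), hl,
    fun h0 => ?_, fun v => ⟨hA v, hB v⟩⟩
  -- otherwise `A` and `B` are proportional and have a common zero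
  set n : ℂ × ℂ := (bev H.A v₁.1 v₁.2, bev H.B v₁.1 v₁.2)
  set n' : ℂ × ℂ := (bev H.A v₂.1 v₂.2, bev H.B v₂.1 v₂.2)
  have hn0 : n ≠ 0 := fun h => by
    have h3 : v₁ = 0 := H.eq_zero_of_bev (congrArg Prod.fst h) (congrArg Prod.snd h)
    simp [h3, linAp] at h11
  obtain ⟨x, hx⟩ : ∃ x : ℂ, n' = x • n := by
    by_cases hn' : n' = 0
    · exact ⟨0, by rw [hn', zero_smul]⟩
    · obtain ⟨c, -, hc⟩ := exists_smul_of_bracket hn0 hn'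
        (by simp only [bracket] at h0 ⊢; linear_combination -h0)
      exact ⟨c, hc⟩
  obtain ⟨s, hs⟩ := IsAlgClosed.exists_pow_nat_eq (-x) (Nat.pos_of_ne_zero hd)
  obtain ⟨v, hv, hv'⟩ := exists_linAp_eq hl s 1
  have hx1 : n'.1 = x * n.1 := by rw [hx]; rfl
  have hx2 : n'.2 = x * n.2 := by rw [hx]; rfl
  have hv0 : v = 0 := by
    refine H.eq_zero_of_bev (x := v.1) (y := v.2) ?_ ?_
    · rw [hA, hv, hv', hs, one_pow]; linear_combination hx1
    · rw [hB, hv, hv', hs, one_pow]; linear_combination hx2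
  simp [hv0, linAp] at hv'

/-- If the Galois group is cyclic of order at least `d`, then the foliation is of the form
`ℓᵈ ν + ℓ'ᵈ ν'`. -/
lemma exists_isDiagonal_of_isCyclic (hd : 2 ≤ d) (hcyc : IsCyclic H.galoisGroup)
    (hcard : d ≤ Nat.card H.galoisGroup) : ∃ l l' n n', H.IsDiagonal l l' n n' := by
  have hd0 : d ≠ 0 := by omega
  have := finite_galoisGroup (H := H) hd0
  obtain ⟨σ, hσ⟩ := hcyc.exists_generator
  have hord : orderOf σ = Nat.card H.galoisGroup := orderOf_eq_card_of_forall_mem_zpowers hσ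
  have hne : ∀ k, 0 < k → k < d → σ ^ k ≠ 1 := fun k hk0 hkd h => by
    have := Nat.le_of_dvd hk0 (orderOf_dvd_of_pow_eq_one h)
    omega
  obtain ⟨M, hdet, hM⟩ := exists_isMobius σ
  obtain ⟨l, l', α, β, hl, hα, hβ, h1, h2⟩ := hM.exists_diagonalization hd0 hdet
    (by simpa using hne 1 one_pos (by omega))
  have hpow : ∀ k : ℕ, (σ ^ k) (linEv l / linEv l') =
      algebraMap ℂ (RatFunc ℂ) ((α / β) ^ k) * (linEv l / linEv l') := fun k => by
    induction k with
    | zero => simp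
    | succ k ih =>
      rw [pow_succ', AlgEquiv.mul_apply, ih, map_mul, galois_algebraMap,
        map_div_of_diagonal hM h1 h2, ← mul_assoc, ← map_mul, pow_succ]
  obtain ⟨n, n', h⟩ := exists_isDiagonal_of_isSymmetry hd0
    (isSymmetry_of_isMobius hd0 hdet hM) hl hα hβ h1 h2 fun k hk0 hkd h => by
      refine hne k hk0 hkd (eq_one_of_fixes hl ?_)
      rw [hpow, ← inv_div β α, inv_pow, h, inv_one, map_one, one_mul]
  exact ⟨l, l', n, n', h⟩

/-! ### Linear conjugacy with the two models -/

lemma linearlyConjugate_iff {H' : HomogeneousFoliation d} :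
    H.LinearlyConjugate H' ↔ ∃ (M : GL (Fin 2) ℂ) (c : ℂ), c ≠ 0 ∧ ∀ x y : ℂ,
      M 0 0 * bev H.A (M 0 0 * x + M 0 1 * y) (M 1 0 * x + M 1 1 * y) +
        M 1 0 * bev H.B (M 0 0 * x + M 0 1 * y) (M 1 0 * x + M 1 1 * y) = c * bev H'.A x y ∧
      M 0 1 * bev H.A (M 0 0 * x + M 0 1 * y) (M 1 0 * x + M 1 1 * y) +
        M 1 1 * bev H.B (M 0 0 * x + M 0 1 * y) (M 1 0 * x + M 1 1 * y) = c * bev H'.B x y := by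
  refine exists_congr fun M => exists_congr fun c => and_congr_right fun _ => ?_
  have hφ : ∀ F : MvPolynomial (Fin 2) ℂ, aeval (fun i : Fin 2 =>
      (C (M i 0) * X 0 + C (M i 1) * X 1 : MvPolynomial (Fin 2) ℂ)) F =
      bev F (C (M 0 0) * X 0 + C (M 0 1) * X 1) (C (M 1 0) * X 0 + C (M 1 1) * X 1) := fun F => by
    rw [bev]
    congr 2
    funext i; fin_cases i <;> rfl
  simp only [hφ]
  have key : ∀ (a b c : ℂ) (G : MvPolynomial (Fin 2) ℂ),
      C a * bev H.A (C (M 0 0) * X 0 + C (M 0 1) * X 1) (C (M 1 0) * X 0 + C (M 1 1) * X 1) +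
        C b * bev H.B (C (M 0 0) * X 0 + C (M 0 1) * X 1) (C (M 1 0) * X 0 + C (M 1 1) * X 1) =
          C c * G ↔ ∀ x y : ℂ,
      a * bev H.A (M 0 0 * x + M 0 1 * y) (M 1 0 * x + M 1 1 * y) +
        b * bev H.B (M 0 0 * x + M 0 1 * y) (M 1 0 * x + M 1 1 * y) = c * bev G x y :=
    fun a b c G => by
      refine ⟨fun h x y => ?_, fun h => eq_of_bev_eq fun x y => ?_⟩
      · simpa [bev_bev] using congrArg (fun F => bev F x y) h
      · simpa [bev_bev] using h x y
  rw [key, key, ← forall_and]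
  simp only [forall_and]

variable {l l' n n' : ℂ × ℂ}

/-- In the coordinates `ℓ = x`, `ℓ' = s y`, the form `ℓᵈ ν + ℓ'ᵈ ν'` becomes
`xᵈ ν + sᵈ yᵈ ν'`. -/
lemma IsDiagonal.exists_coordinates (h : H.IsDiagonal l l' n n') {s : ℂ} (hs : s ≠ 0) :
    ∃ (M : GL (Fin 2) ℂ), (∀ a b : ℂ, (a • l).1 * M 0 0 + (a • l).2 * M 1 0 = a ∧
      (a • l).1 * M 0 1 + (a • l).2 * M 1 1 = 0 ∧
      (b • l').1 * M 0 0 + (b • l').2 * M 1 0 = 0 ∧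
      (b • l').1 * M 0 1 + (b • l').2 * M 1 1 = b * s) ∧
      ∀ x y : ℂ,
      bev H.A (M 0 0 * x + M 0 1 * y) (M 1 0 * x + M 1 1 * y) =
        n.1 * x ^ d + n'.1 * (s * y) ^ d ∧
      bev H.B (M 0 0 * x + M 0 1 * y) (M 1 0 * x + M 1 1 * y) =
        n.2 * x ^ d + n'.2 * (s * y) ^ d := by
  obtain ⟨f, hf, hf'⟩ := exists_linAp_eq h.1 1 0
  obtain ⟨g, hg, hg'⟩ := exists_linAp_eq h.1 0 s
  have hdet : (!![f.1, g.1; f.2, g.2] : Matrix (Fin 2) (Fin 2) ℂ).det ≠ 0 := fun h0 => by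
    have h1 := bracket_mul_eq l l' f g
    rw [Matrix.det_fin_two_of] at h0
    rw [hf, hf', hg, hg'] at h1
    simp only [bracket] at h1
    refine hs ?_
    linear_combination -h1 + (l.1 * l'.2 - l.2 * l'.1) * h0
  refine ⟨Matrix.GeneralLinearGroup.mkOfDetNeZero _ hdet, fun a b => ?_, fun x y => ?_⟩
  · simp only [linAp] at hf hf' hg hg'
    refine ⟨?_, ?_, ?_, ?_⟩
    · change a * l.1 * f.1 + a * l.2 * f.2 = a
      linear_combination a * hf
    · change a * l.1 * g.1 + a * l.2 * g.2 = 0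
      linear_combination a * hg
    · change b * l'.1 * f.1 + b * l'.2 * f.2 = 0
      linear_combination b * hf'
    · change b * l'.1 * g.1 + b * l'.2 * g.2 = b * s
      linear_combination b * hg'
  · have e := h.2.2 (f.1 * x + g.1 * y, f.2 * x + g.2 * y)
    have e1 : linAp l (f.1 * x + g.1 * y, f.2 * x + g.2 * y) = x := by
      simp only [linAp] at *; linear_combination x * hf + y * hg
    have e2 : linAp l' (f.1 * x + g.1 * y, f.2 * x + g.2 * y) = s * y := by
      simp only [linAp] at *; linear_combination x * hf' + y * hg'
    rw [e1, e2] at e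
    exact e

/-- If `ν ν'` is proportional to `ℓ ℓ'`, then `ℓᵈ ν + ℓ'ᵈ ν'` is linearly conjugate to one of the
two models. -/
lemma IsDiagonal.linearlyConjugate (hd : 2 ≤ d) (h : H.IsDiagonal l l' n n') {g : ℂ} (hg0 : g ≠ 0)
    (hg : ∀ p, linAp l (1, p) * linAp l' (1, p) = g * (linAp n (1, p) * linAp n' (1, p))) :
    H.LinearlyConjugate (H₁ d) ∨ H.LinearlyConjugate (H₂ d) := by
  have hl := ne_zero_of_bracket h.1
  have hl' := ne_zero_of_bracket h.symm.1
  have hn := ne_zero_of_bracket h.2.1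
  have hn' := ne_zero_of_bracket h.symm.2.1
  have hg0' := hg 0
  have hg1 := hg 1
  have hg2 := hg (-1)
  have hall : ∀ v, linAp l v * linAp l' v = g * (linAp n v * linAp n' v) := fun v => by
    simp only [linAp] at *
    linear_combination (v.1 ^ 2 - v.2 ^ 2) * hg0' + (v.1 * v.2 + v.2 ^ 2) / 2 * hg1 +
      (v.2 ^ 2 - v.1 * v.2) / 2 * hg2
  -- the factors of the quadratic form `ν ν'` are those of `ℓ ℓ'`
  have hz : ∀ k : ℂ × ℂ, linAp l (k.2, -k.1) * linAp l' (k.2, -k.1) = 0 →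
      bracket n k = 0 ∨ bracket n' k = 0 := fun k hk => by
    rw [hall, mul_eq_zero, mul_eq_zero] at hk
    refine (hk.resolve_left hg0).imp (fun h => ?_) (fun h => ?_) <;>
    · simp only [linAp] at h
      simp only [bracket]
      linear_combination h
  have hzl := hz l (by simp only [linAp]; ring)
  have hzl' := hz l' (by simp only [linAp]; ring)
  have hb : ∀ (c : ℂ) {k : ℂ × ℂ}, k = c • l → bracket k l' = 0 → c = 0 := fun c k hk h0 => by
    rw [hk, bracket_smul_left] at h0
    exact (mul_eq_zero.1 h0).resolve_right h.1
  rcases hzl with h1 | h1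
  · obtain ⟨c, hc, hcn⟩ := exists_smul_of_bracket hl hn h1
    obtain ⟨c', hc', hcn'⟩ := exists_smul_of_bracket hl' hn'
      (hzl'.resolve_left fun h0 => hc (hb c hcn h0))
    right
    obtain ⟨s, hs⟩ := IsAlgClosed.exists_pow_nat_eq (-(c / c')) (Nat.succ_pos d)
    have hs0 : s ≠ 0 := by
      rintro rfl
      rw [zero_pow (Nat.succ_ne_zero d)] at hs
      exact div_ne_zero hc hc' (neg_eq_zero.1 hs.symm)
    have hs' : c' * s ^ (d + 1) = -c := by rw [hs]; field_simp
    obtain ⟨M, hM, hMAB⟩ := h.exists_coordinates hs0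
    obtain ⟨e1, e2, e3, e4⟩ := hM c c'
    rw [← hcn, ← hcn'] at *
    refine linearlyConjugate_iff.2 ⟨M, c, hc, fun x y => ?_⟩
    rw [(hMAB x y).1, (hMAB x y).2]
    simp only [H₂, bev_neg, bev_pow, bev_X_zero, bev_X_one]
    constructor
    · linear_combination x ^ d * e1 + (s * y) ^ d * e3
    · rw [mul_pow]
      linear_combination x ^ d * e2 + (s ^ d * y ^ d) * e4 + y ^ d * hs'
  · obtain ⟨c', hc', hcn'⟩ := exists_smul_of_bracket hl hn' h1
    obtain ⟨c, hc, hcn⟩ := exists_smul_of_bracket hl' hn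
      (hzl'.resolve_right fun h0 => hc' (hb c' hcn' h0))
    left
    obtain ⟨s, hs⟩ := IsAlgClosed.exists_pow_nat_eq (-(c / c')) (n := d - 1) (by omega)
    have hs0 : s ≠ 0 := by
      rintro rfl
      rw [zero_pow (by omega)] at hs
      exact div_ne_zero hc hc' (neg_eq_zero.1 hs.symm)
    have hs' : c' * s ^ d = -(c * s) := by
      obtain ⟨e, rfl⟩ : ∃ e, d = e + 1 := ⟨d - 1, by omega⟩
      rw [Nat.add_sub_cancel] at hs
      rw [pow_succ, hs]
      field_simp
    obtain ⟨M, hM, hMAB⟩ := h.exists_coordinates hs0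
    obtain ⟨e1, e2, e3, e4⟩ := hM c' c
    rw [← hcn, ← hcn'] at *
    refine linearlyConjugate_iff.2 ⟨M, c' * s ^ d, mul_ne_zero hc' (pow_ne_zero _ hs0),
      fun x y => ?_⟩
    rw [(hMAB x y).1, (hMAB x y).2]
    simp only [H₁, bev_neg, bev_pow, bev_X_zero, bev_X_one, mul_pow]
    constructor
    · linear_combination x ^ d * e3 + (s ^ d * y ^ d) * e1
    · linear_combination x ^ d * e4 + (s ^ d * y ^ d) * e2 + x ^ d * hs'

/-- A foliation linearly conjugate to `H'` has the form `c A'(ℓ, ℓ') ℓ + c B'(ℓ, ℓ') ℓ'`, where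
`ℓ, ℓ'` are the rows of the inverse matrix. -/
lemma LinearlyConjugate.exists_linAp {H' : HomogeneousFoliation d} (h : H.LinearlyConjugate H') :
    ∃ (l l' : ℂ × ℂ) (c : ℂ), bracket l l' ≠ 0 ∧ c ≠ 0 ∧ ∀ v : ℂ × ℂ,
      bev H.A v.1 v.2 = c * (bev H'.A (linAp l v) (linAp l' v) * l.1 +
        bev H'.B (linAp l v) (linAp l' v) * l'.1) ∧
      bev H.B v.1 v.2 = c * (bev H'.A (linAp l v) (linAp l' v) * l.2 +
        bev H'.B (linAp l v) (linAp l' v) * l'.2) := by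
  obtain ⟨M, c, hc, hM⟩ := linearlyConjugate_iff.1 h
  have hdet : M 0 0 * M 1 1 - M 0 1 * M 1 0 ≠ 0 := by
    rw [← Matrix.det_fin_two]
    exact M.det.ne_zero
  set δ := M 0 0 * M 1 1 - M 0 1 * M 1 0 with hδ
  refine ⟨(M 1 1 / δ, -M 0 1 / δ), (-M 1 0 / δ, M 0 0 / δ), c, ?_, hc, fun v => ?_⟩
  · have : bracket (M 1 1 / δ, -M 0 1 / δ) (-M 1 0 / δ, M 0 0 / δ) = 1 / δ := by
      simp only [bracket]
      field_simp
      rw [hδ]; ring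
    rw [this]
    exact one_div_ne_zero hdet
  · have h1 := hM (linAp (M 1 1 / δ, -M 0 1 / δ) v) (linAp (-M 1 0 / δ, M 0 0 / δ) v)
    have e1 : M 0 0 * linAp (M 1 1 / δ, -M 0 1 / δ) v +
        M 0 1 * linAp (-M 1 0 / δ, M 0 0 / δ) v = v.1 := by
      simp only [linAp]
      field_simp
      rw [hδ]; ring
    have e2 : M 1 0 * linAp (M 1 1 / δ, -M 0 1 / δ) v +
        M 1 1 * linAp (-M 1 0 / δ, M 0 0 / δ) v = v.2 := by
      simp only [linAp]
      field_simp
      rw [hδ]; ring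
    rw [e1, e2] at h1
    obtain ⟨h2, h3⟩ := h1
    generalize bev H'.A (linAp (M 1 1 / δ, -M 0 1 / δ) v) (linAp (-M 1 0 / δ, M 0 0 / δ) v) = a at *
    generalize bev H'.B (linAp (M 1 1 / δ, -M 0 1 / δ) v) (linAp (-M 1 0 / δ, M 0 0 / δ) v) = b at *
    constructor
    · field_simp
      rw [hδ]
      linear_combination M 1 1 * h2 - M 1 0 * h3
    · field_simp
      rw [hδ]
      linear_combination M 0 0 * h3 - M 0 1 * h2

lemma LinearlyConjugate.legIsFlat_H₁ (hd : 2 ≤ d) (h : H.LinearlyConjugate (H₁ d)) :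
    H.LegIsFlat := by
  obtain ⟨l, l', c, hl, hc, hAB⟩ := h.exists_linAp
  have hdiag : H.IsDiagonal l l' (-c • l') (c • l) := by
    refine ⟨hl, ?_, fun v => ?_⟩
    · have : bracket (-c • l') (c • l) = c ^ 2 * bracket l l' := by
        simp only [bracket, Prod.smul_fst, Prod.smul_snd, smul_eq_mul]; ring
      rw [this]
      exact mul_ne_zero (pow_ne_zero _ hc) hl
    · rw [(hAB v).1, (hAB v).2]
      simp only [H₁, bev_neg, bev_pow, bev_X_zero, bev_X_one, Prod.smul_fst, Prod.smul_snd,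
        smul_eq_mul]
      constructor <;> ring
  refine hdiag.legIsFlat hd (g := -1 / c ^ 2) fun p => ?_
  simp only [linAp, Prod.smul_fst, Prod.smul_snd, smul_eq_mul]
  field_simp
  ring

lemma LinearlyConjugate.legIsFlat_H₂ (hd : 2 ≤ d) (h : H.LinearlyConjugate (H₂ d)) :
    H.LegIsFlat := by
  obtain ⟨l, l', c, hl, hc, hAB⟩ := h.exists_linAp
  have hdiag : H.IsDiagonal l l' (c • l) (-c • l') := by
    refine ⟨hl, ?_, fun v => ?_⟩
    · have : bracket (c • l) (-c • l') = -c ^ 2 * bracket l l' := by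
        simp only [bracket, Prod.smul_fst, Prod.smul_snd, smul_eq_mul]; ring
      rw [this]
      exact mul_ne_zero (neg_ne_zero.2 (pow_ne_zero _ hc)) hl
    · rw [(hAB v).1, (hAB v).2]
      simp only [H₂, bev_neg, bev_pow, bev_X_zero, bev_X_one, Prod.smul_fst, Prod.smul_snd,
        smul_eq_mul]
      constructor <;> ring
  refine hdiag.legIsFlat hd (g := -1 / c ^ 2) fun p => ?_
  simp only [linAp, Prod.smul_fst, Prod.smul_snd, smul_eq_mul]
  field_simp
  ring

end HomogeneousFoliation

end HomFol

theorem theorem4p3 (d : ℕ) (hd : 3 ≤ d) (H : HomFol.HomogeneousFoliation d)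
    (hGal : H.IsGaloisFoliation) :
    (IsCyclic H.galoisGroup →
      (H.LegIsFlat ↔
        H.LinearlyConjugate (HomFol.H₁ d) ∨ H.LinearlyConjugate (HomFol.H₂ d))) ∧
    (¬ IsCyclic H.galoisGroup → H.LegIsFlat) := by
  have hd2 : 2 ≤ d := by omega
  refine ⟨fun hcyc => ⟨fun hflat => ?_, fun h => ?_⟩, H.legIsFlat_of_not_isCyclic hd2⟩
  · obtain ⟨l, l', n, n', h⟩ :=
      HomFol.HomogeneousFoliation.exists_isDiagonal_of_isCyclic hd2 hcyc (hGal.le_card hd2)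
    obtain ⟨g, hg0, hg⟩ := h.exists_of_legIsFlat hd hflat
    exact h.linearlyConjugate hd2 hg0 hg
  · exact h.elim (fun h => h.legIsFlat_H₁ hd2) fun h => h.legIsFlat_H₂ hd2
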